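/- Let $n\geqslant 4$, let $\Omega_{n-1}=\{1,\dots,n-1\}$ and let $S_n$ be the star graph with vertex set $V=\{0,1,\dots,n-1\}$ and edges $\{0,i\}$, $1\leqslant i\leqslant n-1$. Partial transformations of $V$ are composed from left to right; $\mathrm{dom}(\alpha)$ and $\mathrm{im}(\alpha)$ are the domain and the image of $\alpha$, and $A\alpha$ is the image of the set $A$ under $\alpha$. A partial transformation $\alpha$ of $V$ is a *partial weak endomorphism* of $S_n$ if, for all $u,v\in\mathrm{dom}(\alpha)$, $\{u,v\}\in E$ and $u\alpha\neq v\alpha$ imply $\{u\alpha,v\alpha\}\in E$, and a *partial strong endomorphism* if, for all $u,v\in\mathrm{dom}(\alpha)$, $\{u,v\}\in E$ if and only if $\{u\alpha,v\alpha\}\in E$ (where $E$ is the edge set). Let $\mathrm{PwEnd}(S_n)$ and $\mathrm{PsEnd}(S_n)$ be the monoids of all of these. Consider the following partial transformations of $V$, defined on all of $V$ except where stated: $a_0$ transposes $1$ and $2$ and fixes the rest; $b_0$ fixes $0$ and is the cycle $1\mapsto2\mapsto\cdots\mapsto n-1\mapsto1$; $e_0$ maps $2$ to $1$ and fixes the rest;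 $f_0$ is the identity on $V\setminus\{1\}$ (undefined at $1$); $c_0$ maps $1$ to $0$ and fixes the rest; $d$ is the identity on $V\setminus\{0\}$ (undefined at $0$); $z$ maps $0$ to $1$ and every other vertex to $0$. For a submonoid $M$ and a set $R$ of relations between words on an alphabet of elements of $M$, say that the presentation $\langle X\mid R\rangle$ *defines* $M$ if the letters, read as elements of $M$, induce an isomorphism $X^*/{\sim_R}\to M$, where $\sim_R$ is the congruence generated by $R$. Let $R_0$ be any set of relations on $\{a_0,b_0,e_0,f_0\}$ such that $\langle a_0,b_0,e_0,f_0\mid R_0\rangle$ defines the monoid of all partial transformations $\alpha$ of $V$ with $0\alpha=0$ and $\Omega_{n-1}\alpha\subseteq\Omega_{n-1}$. Let $R_{\mathrm s}$ be $R_0$ together with $$d^2=d,\quad a_0d=da_0,\quad b_0d=db_0,\quad e_0d=de_0,\quad f_0d=df_0,$$ $$a_0z=z,\quad b_0z=z,\quad e_0z=z,\quad dz=zf_0,\quad zd=(f_0b_0)^{n-1}z,\quad z^2=(e_0b_0)^{n-3}e_0,\quad d(f_0b_0)^{n-1}z=d(f_0b_0)^{n-1},$$ and let $R_{\mathrm w}$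 be $R_{\mathrm s}$ together with the twelve relations $$c_0^2=c_0,\quad e_0c_0=c_0a_0c_0,\quad c_0f_0=c_0,\quad f_0c_0=f_0,\quad c_0d=f_0d,$$ $$c_0b_0^{n-2}a_0b_0=b_0^{n-2}a_0b_0c_0,\quad c_0b_0a_0=b_0a_0c_0,\quad c_0a_0f_0a_0=a_0f_0a_0c_0,$$ $$c_0a_0b_0^{n-2}a_0b_0e_0b_0^{n-2}a_0b_0a_0=a_0b_0^{n-2}a_0b_0e_0b_0^{n-2}a_0b_0a_0c_0,$$ $$c_0zc_0=zc_0,\quad z^2c_0=zc_0,\quad dc_0zb_0^{n-2}=a_0(b_0e_0)^{n-3}dc_0.$$ Then the following hold. 1. The presentation $\langle a_0,b_0,e_0,f_0,c_0,d,z\mid R_{\mathrm w}\rangle$ defines $\mathrm{PwEnd}(S_n)$. 2. Call a set $W$ of words a set of *canonical forms* for a finite monoid $M$ with respect to $R$ if each word is $\sim_R$-congruent to a word in $W$ and $|W|\leqslant|M|$. For $1\leqslant k\leqslant n-1$ let $\sigma_k$ be the permutation of $V$ with $1\mapsto k$ and $j\mapsto j-1$ for $2\leqslant j\leqslant k$ that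 fixes the rest, and let $D_k$ be the set of all $\alpha\in\mathrm{PsEnd}(S_n)$ such that $\{1,\dots,k\}\subseteq\mathrm{im}(\alpha)$ and either $0\in\mathrm{dom}(\alpha)$ and $0\alpha=0$, or $0\notin\mathrm{dom}(\alpha)$ and $|\mathrm{im}(\alpha)|\geqslant2$. Let $D$ be the set of all partial transformations $\alpha$ of $V$ with $0\alpha=0$, $\Omega_{n-1}\alpha\subseteq\{1,2\}$ and $1\in\Omega_{n-1}\alpha$. Let $W_{\mathrm s}$ be any set of canonical forms for $\mathrm{PsEnd}(S_n)$ with respect to $R_{\mathrm s}$, on the alphabet $\{a_0,b_0,e_0,f_0,d,z\}$, that contains the empty word, and let $w_\alpha$ be the word in $W_{\mathrm s}$ that represents $\alpha\in\mathrm{PsEnd}(S_n)$. With $$W_8=\bigcup_{k=1}^{n-1}\{w_\alpha c_0w_{\sigma_k}\mid\alpha\in D_k\},\qquad W_9=\{w_\alpha c_0zb_0^{\ell}\mid\alpha\in D,\ 0\leqslant\ell\leqslant n-2\},$$ the set $W_{\mathrm w}=W_{\mathrm s}\cup W_8\cup W_9$ is a set of canonical forms for $\mathrm{PwEnd}(S_n)$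 with respect to $R_{\mathrm w}$, and $|W_{\mathrm w}|=|\mathrm{PwEnd}(S_n)|$. 3. For $1\leqslant k\leqslant n-1$ let $\Gamma_k$ be the set of all $\alpha\in\mathrm{PwEnd}(S_n)\setminus\mathrm{PsEnd}(S_n)$ such that $k=\min(\Omega_{n-1}\setminus\Omega_{n-1}\alpha)$ and either $0\notin\mathrm{dom}(\alpha)$ or $0\alpha=0$. Then $\alpha\mapsto\alpha c_0\sigma_k$ is a bijection from $D_k$ onto $\Gamma_k$. 4. If $\Gamma_0$ is the set of all $\alpha\in\mathrm{PwEnd}(S_n)\setminus\mathrm{PsEnd}(S_n)$ with $0\in\mathrm{dom}(\alpha)$ and $0\alpha\neq0$, then $|\Gamma_0|=(n-1)|D|$. -/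

import Mathlib

namespace StarEnd

/-- A partial transformation `α` of `V`: `α x = some y` means that `x` lies in the domain and
`x α = y`, and `α x = none` means that `x` is not in the domain. -/
@[ext]
structure PT (V : Type*) where
  /-- The underlying function with values in `Option V`. -/
  toFun : V → Option V

namespace PT

variable {V : Type*}

instance : CoeFun (PT V) fun _ => V → Option V := ⟨PT.toFun⟩

/-- Partial transformations form a monoid under composition, written from left to right:
`x (α β) = (x α) β`. -/
instance : Monoid (PT V) where
  mul α β := ⟨fun x => (α x).bind β⟩
  one := ⟨fun x => some x⟩
  mul_assoc α β γ := PT.ext (funext fun x => Option.bind_assoc (α x) β γ)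
  one_mul _ := rfl
  mul_one α := PT.ext (funext fun x => Option.bind_fun_some (α x))

theorem one_apply (x : V) : (1 : PT V) x = some x := rfl

theorem mul_apply (α β : PT V) (x : V) : (α * β) x = (α x).bind β := rfl

/-- The domain of a partial transformation. -/
def dom (α : PT V) : Set V := {x | ∃ y, α x = some y}

/-- The image `A α` of a set `A` under a partial transformation `α`. -/
def imageOf (α : PT V) (A : Set V) : Set V := {y | ∃ x ∈ A, α x = some y}

/-- The image of a partial transformation. -/
def im (α : PT V) : Set V := α.imageOf Set.univ

end PT

/-- The monoid of partial weak endomorphisms of a graph. -/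
def PwEnd {V : Type*} (G : SimpleGraph V) : Submonoid (PT V) where
  carrier := {α | ∀ u v u' v' : V, α u = some u' → α v = some v' →
    G.Adj u v → u' ≠ v' → G.Adj u' v'}
  one_mem' := by
    intro u v u' v' hu hv h _
    cases hu
    cases hv
    exact h
  mul_mem' := by
    intro α β hα hβ u v u' v' hu hv h hne
    rw [PT.mul_apply, Option.bind_eq_some_iff] at hu hv
    obtain ⟨x, hx, hxu⟩ := hu
    obtain ⟨y, hy, hyv⟩ := hv
    have hxy : x ≠ y := by
      rintro rfl
      exact hne (Option.some.inj (hxu.symm.trans hyv))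
    exact hβ x y u' v' hxu hyv (hα u v x y hx hy h hxy) hne

/-- The monoid of partial strong endomorphisms of a graph. -/
def PsEnd {V : Type*} (G : SimpleGraph V) : Submonoid (PT V) where
  carrier := {α | ∀ u v u' v' : V, α u = some u' → α v = some v' →
    (G.Adj u v ↔ G.Adj u' v')}
  one_mem' := by
    intro u v u' v' hu hv
    cases hu
    cases hv
    exact Iff.rfl
  mul_mem' := by
    intro α β hα hβ u v u' v' hu hv
    rw [PT.mul_apply, Option.bind_eq_some_iff] at hu hv
    obtain ⟨x, hx, hxu⟩ := hu
    obtain ⟨y, hy, hyv⟩ := hv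
    exact (hα u v x y hx hy).trans (hβ x y u' v' hxu hyv)

/-- `⟨X | R⟩` defines the submonoid `M` of `T` on the generators `g x`, `x ∈ X`: there is an
isomorphism from the monoid presented by `⟨X | R⟩` onto `M` which sends each letter `x` to `g x`. -/
def Defines {X T : Type*} [Monoid T] (R : Set (FreeMonoid X × FreeMonoid X))
    (M : Submonoid T) (g : X → T) : Prop :=
  ∃ φ : PresentedMonoid (fun u v : FreeMonoid X => (u, v) ∈ R) ≃* M,
    ∀ x : X, (φ (PresentedMonoid.of _ x) : T) = g x

/-- `W` is a set of canonical forms for the (finite) monoid `M`, with respect to the relations `R`: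
each word is congruent to a word in `W` modulo the congruence generated by `R`,
and `|W| ≤ |M|`. -/
def IsCanonicalForms {X T : Type*} [Monoid T] (R : Set (FreeMonoid X × FreeMonoid X))
    (M : Submonoid T) (W : Set (FreeMonoid X)) : Prop :=
  (∀ w : FreeMonoid X, ∃ w' ∈ W, conGen (fun u v => (u, v) ∈ R) w w') ∧
    W.encard ≤ ENat.card M

/-- The relations `R`, read over a larger alphabet through the inclusion `i` of alphabets. -/
def mapRel {X Y : Type*} (i : X → Y) (R : Set (FreeMonoid X × FreeMonoid X)) :
    Set (FreeMonoid Y × FreeMonoid Y) :=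
  (fun p => (FreeMonoid.map i p.1, FreeMonoid.map i p.2)) '' R

/-- The alphabet `{a₀, b₀, e₀, f₀}`. -/
inductive LetterT
  | a | b | e | f

/-- The alphabet `{a₀, b₀, e₀, f₀, d, z}`. -/
inductive LetterS
  | a | b | e | f | d | z

/-- The alphabet `{a₀, b₀, e₀, f₀, c₀, d, z}`. -/
inductive LetterW
  | a | b | e | f | c | d | z

/-- The inclusion `{a₀, b₀, e₀, f₀} ⊆ {a₀, b₀, e₀, f₀, d, z}`. -/
def LetterT.toS : LetterT → LetterS
  | .a => .a
  | .b => .b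
  | .e => .e
  | .f => .f

/-- The inclusion `{a₀, b₀, e₀, f₀, d, z} ⊆ {a₀, b₀, e₀, f₀, c₀, d, z}`. -/
def LetterS.toW : LetterS → LetterW
  | .a => .a
  | .b => .b
  | .e => .e
  | .f => .f
  | .d => .d
  | .z => .z

section Relations

/-- The relations `R_d`: a set `R₀` of relations on `{a₀, b₀, e₀, f₀}`, together with relations
saying that `d` is an idempotent commuting with `a₀, b₀, e₀, f₀`. -/
def relD (R₀ : Set (FreeMonoid LetterT × FreeMonoid LetterT)) :
    Set (FreeMonoid LetterS × FreeMonoid LetterS) :=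
  let a := FreeMonoid.of LetterS.a
  let b := FreeMonoid.of LetterS.b
  let e := FreeMonoid.of LetterS.e
  let f := FreeMonoid.of LetterS.f
  let d := FreeMonoid.of LetterS.d
  mapRel LetterT.toS R₀ ∪
    {(d ^ 2, d), (a * d, d * a), (b * d, d * b), (e * d, d * e), (f * d, d * f)}

/-- The relations `R_s`. -/
def relS (n : ℕ) (R₀ : Set (FreeMonoid LetterT × FreeMonoid LetterT)) :
    Set (FreeMonoid LetterS × FreeMonoid LetterS) :=
  let a := FreeMonoid.of LetterS.a
  let b := FreeMonoid.of LetterS.b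
  let e := FreeMonoid.of LetterS.e
  let f := FreeMonoid.of LetterS.f
  let d := FreeMonoid.of LetterS.d
  let z := FreeMonoid.of LetterS.z
  relD R₀ ∪
    {(a * z, z), (b * z, z), (e * z, z), (d * z, z * f), (z * d, (f * b) ^ (n - 1) * z),
      (z ^ 2, (e * b) ^ (n - 3) * e),
      (d * (f * b) ^ (n - 1) * z, d * (f * b) ^ (n - 1))}

/-- The relations `R_w`: `R_s` together with twelve relations involving `c₀`. -/
def relW (n : ℕ) (R₀ : Set (FreeMonoid LetterT × FreeMonoid LetterT)) :
    Set (FreeMonoid LetterW × FreeMonoid LetterW) :=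
  let a := FreeMonoid.of LetterW.a
  let b := FreeMonoid.of LetterW.b
  let e := FreeMonoid.of LetterW.e
  let f := FreeMonoid.of LetterW.f
  let c := FreeMonoid.of LetterW.c
  let d := FreeMonoid.of LetterW.d
  let z := FreeMonoid.of LetterW.z
  mapRel LetterS.toW (relS n R₀) ∪
    {(c ^ 2, c), (e * c, c * a * c), (c * f, c), (f * c, f), (c * d, f * d),
      (c * b ^ (n - 2) * a * b, b ^ (n - 2) * a * b * c),
      (c * b * a, b * a * c),
      (c * a * f * a, a * f * a * c),
      (c * a * b ^ (n - 2) * a * b * e * b ^ (n - 2) * a * b * a,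
        a * b ^ (n - 2) * a * b * e * b ^ (n - 2) * a * b * a * c),
      (c * z * c, z * c), (z ^ 2 * c, z * c),
      (d * c * z * b ^ (n - 2), a * (b * e) ^ (n - 3) * d * c)}

end Relations

section Star

variable (n : ℕ) [NeZero n]

/-- The star graph `S_n` with `n` vertices `0, 1, …, n - 1` and edges `{0, i}`, `1 ≤ i ≤ n - 1`. -/
abbrev starS : SimpleGraph (Fin n) := SimpleGraph.starGraph 0

/-- The monoid `PT(Ω_{n-1})ζ` of all `α` with `0 α = 0` and `Ω_{n-1} α ⊆ Ω_{n-1}`, where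
`Ω_{n-1} = {1, …, n - 1}`; it is a copy of the monoid of all partial transformations of
`Ω_{n-1}`. -/
def PTzeta : Submonoid (PT (Fin n)) where
  carrier := {α | α 0 = some 0 ∧ α.imageOf {x | x ≠ 0} ⊆ {x | x ≠ 0}}
  one_mem' := by
    refine ⟨rfl, ?_⟩
    rintro y ⟨x, hx, hxy⟩
    cases hxy
    exact hx
  mul_mem' := by
    rintro α β ⟨hα, hα'⟩ ⟨hβ, hβ'⟩
    refine ⟨by rw [PT.mul_apply, hα]; exact hβ, ?_⟩
    rintro y ⟨x, hx, hxy⟩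
    rw [PT.mul_apply, Option.bind_eq_some_iff] at hxy
    obtain ⟨t, ht, hty⟩ := hxy
    exact hβ' ⟨t, hα' ⟨x, hx, ht⟩, hty⟩

/-- `a₀` transposes `1` and `2`. -/
def gA : PT (Fin n) := ⟨fun x => if x = 1 then some 2 else if x = 2 then some 1 else some x⟩

/-- `b₀` fixes `0` and is the cycle `1 ↦ 2 ↦ ⋯ ↦ n - 1 ↦ 1`. -/
def gB : PT (Fin n) := ⟨fun x =>
  if x = 0 then some 0 else if x.val = n - 1 then some 1 else some (x + 1)⟩

/-- `e₀` maps `2` to `1` and fixes all the other vertices. -/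
def gE : PT (Fin n) := ⟨fun x => if x = 2 then some 1 else some x⟩

/-- `f₀` is the partial identity with domain `{0, 2, …, n - 1}`. -/
def gF : PT (Fin n) := ⟨fun x => if x = 1 then none else some x⟩

/-- `c₀` maps `1` to `0` and fixes all the other vertices. -/
def gC : PT (Fin n) := ⟨fun x => if x = 1 then some 0 else some x⟩

/-- `d` is the partial identity with domain `{1, …, n - 1}`. -/
def gD : PT (Fin n) := ⟨fun x => if x = 0 then none else some x⟩

/-- `z` maps `0` to `1` and all the other vertices to `0`. -/
def gZ : PT (Fin n) := ⟨fun x => if x = 0 then some 1 else some 0⟩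

/-- The transformations denoted by the letters `a₀, b₀, e₀, f₀, c₀, d, z`. -/
def genW : LetterW → PT (Fin n)
  | .a => gA n
  | .b => gB n
  | .e => gE n
  | .f => gF n
  | .c => gC n
  | .d => gD n
  | .z => gZ n

/-- The transformations denoted by the letters `a₀, b₀, e₀, f₀, d, z`. -/
def genS (x : LetterS) : PT (Fin n) := genW n x.toW

/-- The transformations denoted by the letters `a₀, b₀, e₀, f₀`. -/
def genT (x : LetterT) : PT (Fin n) := genS n x.toS

/-- The transformation represented by a word on `{a₀, b₀, e₀, f₀, d, z}`. -/
def evalS : FreeMonoid LetterS →* PT (Fin n) := FreeMonoid.lift (genS n)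

variable {n}

/-- `σ_k`, for `1 ≤ k ≤ n - 1`: it maps `1` to `k` and `j` to `j - 1` for `2 ≤ j ≤ k`, and fixes
all the other vertices. -/
def sigma (k : Fin n) : PT (Fin n) := ⟨fun x =>
  if x = 0 then some 0 else if x = 1 then some k else if x ≤ k then some (x - 1) else some x⟩

/-- `D_k`, for `1 ≤ k ≤ n - 1`: the partial strong endomorphisms `α` of `S_n` with
`{1, …, k} ⊆ im α` and either `0 α = 0`, or `0 ∉ dom α` and `|im α| ≥ 2`. -/
def setDk (k : Fin n) : Set (PT (Fin n)) :=
  {α | α ∈ PsEnd (starS n) ∧ {j | j ≠ 0 ∧ j ≤ k} ⊆ α.im ∧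
    (α 0 = some 0 ∨ (0 ∉ α.dom ∧ 2 ≤ α.im.ncard))}

/-- `Γ_k`, for `1 ≤ k ≤ n - 1`: the partial weak endomorphisms `α` of `S_n` that are not strong,
with `k = min (Ω_{n-1} \ Ω_{n-1} α)` and either `0 ∉ dom α` or `0 α = 0`. -/
def setGammak (k : Fin n) : Set (PT (Fin n)) :=
  {α | α ∈ PwEnd (starS n) ∧ α ∉ PsEnd (starS n) ∧
    IsLeast ({j | j ≠ 0} \ α.imageOf {x | x ≠ 0}) k ∧
    (0 ∉ α.dom ∨ α 0 = some 0)}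

variable (n)

/-- `D`: the partial transformations with `0 ↦ 0` and each other vertex of the domain mapped to `1`
or `2`, with `1` attained. -/
def setD : Set (PT (Fin n)) :=
  {α | α 0 = some 0 ∧ (∀ x, x ≠ 0 → α x = none ∨ α x = some 1 ∨ α x = some 2) ∧
    ∃ x, x ≠ 0 ∧ α x = some 1}

/-- `Γ₀`: the partial weak endomorphisms `α` of `S_n` that are not strong, with `0 ∈ dom α` and
`0 α ≠ 0`. -/
def setGamma0 : Set (PT (Fin n)) :=
  {α | α ∈ PwEnd (starS n) ∧ α ∉ PsEnd (starS n) ∧ ∃ y, y ≠ 0 ∧ α 0 = some y}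

variable {n}

/-- `W₈`: the words `w_α c₀ w_{σ_k}` with `1 ≤ k ≤ n - 1` and `α ∈ D_k`, where `w_β` is the word of
`W_s` representing `β`. -/
def setW8 (Ws : Set (FreeMonoid LetterS)) : Set (FreeMonoid LetterW) :=
  {w | ∃ k : Fin n, k ≠ 0 ∧ ∃ u ∈ Ws, ∃ v ∈ Ws, evalS n u ∈ setDk k ∧ evalS n v = sigma k ∧
    w = FreeMonoid.map LetterS.toW u * FreeMonoid.of LetterW.c * FreeMonoid.map LetterS.toW v}

/-- `W₉`: the words `w_α c₀ z b₀^ℓ` with `α ∈ D` and `0 ≤ ℓ ≤ n - 2`, where `w_α` is the word of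
`W_s` representing `α`. -/
def setW9 (Ws : Set (FreeMonoid LetterS)) : Set (FreeMonoid LetterW) :=
  {w | ∃ u ∈ Ws, ∃ l : ℕ, l ≤ n - 2 ∧ evalS n u ∈ setD n ∧
    w = FreeMonoid.map LetterS.toW u * FreeMonoid.of LetterW.c * FreeMonoid.of LetterW.z *
      FreeMonoid.of LetterW.b ^ l}

variable (n)

/-- `W_w = W_s ∪ W₈ ∪ W₉`. -/
def setWw (Ws : Set (FreeMonoid LetterS)) : Set (FreeMonoid LetterW) :=
  FreeMonoid.map LetterS.toW '' Ws ∪ setW8 (n := n) Ws ∪ setW9 (n := n) Ws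

end Star

end StarEnd

open StarEnd

/-!
The presentation of `PwEnd(S_n)` rests on a chain of three monoids: the copy of `PT(Ω_{n-1})` that
consists of the transformations fixing `0` and preserving `Ω_{n-1}`, which is presented by `R₀`;
then `PsEnd(S_n)`; then `PwEnd(S_n)`. At each of the two steps one knows a multiplicative map `J`
from the smaller monoid to the monoid `Q` presented by the larger set of relations (any solution of
the smaller set of relations receives one, `Defines.exists_isRep`). So elements of the smaller
monoid can be handled in `Q` as transformations, and only the new letters need rewriting.

For `PsEnd(S_n)` the new letters are `d` and `z`. Every element of `Q` is `J α`, `d J α`, `d J α z`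
or `J α z J(b₀)^l` with `α` in the copy of `PT(Ω_{n-1})`: `d` commutes with `J α`, and `J α z`
depends only on the domain of `α`, because total transformations are products of `a₀, b₀, e₀`
(`StrongRel.mul_z_eq`), while `z J β` depends only on the image of `1` under `β`
(`StrongRel.z_mul_eq`). Two such forms with the same value are equal (`StrongRel.form_unique`), and
so `R_s` defines `PsEnd(S_n)` (`defines_PsEnd`).

For `PwEnd(S_n)` the new letter is `c = c₀`. Three facts about `c` carry the argument. It commutes
with `J β` whenever `1` is an isolated fixed point of `β` (`WeakRel.comm_c`), since the
transformations of `{2, …, n - 1}` are generated by those that occur in the commutation relations;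
`c J β` does not depend on the image of `1` under `β` (`WeakRel.c_mul_eq`); and `J α c = J α` if `1`
is not in the image of `α`. Now consider `J α c J β`. Some nonzero vertex is missed by `α c₀ β`, and
if `k` is the least such vertex then, on the part of the image of `α` that matters, `β` equals `γ
σ_k` with `1` an isolated fixed point of `γ`; so `J α c J β = J (α γ) c J σ_k`, where `α γ` is in
`D_k` or else the element is strong (`WeakRel.form_c_mul`). In the same way `J α c z J β` reduces
to a form with `α ∈ D` (`WeakRel.form_c_z_mul`). Hence every element of `Q` is `J α`, or
`J α c J σ_k` with `α ∈ D_k`, or `J α c z J(b₀)^l` with `α ∈ D`. The values of the three kinds of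
forms are the strong endomorphisms, the sets `Γ_k`, and the set `Γ₀`; these sets are disjoint, they
exhaust `PwEnd(S_n)`, and each value is taken once, by the bijections `bijOn_setGammak` and
`bijOn_setGamma0`. This gives the presentation, the canonical forms and the two counts together.
-/

namespace StarEnd

open Equiv (Perm swap)

/-! ### Presentations and multiplicative maps -/

section Presentations

variable {X T Q : Type*} [Monoid T] [Monoid Q]

/-- `J` is multiplicative on the submonoid `M`. Working with a total function on `T` instead of a
homomorphism defined on the subtype `M` avoids coercions; the values of `J` off `M` are
irrelevant. -/
structure IsRep (M : Submonoid T) (J : T → Q) : Prop where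
  one : J 1 = 1
  mul : ∀ α ∈ M, ∀ β ∈ M, J (α * β) = J α * J β

theorem IsRep.pow {M : Submonoid T} {J : T → Q} (hJ : IsRep M J) {α : T} (hα : α ∈ M)
    (k : ℕ) : J (α ^ k) = J α ^ k := by
  induction k with
  | zero => simp [hJ.one]
  | succ k ih => rw [pow_succ, pow_succ, hJ.mul _ (pow_mem hα k) _ hα, ih]

variable {R : Set (FreeMonoid X × FreeMonoid X)} {M : Submonoid T} {g : X → T}

theorem lift_mem (hg : ∀ x, g x ∈ M) (w : FreeMonoid X) : FreeMonoid.lift g w ∈ M := by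
  induction w using FreeMonoid.inductionOn' with
  | one => simp
  | of_mul x w ih => rw [map_mul, FreeMonoid.lift_eval_of]; exact mul_mem (hg x) ih

theorem IsRep.apply_lift {J : T → Q} (hJ : IsRep M J) (hg : ∀ x, g x ∈ M) (w : FreeMonoid X) :
    J (FreeMonoid.lift g w) = FreeMonoid.lift (fun x => J (g x)) w := by
  induction w using FreeMonoid.inductionOn' with
  | one => simp [hJ.one]
  | of_mul x w ih =>
    rw [map_mul (FreeMonoid.lift g), map_mul (FreeMonoid.lift _), FreeMonoid.lift_eval_of,
      FreeMonoid.lift_eval_of, hJ.mul _ (hg x) _ (lift_mem hg w), ih]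

/-- A presentation defines `M` as soon as the letters generate `M`, satisfy the relations, and
words with equal values are congruent. -/
theorem Defines.of_words (hg : ∀ x, g x ∈ M)
    (hrel : ∀ u v, (u, v) ∈ R → FreeMonoid.lift g u = FreeMonoid.lift g v)
    (hsurj : ∀ α ∈ M, ∃ w, FreeMonoid.lift g w = α)
    (hinj : ∀ u v, FreeMonoid.lift g u = FreeMonoid.lift g v →
      conGen (fun u v => (u, v) ∈ R) u v) : Defines R M g := by
  have hl : ∀ w, PresentedMonoid.lift (rels := fun u v => (u, v) ∈ R) g hrel
      (PresentedMonoid.mk _ w) = FreeMonoid.lift g w := fun _ => rfl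
  have hm : ∀ q, PresentedMonoid.lift (rels := fun u v => (u, v) ∈ R) g hrel q ∈ M := by
    intro q
    obtain ⟨w, rfl⟩ := PresentedMonoid.surjective_mk q
    rw [hl]
    exact lift_mem hg w
  refine ⟨MulEquiv.ofBijective ((PresentedMonoid.lift (rels := fun u v => (u, v) ∈ R) g
    hrel).codRestrict M hm) ⟨?_, ?_⟩, fun x => rfl⟩
  · intro p q h
    obtain ⟨u, rfl⟩ := PresentedMonoid.surjective_mk p
    obtain ⟨v, rfl⟩ := PresentedMonoid.surjective_mk q
    exact PresentedMonoid.mk_eq_mk_iff.2 (hinj u v (congrArg Subtype.val h))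
  · rintro ⟨α, hα⟩
    obtain ⟨w, rfl⟩ := hsurj α hα
    exact ⟨PresentedMonoid.mk _ w, rfl⟩

theorem Defines.exists_equiv (h : Defines R M g) :
    ∃ φ : PresentedMonoid (fun u v : FreeMonoid X => (u, v) ∈ R) ≃* M,
      ∀ w, (φ (PresentedMonoid.mk _ w) : T) = FreeMonoid.lift g w := by
  obtain ⟨φ, hφ⟩ := h
  refine ⟨φ, fun w => ?_⟩
  induction w using FreeMonoid.inductionOn' with
  | one => simp
  | of_mul x w ih =>
    rw [map_mul, map_mul, map_mul, FreeMonoid.lift_eval_of, Submonoid.coe_mul, ih, ← hφ]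
    rfl

theorem Defines.mem (h : Defines R M g) (x : X) : g x ∈ M := by
  obtain ⟨φ, hφ⟩ := h
  rw [← hφ]
  exact Subtype.prop _

theorem Defines.lift_eq (h : Defines R M g) {u v : FreeMonoid X}
    (huv : conGen (fun u v => (u, v) ∈ R) u v) : FreeMonoid.lift g u = FreeMonoid.lift g v := by
  obtain ⟨φ, hφ⟩ := h.exists_equiv
  rw [← hφ, ← hφ, PresentedMonoid.mk_eq_mk_iff.2 huv]

theorem Defines.rel (h : Defines R M g) {u v : FreeMonoid X} (huv : (u, v) ∈ R) :
    FreeMonoid.lift g u = FreeMonoid.lift g v :=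
  h.lift_eq (.of _ _ huv)

theorem Defines.exists_word (h : Defines R M g) {α : T} (hα : α ∈ M) :
    ∃ w, FreeMonoid.lift g w = α := by
  obtain ⟨φ, hφ⟩ := h.exists_equiv
  obtain ⟨q, hq⟩ := φ.surjective ⟨α, hα⟩
  obtain ⟨w, rfl⟩ := PresentedMonoid.surjective_mk q
  exact ⟨w, by rw [← hφ, hq]⟩

theorem Defines.congr (h : Defines R M g) {u v : FreeMonoid X}
    (huv : FreeMonoid.lift g u = FreeMonoid.lift g v) :
    conGen (fun u v => (u, v) ∈ R) u v := by
  obtain ⟨φ, hφ⟩ := h.exists_equiv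
  exact PresentedMonoid.mk_eq_mk_iff.1 (φ.injective (Subtype.ext (by rw [hφ, hφ, huv])))

/-- A property of elements of a monoid defined by a presentation that is closed under products
and holds for the letters holds everywhere. -/
theorem Defines.le (h : Defines R M g) (H : Submonoid T) (hg : ∀ x, g x ∈ H) : M ≤ H := by
  intro α hα
  obtain ⟨w, rfl⟩ := h.exists_word hα
  exact lift_mem hg w

/-- Images of the letters that satisfy the defining relations extend to a multiplicative map. -/
theorem Defines.exists_isRep (h : Defines R M g) (f : X → Q)
    (hf : ∀ u v, (u, v) ∈ R → FreeMonoid.lift f u = FreeMonoid.lift f v) :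
    ∃ J : T → Q, IsRep M J ∧ ∀ x, J (g x) = f x := by
  classical
  obtain ⟨φ, hφ⟩ := h.exists_equiv
  let ψ := PresentedMonoid.lift (rels := fun u v => (u, v) ∈ R) f hf
  refine ⟨fun α => if hα : α ∈ M then ψ (φ.symm ⟨α, hα⟩) else 1, ⟨?_, ?_⟩, ?_⟩
  · have : (⟨1, one_mem M⟩ : M) = 1 := rfl
    simp [this]
  · intro α hα β hβ
    have : (⟨α * β, mul_mem hα hβ⟩ : M) = ⟨α, hα⟩ * ⟨β, hβ⟩ := rfl
    simp only [hα, hβ, mul_mem hα hβ, dite_true, this, map_mul]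
  · intro x
    have hx : (⟨g x, h.mem x⟩ : M) = φ (PresentedMonoid.mk _ (FreeMonoid.of x)) :=
      Subtype.ext (by rw [hφ]; simp)
    simp only [h.mem x, dite_true, hx, MulEquiv.symm_apply_apply]
    rfl

/-- A relation transported along an inclusion of alphabets holds if the original one does. -/
theorem lift_map_eq {Y : Type*} (i : X → Y) (f : Y → Q) (w : FreeMonoid X) :
    FreeMonoid.lift f (FreeMonoid.map i w) = FreeMonoid.lift (fun x => f (i x)) w := by
  rw [← MonoidHom.comp_apply]
  congr 1
  exact FreeMonoid.hom_eq fun _ => rfl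

end Presentations

/-! ### Generating transformations of a finite set -/

section Generation

variable {V : Type*}

/-- A permutation as a (total) transformation. -/
def permPT (σ : Perm V) : PT V := ⟨fun x => some (σ x)⟩

theorem permPT_mul (σ τ : Perm V) : permPT σ * permPT τ = permPT (τ * σ) := rfl

variable [DecidableEq V]

/-- The idempotent which moves `u` to `v` and fixes all the other points. -/
def colPT (u v : V) : PT V := ⟨fun x => if x = u then some v else some x⟩

/-- The identity with the point `u` removed from its domain. -/
def delPT (u : V) : PT V := ⟨fun x => if x = u then none else some x⟩

theorem permPT_inv_mul_colPT (σ : Perm V) (u v : V) :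
    permPT σ⁻¹ * colPT u v * permPT σ = colPT (σ u) (σ v) := by
  refine PT.ext (funext fun x => ?_)
  simp only [PT.mul_apply, permPT, colPT, Option.bind_some, Perm.inv_eq_iff_eq]
  split_ifs <;> simp_all

theorem permPT_inv_mul_delPT (σ : Perm V) (u : V) :
    permPT σ⁻¹ * delPT u * permPT σ = delPT (σ u) := by
  refine PT.ext (funext fun x => ?_)
  simp only [PT.mul_apply, permPT, delPT, Option.bind_some, Perm.inv_eq_iff_eq]
  split_ifs <;> simp_all

/-- Transpositions and collapses of points of `A` generate all transformations that map `A` to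
itself and fix every other point; if one adds the partial identities that omit one point of `A`,
then they generate all partial transformations of this kind.

The induction is on the number of points that are moved. Let `x` be such a point, with image `y`.
If `y` is fixed, then `α` factors through the collapse of `x` to `y`; if `y` is moved, then
composing with the transposition of `x` and `y` makes `y` a fixed point. -/
theorem mem_of_swap_of_colPT [Finite V] (H : Submonoid (PT V)) (A : Set V)
    (hs : ∀ x ∈ A, ∀ y ∈ A, permPT (swap x y) ∈ H)
    (hc : ∀ x ∈ A, ∀ y ∈ A, x ≠ y → colPT x y ∈ H) (α : PT V)
    (hA : ∀ x, x ∉ A → α x = some x) (hA' : ∀ x ∈ A, ∀ y, α x = some y → y ∈ A)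
    (hd : (∀ x ∈ A, delPT x ∈ H) ∨ ∀ x, α x ≠ none) : α ∈ H := by
  induction hk : {x | α x ≠ some x}.ncard using Nat.strong_induction_on generalizing α with
  | _ k ih =>
  subst hk
  by_cases hfix : ∀ x, α x = some x
  · have : α = 1 := PT.ext (funext hfix)
    rw [this]
    exact one_mem H
  push Not at hfix
  obtain ⟨x, hx⟩ := hfix
  have hxA : x ∈ A := by
    by_contra h
    exact hx (hA x h)
  -- a map whose moved points form a smaller set is in `H` by induction
  have step : ∀ β : PT V, (∀ t, t ∉ A → β t = some t) → (∀ t ∈ A, ∀ y, β t = some y → y ∈ A) →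
      ((∀ x ∈ A, delPT x ∈ H) ∨ ∀ x, β x ≠ none) → (∀ t, α t = some t → β t = some t) →
      (∃ t, α t ≠ some t ∧ β t = some t) → β ∈ H := by
    intro β h1 h2 h3 h4 ⟨t, ht, ht'⟩
    refine ih _ ?_ β h1 h2 h3 rfl
    refine Set.ncard_lt_ncard ⟨fun s hs hs' => hs (h4 s hs'), fun hsub => ?_⟩ (Set.toFinite _)
    exact hsub ht ht'
  let β : PT V := ⟨fun t => if t = x then some x else α t⟩
  have hβ : ((∀ x ∈ A, delPT x ∈ H) ∨ ∀ x, α x ≠ none) → β ∈ H := by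
    intro hd'
    refine step β ?_ ?_ ?_ ?_ ⟨x, hx, if_pos rfl⟩
    · intro t ht
      have : t ≠ x := by rintro rfl; exact ht hxA
      simp [β, this, hA t ht]
    · intro t ht y hy
      by_cases h : t = x
      · simp [β, h] at hy; exact hy ▸ hxA
      · simp [β, h] at hy; exact hA' t ht y hy
    · refine hd'.imp id fun h t => ?_
      by_cases h' : t = x
      · simp [β, h']
      · simpa [β, h'] using h t
    · intro t ht
      by_cases h : t = x
      · simp [β, h]
      · simpa [β, h] using ht
  rcases hy : α x with _ | y
  · rcases hd with hd | hd
    · have : α = delPT x * β := by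
        refine PT.ext (funext fun t => ?_)
        by_cases h : t = x
        · simp [PT.mul_apply, delPT, h, hy]
        · simp [PT.mul_apply, delPT, h, β]
      rw [this]
      exact mul_mem (hd x hxA) (hβ (Or.inl hd))
    · exact absurd hy (hd x)
  have hyA := hA' x hxA y hy
  have hxy : x ≠ y := by rintro rfl; exact hx hy
  by_cases hyf : α y = some y
  · have : α = colPT x y * β := by
      refine PT.ext (funext fun t => ?_)
      by_cases h : t = x
      · simp [PT.mul_apply, colPT, h, hy, β, hxy.symm, hyf]
      · simp [PT.mul_apply, colPT, h, β]
    rw [this]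
    exact mul_mem (hc x hxA y hyA hxy) (hβ hd)
  · have : α = permPT (swap x y) * (permPT (swap x y) * α) := by
      rw [← mul_assoc, permPT_mul, Equiv.swap_mul_self]
      rfl
    rw [this]
    have hne : ∀ t, t ≠ x → t ≠ y → swap x y t = t := fun t => Equiv.swap_apply_of_ne_of_ne
    refine mul_mem (hs x hxA y hyA) (step _ ?_ ?_ ?_ ?_ ⟨y, hyf, ?_⟩)
    · intro t ht
      have h1 : t ≠ x := by rintro rfl; exact ht hxA
      have h2 : t ≠ y := by rintro rfl; exact ht hyA
      simp [PT.mul_apply, permPT, hne t h1 h2, hA t ht]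
    · intro t ht s hts
      have h3 : swap x y t ∈ A := by
        rw [Equiv.swap_apply_def]
        split_ifs <;> assumption
      exact hA' _ h3 s hts
    · exact hd.imp id fun h t => h _
    · intro t ht
      have h1 : t ≠ x := by rintro rfl; exact hx ht
      have h2 : t ≠ y := by rintro rfl; exact hyf ht
      simp [PT.mul_apply, permPT, hne t h1 h2, ht]
    · simp [PT.mul_apply, permPT, hy]

end Generation

section Cycle

variable {n : ℕ}

/-- The cycle `p ↦ p + 1 ↦ ⋯ ↦ n - 1 ↦ p`, which fixes all the points below `p`. -/
noncomputable def cyc (p : ℕ) (hp : p < n) : Perm (Fin n) :=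
  Equiv.ofBijective (fun x => if x.val < p then x else
    if h : x.val + 1 < n then ⟨x.val + 1, h⟩ else ⟨p, hp⟩) <| by
      rw [← Finite.injective_iff_bijective]
      intro x y hxy
      simp only at hxy
      apply Fin.ext
      split_ifs at hxy <;> simp only [Fin.ext_iff] at hxy <;> omega

theorem cyc_val (p : ℕ) (hp : p < n) (x : Fin n) : (cyc p hp x).val =
    if x.val < p then x.val else if x.val + 1 < n then x.val + 1 else p := by
  simp only [cyc, Equiv.ofBijective_apply]
  split_ifs <;> rfl

/-- By finiteness, the inverse of a permutation is one of its powers. -/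
theorem permPT_inv_mem [Finite V] (H : Submonoid (PT V)) {σ : Perm V} (h : permPT σ ∈ H) :
    permPT σ⁻¹ ∈ H := by
  have hpow : ∀ k : ℕ, permPT (σ ^ k) = permPT σ ^ k := by
    intro k
    induction k with
    | zero => rfl
    | succ k ih => rw [pow_succ', pow_succ, ← ih, permPT_mul]
  have : σ⁻¹ = σ ^ (orderOf σ - 1) := by
    rw [inv_eq_iff_mul_eq_one, ← pow_succ', Nat.sub_add_cancel (orderOf_pos σ), pow_orderOf_eq_one]
  rw [this, hpow]
  exact pow_mem h _

/-- A long cycle, a transposition of neighbours and a collapse of neighbours generate all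
transformations of `{p, …, n - 1}`; together with the partial identity that omits `p`, they
generate all its partial transformations. -/
theorem mem_of_cyc (H : Submonoid (PT (Fin n))) (p : ℕ) (hp : p + 1 < n)
    (hcyc : permPT (cyc p (by omega)) ∈ H)
    (hswap : permPT (swap (⟨p, by omega⟩ : Fin n) ⟨p + 1, hp⟩) ∈ H)
    (hcol : colPT (⟨p + 1, hp⟩ : Fin n) ⟨p, by omega⟩ ∈ H) (α : PT (Fin n))
    (hA : ∀ x : Fin n, x.val < p → α x = some x)
    (hA' : ∀ x y : Fin n, p ≤ x.val → α x = some y → p ≤ y.val)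
    (hd : delPT (⟨p, by omega⟩ : Fin n) ∈ H ∨ ∀ x, α x ≠ none) : α ∈ H := by
  -- permutations in `H`
  let K : Submonoid (Perm (Fin n)) :=
    { carrier := {σ | permPT σ ∈ H}
      one_mem' := one_mem H
      mul_mem' := fun hσ hτ => H.mul_mem hτ hσ }
  have hconj : ∀ (σ : Perm (Fin n)) (x y : Fin n), permPT σ ∈ H → permPT (swap x y) ∈ H →
      permPT (swap (σ x) (σ y)) ∈ H := by
    intro σ x y hσ hxy
    rw [Equiv.swap_apply_apply]
    exact mul_mem (permPT_inv_mem H hσ) (mul_mem hxy hσ)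
  have hadj : ∀ k (hk : p + k + 1 < n),
      permPT (swap (⟨p + k, by omega⟩ : Fin n) ⟨p + k + 1, hk⟩) ∈ H := by
    intro k
    induction k with
    | zero => intro _; exact hswap
    | succ k ih =>
      intro hk
      have := hconj _ _ _ hcyc (ih (by omega))
      have h1 : cyc p (by omega) (⟨p + k, by omega⟩ : Fin n) = ⟨p + (k + 1), by omega⟩ := by
        apply Fin.ext; rw [cyc_val]; simp only; split_ifs <;> omega
      have h2 : cyc p (by omega) (⟨p + k + 1, by omega⟩ : Fin n) = ⟨p + (k + 1) + 1, by omega⟩ := by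
        apply Fin.ext; rw [cyc_val]; simp only; split_ifs <;> omega
      rwa [h1, h2] at this
  have hfrom : ∀ k (hk : p + k < n),
      swap (⟨p, by omega⟩ : Fin n) ⟨p + k, hk⟩ ∈ K := by
    intro k
    induction k with
    | zero => intro _; simp [Equiv.swap_self, ← Perm.one_def, one_mem]
    | succ k ih =>
      intro hk
      exact SubmonoidClass.swap_mem_trans K (ih (by omega)) (hadj k hk)
  have hs : ∀ x ∈ {x : Fin n | p ≤ x.val}, ∀ y ∈ {x : Fin n | p ≤ x.val},
      permPT (swap x y) ∈ H := by
    have h0 : ∀ x : Fin n, p ≤ x.val → swap (⟨p, by omega⟩ : Fin n) x ∈ K := by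
      intro x hx
      have := hfrom (x.val - p) (by omega)
      have e : (⟨p + (x.val - p), by omega⟩ : Fin n) = x := Fin.ext (by simp only; omega)
      rwa [e] at this
    intro x hx y hy
    have hx' := h0 x hx
    rw [Equiv.swap_comm] at hx'
    exact SubmonoidClass.swap_mem_trans K hx' (h0 y hy)
  have hc : ∀ x ∈ {x : Fin n | p ≤ x.val}, ∀ y ∈ {x : Fin n | p ≤ x.val}, x ≠ y →
      colPT x y ∈ H := by
    intro x hx y hy hxy
    set P : Fin n := ⟨p, by omega⟩
    set P' : Fin n := ⟨p + 1, hp⟩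
    have hPP : P ≠ P' := by simp [P, P', Fin.ext_iff]
    have hPA : p ≤ P.val := le_rfl
    have hPA' : p ≤ P'.val := Nat.le_succ p
    have h1 : colPT x (swap P' x P) ∈ H := by
      have := permPT_inv_mul_colPT (swap P' x) P' P
      rw [Equiv.swap_apply_left] at this
      rw [← this]
      exact mul_mem (mul_mem (permPT_inv_mem H (hs _ hPA' _ hx)) hcol) (hs _ hPA' _ hx)
    have hq : swap P' x P ≠ x := by
      intro h
      apply hPP
      rw [← (swap P' x).injective.eq_iff, h, Equiv.swap_apply_left]
    have hqA : p ≤ (swap P' x P).val := by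
      rw [Equiv.swap_apply_def]
      split_ifs <;> assumption
    have := permPT_inv_mul_colPT (swap (swap P' x P) y) x (swap P' x P)
    rw [Equiv.swap_apply_left, Equiv.swap_apply_of_ne_of_ne hq.symm hxy] at this
    rw [← this]
    exact mul_mem (mul_mem (permPT_inv_mem H (hs _ hqA _ hy)) h1) (hs _ hqA _ hy)
  refine mem_of_swap_of_colPT H {x : Fin n | p ≤ x.val} hs hc α
    (fun x hx => hA x (not_le.1 hx)) (fun x hx y => hA' x y hx) (hd.imp (fun h x hx => ?_) id)
  have := permPT_inv_mul_delPT (swap (⟨p, by omega⟩ : Fin n) x) ⟨p, by omega⟩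
  rw [Equiv.swap_apply_left] at this
  rw [← this]
  have hpA : p ≤ (⟨p, by omega⟩ : Fin n).val := le_rfl
  exact mul_mem (mul_mem (permPT_inv_mem H (hs _ hpA _ hx)) h) (hs _ hpA _ hx)

end Cycle

/-! ### Endomorphisms of the star graph -/

section Star

variable {n : ℕ} [NeZero n]

theorem val_zero : ((0 : Fin n) : ℕ) = 0 := Nat.zero_mod n

theorem val_one (hn : 4 ≤ n) : ((1 : Fin n) : ℕ) = 1 := Nat.mod_eq_of_lt (show 1 < n by omega)

theorem val_two (hn : 4 ≤ n) : ((2 : Fin n) : ℕ) = 2 := Nat.mod_eq_of_lt (show 2 < n by omega)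

theorem val_three (hn : 4 ≤ n) : ((3 : Fin n) : ℕ) = 3 := Nat.mod_eq_of_lt (show 3 < n by omega)

theorem one_ne_zero_of_le (hn : 4 ≤ n) : (1 : Fin n) ≠ 0 := by
  rw [Ne, Fin.ext_iff, val_one hn]; exact Nat.one_ne_zero

theorem two_ne_zero_of_le (hn : 4 ≤ n) : (2 : Fin n) ≠ 0 := by
  rw [Ne, Fin.ext_iff, val_two hn]; exact two_ne_zero

theorem two_ne_one_of_le (hn : 4 ≤ n) : (2 : Fin n) ≠ 1 := by
  rw [Ne, Fin.ext_iff, val_two hn, val_one hn]; decide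

theorem val_ne_zero {x : Fin n} (hx : x ≠ 0) : x.val ≠ 0 := fun h => hx (Fin.ext h)

theorem PT.mul_apply_of_some {V : Type*} {α β : PT V} {x y : V} (h : α x = some y) :
    (α * β) x = β y := by
  rw [PT.mul_apply, h, Option.bind_some]

theorem PT.mul_apply_of_none {V : Type*} {α β : PT V} {x : V} (h : α x = none) :
    (α * β) x = none := by
  rw [PT.mul_apply, h, Option.bind_none]

theorem mem_PTzeta_iff {α : PT (Fin n)} :
    α ∈ PTzeta n ↔ α 0 = some 0 ∧ ∀ x, x ≠ 0 → α x ≠ some 0 := by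
  refine and_congr_right fun _ => ⟨fun h x hx hx0 => h ⟨x, hx, hx0⟩ rfl, ?_⟩
  rintro h y ⟨x, hx, hxy⟩ rfl
  exact h x hx hxy

/-- A weak endomorphism that moves `0` to `y ≠ 0` has its image in `{0, y}`; there is no other
restriction. -/
theorem mem_PwEnd_iff {α : PT (Fin n)} : α ∈ PwEnd (starS n) ↔
    ∀ y, y ≠ 0 → α 0 = some y → ∀ x, α x = none ∨ α x = some 0 ∨ α x = some y := by
  constructor
  · intro h y hy h0 x
    rcases hx : α x with _ | w
    · exact Or.inl rfl
    · right
      by_contra! hw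
      simp only [ne_eq, Option.some.injEq] at hw
      have hx0 : x ≠ 0 := by rintro rfl; exact hw.2 (Option.some.inj (hx.symm.trans h0))
      have := h 0 x y w h0 hx (by simp [hx0.symm]) (Ne.symm hw.2)
      simp [hy, hw.1] at this
  · intro h u v u' v' hu hv huv hne
    simp only [SimpleGraph.starGraph_adj] at huv ⊢
    refine ⟨hne, ?_⟩
    by_contra! h0
    rcases huv.2 with rfl | rfl
    · rcases h u' h0.1 hu v with h1 | h1 | h1 <;> simp_all
    · rcases h v' h0.2 hv u with h1 | h1 | h1 <;> simp_all

/-- The strong endomorphisms, according to what they do to the centre of the star. -/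
theorem mem_PsEnd_iff {α : PT (Fin n)} : α ∈ PsEnd (starS n) ↔
    (α 0 = some 0 ∧ ∀ x, x ≠ 0 → α x ≠ some 0) ∨
    (α 0 = none ∧ ∀ x, α x ≠ some 0) ∨
    (α 0 = none ∧ ∀ x, α x = none ∨ α x = some 0) ∨
    ∃ y, y ≠ 0 ∧ α 0 = some y ∧ ∀ x, x ≠ 0 → α x = none ∨ α x = some 0 := by
  constructor
  · intro h
    rcases h0 : α 0 with _ | y
    · right
      by_cases h1 : ∀ x, α x ≠ some 0
      · exact Or.inl ⟨rfl, h1⟩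
      · right; left
        refine ⟨rfl, fun x => ?_⟩
        push Not at h1
        obtain ⟨u, hu⟩ := h1
        rcases hx : α x with _ | w
        · exact Or.inl rfl
        · have := h u x 0 w hu hx
          have hu0 : u ≠ 0 := by rintro rfl; simp [h0] at hu
          have hx0 : x ≠ 0 := by rintro rfl; simp [h0] at hx
          simp only [SimpleGraph.starGraph_adj, hu0, hx0] at this
          simp at this
          right; rw [← this]
    · by_cases hy : y = 0
      · subst hy
        refine Or.inl ⟨rfl, fun x hx hx0 => ?_⟩
        have := h 0 x 0 0 h0 hx0
        simp [hx.symm] at this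
      · right; right; right
        refine ⟨y, hy, rfl, fun x hx => ?_⟩
        rcases hw : α x with _ | w
        · exact Or.inl rfl
        · have := h 0 x y w h0 hw
          simp [hx.symm, hy] at this
          right; rw [this.2]
  · intro h u v u' v' hu hv
    simp only [SimpleGraph.starGraph_adj]
    rcases h with ⟨h0, h⟩ | ⟨h0, h⟩ | ⟨h0, h⟩ | ⟨y, hy, h0, h⟩ <;>
    · have hhu := h u
      have hhv := h v
      by_cases hu0 : u = 0 <;> by_cases hv0 : v = 0 <;> simp_all <;> aesop

theorem PTzeta_le_PsEnd : PTzeta n ≤ PsEnd (starS n) := fun _ h =>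
  mem_PsEnd_iff.2 (Or.inl (mem_PTzeta_iff.1 h))

theorem PsEnd_le_PwEnd : PsEnd (starS n) ≤ PwEnd (starS n) := fun _ h u v u' v' hu hv huv _ =>
  (h u v u' v' hu hv).1 huv

/-! ### The generators and words in them -/

theorem gA_eq_permPT : gA n = permPT (swap 1 2) := by
  refine PT.ext (funext fun x => ?_)
  simp only [gA, permPT, Equiv.swap_apply_def]
  split_ifs <;> rfl

theorem gE_eq_colPT : gE n = colPT 2 1 := rfl

theorem gB_eq_permPT (hn : 4 ≤ n) : gB n = permPT (cyc 1 (by omega)) := by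
  refine PT.ext (funext fun x => ?_)
  simp only [gB, permPT]
  have h1 := val_one hn
  split_ifs with h h' <;> congr 1 <;> apply Fin.ext <;> rw [cyc_val]
  · simp [h]
  · have := val_ne_zero h
    split_ifs <;> omega
  · have := val_ne_zero h
    rw [Fin.val_add_one_of_lt' (by omega)]
    split_ifs <;> omega

theorem gA_mem (hn : 4 ≤ n) : gA n ∈ PTzeta n := by
  have h1 := one_ne_zero_of_le hn
  have h2 := two_ne_zero_of_le hn
  rw [mem_PTzeta_iff]
  constructor
  · simp [gA, h1.symm, h2.symm]
  · intro x hx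
    simp only [gA]
    split_ifs <;> simp [*]

theorem gB_mem (hn : 4 ≤ n) : gB n ∈ PTzeta n := by
  have h1 := one_ne_zero_of_le hn
  rw [mem_PTzeta_iff]
  constructor
  · simp [gB]
  · intro x hx
    have := val_ne_zero hx
    simp only [gB, hx, if_false]
    split_ifs with h
    · simp [h1]
    · rw [ne_eq, Option.some.injEq, Fin.ext_iff, Fin.val_add_one_of_lt' (by omega)]
      simp

theorem gE_mem (hn : 4 ≤ n) : gE n ∈ PTzeta n := by
  have h1 := one_ne_zero_of_le hn
  have h2 := two_ne_zero_of_le hn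
  rw [mem_PTzeta_iff]
  constructor
  · simp [gE, h2.symm]
  · intro x hx
    simp only [gE]
    split_ifs <;> simp [*]

theorem gF_mem (hn : 4 ≤ n) : gF n ∈ PTzeta n := by
  have h1 := one_ne_zero_of_le hn
  rw [mem_PTzeta_iff]
  constructor
  · simp [gF, h1.symm]
  · intro x hx
    simp only [gF]
    split_ifs <;> simp [*]

theorem sigma_mem (hn : 4 ≤ n) {k : Fin n} (hk : k ≠ 0) : sigma k ∈ PTzeta n := by
  have h1 := val_one hn
  rw [mem_PTzeta_iff]
  refine ⟨by simp [sigma], fun x hx => ?_⟩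
  have := val_ne_zero hx
  simp only [sigma, hx, if_false]
  split_ifs with h h'
  · simp [hk]
  · rw [Fin.ext_iff, h1] at h
    rw [ne_eq, Option.some.injEq, Fin.ext_iff, Fin.val_sub_one_of_ne_zero hx]
    simp only [val_zero]; omega
  · simpa using hx

/-- The powers of the cycle `b₀`. -/
theorem gB_pow_apply (hn : 4 ≤ n) (l : ℕ) {x : Fin n} (hx : x ≠ 0) :
    (gB n ^ l) x = some ⟨(x.val - 1 + l) % (n - 1) + 1, by
      have := Nat.mod_lt (x.val - 1 + l) (show 0 < n - 1 by omega); omega⟩ := by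
  induction l with
  | zero =>
    have := val_ne_zero hx
    rw [pow_zero, PT.one_apply, Option.some.injEq, Fin.ext_iff]
    simp only [add_zero]
    rw [Nat.mod_eq_of_lt (by omega)]; omega
  | succ l ih =>
    rw [pow_succ, PT.mul_apply_of_some ih, gB_eq_permPT hn]
    simp only [permPT, Option.some.injEq, Fin.ext_iff, cyc_val]
    have h := Nat.mod_lt (x.val - 1 + l) (show 0 < n - 1 by omega)
    have h' : (x.val - 1 + (l + 1)) % (n - 1) = ((x.val - 1 + l) % (n - 1) + 1) % (n - 1) := by
      rw [Nat.mod_add_mod, add_assoc]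
    rw [h']
    by_cases hlt : (x.val - 1 + l) % (n - 1) + 1 < n - 1
    · rw [Nat.mod_eq_of_lt hlt]; split_ifs <;> omega
    · have : (x.val - 1 + l) % (n - 1) + 1 = n - 1 := by omega
      rw [this, Nat.mod_self]; split_ifs <;> omega

theorem gB_pow_zero_apply (hn : 4 ≤ n) (l : ℕ) : (gB n ^ l) 0 = some 0 :=
  (mem_PTzeta_iff.1 (pow_mem (gB_mem hn) l)).1

theorem gB_pow_one_apply (hn : 4 ≤ n) {y : Fin n} (hy : y ≠ 0) :
    (gB n ^ (y.val - 1)) 1 = some y := by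
  have := val_ne_zero hy
  rw [gB_pow_apply hn _ (one_ne_zero_of_le hn), Option.some.injEq, Fin.ext_iff]
  simp only [val_one hn]
  rw [Nat.mod_eq_of_lt (by omega)]; omega

theorem gB_pow_card (hn : 4 ≤ n) : gB n ^ (n - 1) = 1 := by
  refine PT.ext (funext fun x => ?_)
  by_cases hx : x = 0
  · rw [hx, gB_pow_zero_apply hn, PT.one_apply]
  · have := val_ne_zero hx
    rw [gB_pow_apply hn _ hx, PT.one_apply, Option.some.injEq, Fin.ext_iff]
    simp only [Nat.add_mod_right]
    rw [Nat.mod_eq_of_lt (by omega)]; omega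

theorem gB_pow_sub_two (hn : 4 ≤ n) : gB n ^ (n - 2) = permPT (cyc 1 (by omega))⁻¹ := by
  have h : gB n ^ (n - 2) * gB n = 1 := by
    rw [← pow_succ, show n - 2 + 1 = n - 1 by omega, gB_pow_card hn]
  calc gB n ^ (n - 2) = gB n ^ (n - 2) * (gB n * permPT (cyc 1 (by omega))⁻¹) := by
        rw [gB_eq_permPT hn, permPT_mul, inv_mul_cancel]; exact (mul_one _).symm
    _ = _ := by rw [← mul_assoc, h, one_mul]

/-- The transformation that fixes `0` and maps the other vertices to `1`. -/
def kappa (n : ℕ) [NeZero n] : PT (Fin n) := ⟨fun x => if x = 0 then some 0 else some 1⟩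

/-- The partial identity with domain `{0}`. -/
def zeroId (n : ℕ) [NeZero n] : PT (Fin n) := ⟨fun x => if x = 0 then some 0 else none⟩

theorem gZ_mul_gZ (hn : 4 ≤ n) : gZ n * gZ n = kappa n := by
  have h1 := one_ne_zero_of_le hn
  refine PT.ext (funext fun x => ?_)
  by_cases hx : x = 0 <;> simp [PT.mul_apply, gZ, kappa, hx, h1]

/-- After `k` steps of `e₀ b₀`, a vertex `x ≠ 0` is at most `2`, or at `x + k` with `x ≥ 3`. For
`k = n - 3` only the first is possible. -/
theorem gE_gB_pow (hn : 4 ≤ n) : (gE n * gB n) ^ (n - 3) * gE n = kappa n := by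
  have hv1 := val_one hn
  have hv2 := val_two hn
  have key : ∀ k, ∀ x : Fin n, x ≠ 0 → ∃ y : Fin n, ((gE n * gB n) ^ k) x = some y ∧ y ≠ 0 ∧
      (y.val ≤ 2 ∨ 3 ≤ x.val ∧ y.val = x.val + k) := by
    intro k
    induction k with
    | zero => exact fun x hx => ⟨x, by rw [pow_zero, PT.one_apply], hx, by omega⟩
    | succ k ih =>
      intro x hx
      obtain ⟨y, hy, hy0, h⟩ := ih x hx
      have := val_ne_zero hy0
      rw [pow_succ, PT.mul_apply_of_some hy, gB_eq_permPT hn, PT.mul_apply]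
      simp only [gE, permPT]
      by_cases h2 : y = 2
      · simp only [h2, if_true, Option.bind_some]
        refine ⟨_, rfl, ?_, ?_⟩
        · intro h0
          have := congrArg Fin.val h0
          rw [cyc_val, hv1, val_zero] at this
          split_ifs at this
        · rw [cyc_val, hv1]; split_ifs <;> omega
      · simp only [h2, if_false, Option.bind_some]
        rw [Fin.ext_iff, hv2] at h2
        refine ⟨_, rfl, ?_, ?_⟩
        · intro h0
          have := congrArg Fin.val h0
          rw [cyc_val] at this
          rw [val_zero] at this
          split_ifs at this
          omega
        · rw [cyc_val]; split_ifs <;> omega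
  refine PT.ext (funext fun x => ?_)
  by_cases hx : x = 0
  · have h0 := mul_mem (pow_mem (mul_mem (gE_mem hn) (gB_mem hn)) (n - 3)) (gE_mem hn)
    rw [hx, (mem_PTzeta_iff.1 h0).1]
    simp [kappa]
  · obtain ⟨y, hy, hy0, h⟩ := key (n - 3) x hx
    have := val_ne_zero hy0
    have hy' : y = 1 ∨ y = 2 := by
      rw [Fin.ext_iff, Fin.ext_iff, hv1, hv2]; omega
    rw [PT.mul_apply_of_some hy]
    rcases hy' with rfl | rfl <;> simp [gE, kappa, hx]

/-- A vertex `x ≠ 0` survives `k ≥ 1` steps of `f₀ b₀` only if `2 ≤ x` and `x + k ≤ n`. -/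
theorem gF_gB_pow (hn : 4 ≤ n) : (gF n * gB n) ^ (n - 1) = zeroId n := by
  have hv1 := val_one hn
  have key : ∀ k, ∀ x y : Fin n, x ≠ 0 → ((gF n * gB n) ^ (k + 1)) x = some y →
      2 ≤ x.val ∧ (y.val = x.val + (k + 1) ∨ y.val = 1 ∧ x.val + (k + 1) = n) := by
    intro k
    induction k with
    | zero =>
      intro x y hx hy
      have := val_ne_zero hx
      rw [zero_add, pow_one, gB_eq_permPT hn, PT.mul_apply] at hy
      simp only [gF, permPT] at hy
      split_ifs at hy with h
      · simp at hy
      · rw [Fin.ext_iff, hv1] at h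
        simp only [Option.bind_some, Option.some.injEq, Fin.ext_iff, cyc_val] at hy
        split_ifs at hy <;> omega
    | succ k ih =>
      intro x y hx hy
      rw [pow_succ, PT.mul_apply, Option.bind_eq_some_iff] at hy
      obtain ⟨w, hw, hy⟩ := hy
      have := ih x w hx hw
      rw [gB_eq_permPT hn, PT.mul_apply] at hy
      simp only [gF, permPT] at hy
      split_ifs at hy with h
      · simp at hy
      · rw [Fin.ext_iff, hv1] at h
        simp only [Option.bind_some, Option.some.injEq, Fin.ext_iff, cyc_val] at hy
        split_ifs at hy <;> omega
  refine PT.ext (funext fun x => ?_)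
  by_cases hx : x = 0
  · rw [hx, (mem_PTzeta_iff.1 (pow_mem (mul_mem (gF_mem hn) (gB_mem hn)) (n - 1))).1]
    simp [zeroId]
  · rcases hy : ((gF n * gB n) ^ (n - 1)) x with _ | y
    · simp [zeroId, hx]
    · rw [show n - 1 = n - 2 + 1 by omega] at hy
      have := key _ x y hx hy
      have := y.isLt
      omega

/-- The powers of `b₀ e₀` fix `1` and increase the other vertices until they reach `1`. -/
theorem gB_gE_pow (hn : 4 ≤ n) (x : Fin n) :
    (gA n * (gB n * gE n) ^ (n - 3) * gD n) x =
      if x = 0 then none else if x = 1 then some ⟨n - 1, by omega⟩ else some 1 := by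
  have hv1 := val_one hn
  have hv2 := val_two hn
  have h1 := one_ne_zero_of_le hn
  have h2 := two_ne_zero_of_le hn
  have h21 := two_ne_one_of_le hn
  have key : ∀ k, k ≤ n - 3 → ∀ x : Fin n, x ≠ 0 → ∃ y : Fin n,
      ((gB n * gE n) ^ k) x = some y ∧ y.val = if x.val = 1 then 1 else
        if x.val + k < n then x.val + k else 1 := by
    intro k
    induction k with
    | zero => exact fun _ x hx => ⟨x, by rw [pow_zero, PT.one_apply], by
        rw [add_zero]; split_ifs <;> omega⟩
    | succ k ih =>
      intro hk x hx
      obtain ⟨y, hy, h⟩ := ih (by omega) x hx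
      have hx0 := val_ne_zero hx
      rw [pow_succ, PT.mul_apply_of_some hy, gB_eq_permPT hn, PT.mul_apply]
      simp only [gE, permPT, Option.bind_some]
      refine ⟨if cyc 1 (by omega) y = 2 then 1 else cyc 1 (by omega) y,
        by split_ifs <;> rfl, ?_⟩
      have hc := cyc_val 1 (by omega) y
      by_cases hh : cyc 1 (by omega) y = 2
      · simp only [hh, if_true, hv1]
        rw [hh, hv2] at hc
        split_ifs at h hc ⊢ <;> omega
      · simp only [hh, if_false]
        rw [Fin.ext_iff, hv2] at hh
        split_ifs at h hc ⊢ <;> omega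
  by_cases hx : x = 0
  · have h0 := mem_PTzeta_iff.1
      (mul_mem (gA_mem hn) (pow_mem (mul_mem (gB_mem hn) (gE_mem hn)) (n - 3)))
    rw [hx, PT.mul_apply_of_some h0.1]
    simp [gD]
  · have hA : ∀ w, gA n x = some w → ∀ y, ((gB n * gE n) ^ (n - 3)) w = some y → y ≠ 0 →
        (gA n * (gB n * gE n) ^ (n - 3) * gD n) x = some y := by
      intro w hw y hy hy0
      rw [mul_assoc, PT.mul_apply_of_some hw, PT.mul_apply_of_some hy]
      simp [gD, hy0]
    simp only [hx, if_false]
    by_cases hx1 : x = 1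
    · simp only [hx1, if_true]
      obtain ⟨y, hy, h⟩ := key (n - 3) le_rfl 2 h2
      rw [hv2] at h
      rw [if_neg (by omega), if_pos (by omega)] at h
      rw [← hx1, hA 2 (by simp [gA, hx1]) y hy (by rw [Ne, Fin.ext_iff, val_zero]; omega)]
      congr 1; apply Fin.ext; simp only; omega
    · simp only [hx1, if_false]
      have hw : ∃ w, gA n x = some w ∧ w ≠ 0 ∧ w ≠ 2 := by
        by_cases hx2 : x = 2
        · exact ⟨1, by simp [gA, hx2, h21], h1, h21.symm⟩
        · exact ⟨x, by simp [gA, hx1, hx2], hx, hx2⟩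
      obtain ⟨w, hw, hw0, hw2⟩ := hw
      obtain ⟨y, hy, h⟩ := key (n - 3) le_rfl w hw0
      have := val_ne_zero hw0
      rw [Ne, Fin.ext_iff, hv2] at hw2
      have hy1 : y = 1 := by
        rw [Fin.ext_iff, hv1]; split_ifs at h <;> omega
      subst hy1
      exact hA w hw 1 hy h1

end Star

section Star

variable {n : ℕ} [NeZero n]

/-! ### Generation of the copy of `PT(Ω_{n-1})` -/

/-- The four generators generate, and `f₀` is needed only for transformations that are not defined
everywhere. -/
theorem mem_of_gens (hn : 4 ≤ n) (H : Submonoid (PT (Fin n))) (ha : gA n ∈ H) (hb : gB n ∈ H)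
    (he : gE n ∈ H) {α : PT (Fin n)} (hα : α ∈ PTzeta n) (hf : gF n ∈ H ∨ ∀ x, α x ≠ none) :
    α ∈ H := by
  have e1 : (⟨1, by omega⟩ : Fin n) = 1 := Fin.ext (val_one hn).symm
  have e2 : (⟨1 + 1, by omega⟩ : Fin n) = 2 := Fin.ext (val_two hn).symm
  rw [mem_PTzeta_iff] at hα
  refine mem_of_cyc H 1 (by omega) ?_ ?_ ?_ α ?_ ?_ ?_
  · rwa [← gB_eq_permPT hn]
  · rwa [e1, e2, ← gA_eq_permPT]
  · rwa [e1, e2]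
  · intro x hx
    have : x = 0 := Fin.ext (by rw [val_zero]; omega)
    rw [this, hα.1]
  · intro x y hx hy
    have hx0 : x ≠ 0 := by rintro rfl; rw [val_zero] at hx; omega
    have hy0 : y ≠ 0 := by rintro rfl; exact hα.2 x hx0 hy
    have := val_ne_zero hy0
    omega
  · rwa [e1]

theorem gA_mul_gA : gA n * gA n = 1 := by
  rw [gA_eq_permPT, permPT_mul, Equiv.swap_mul_self]; rfl

theorem gB_pow_conj (hn : 4 ≤ n) : gB n ^ (n - 2) * gA n * gB n = permPT (swap 2 3) := by
  have c1 : cyc 1 (by omega) (1 : Fin n) = 2 := by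
    rw [Fin.ext_iff, cyc_val, val_one hn, val_two hn]; split_ifs <;> omega
  have c2 : cyc 1 (by omega) (2 : Fin n) = 3 := by
    rw [Fin.ext_iff, cyc_val, val_two hn, val_three hn]; split_ifs <;> omega
  rw [gB_pow_sub_two hn, gB_eq_permPT hn, gA_eq_permPT, permPT_mul, permPT_mul, ← c1]
  conv_rhs => rw [c1, ← c2]
  conv_rhs => rw [← c1, Equiv.swap_apply_apply]
  rw [c1, mul_assoc]

theorem three_ne (hn : 4 ≤ n) : (3 : Fin n) ≠ 0 ∧ (3 : Fin n) ≠ 1 ∧ (3 : Fin n) ≠ 2 := by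
  refine ⟨?_, ?_, ?_⟩ <;> rw [Ne, Fin.ext_iff, val_three hn]
  · rw [val_zero]; omega
  · rw [val_one hn]; omega
  · rw [val_two hn]; omega

theorem gA_conj_gF : gA n * gF n * gA n = delPT 2 := by
  rw [gA_eq_permPT]
  have := permPT_inv_mul_delPT (swap (1 : Fin n) 2) 1
  rwa [Equiv.swap_inv, Equiv.swap_apply_left] at this

/-- The idempotent `3 ↦ 2` is conjugate to `e₀` under `a₀ (2 3)`. -/
theorem gE_conj (hn : 4 ≤ n) :
    gA n * gB n ^ (n - 2) * gA n * gB n * gE n * gB n ^ (n - 2) * gA n * gB n * gA n =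
      colPT 3 2 := by
  have h : gA n * gB n ^ (n - 2) * gA n * gB n * gE n * gB n ^ (n - 2) * gA n * gB n * gA n =
      gA n * ((gB n ^ (n - 2) * gA n * gB n) * gE n * (gB n ^ (n - 2) * gA n * gB n)) * gA n := by
    simp only [mul_assoc]
  have h1 := two_ne_one_of_le hn
  obtain ⟨-, h31, h32⟩ := three_ne hn
  have e1 := permPT_inv_mul_colPT (swap (2 : Fin n) 3) 2 1
  have e2 := permPT_inv_mul_colPT (swap (1 : Fin n) 2) 3 1
  rw [Equiv.swap_inv, Equiv.swap_apply_left, Equiv.swap_apply_of_ne_of_ne h1.symm h31.symm] at e1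
  rw [Equiv.swap_inv, Equiv.swap_apply_left, Equiv.swap_apply_of_ne_of_ne h31 h32] at e2
  rw [h, gB_pow_conj hn, gA_eq_permPT, gE_eq_colPT, e1, e2]

theorem gB_mul_gA (hn : 4 ≤ n) : gB n * gA n = permPT (cyc 2 (by omega)) := by
  rw [gB_eq_permPT hn, gA_eq_permPT, permPT_mul]
  congr 1
  refine Equiv.ext fun x => Fin.ext ?_
  have h1 := val_one hn
  have h2 := val_two hn
  have hc := cyc_val 1 (by omega) x
  rw [Perm.mul_apply, Equiv.swap_apply_def, cyc_val]
  simp only [Fin.ext_iff, hc, h1, h2]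
  split_ifs <;> (try simp only [hc, h1, h2]) <;> (try split_ifs) <;> omega

/-- Together with `1 ↦ 1`, the partial transformations of `{2, …, n - 1}` are generated by the
four transformations that occur in the commutation relations for `c₀`. -/
theorem mem_of_gens_two (hn : 4 ≤ n) (H : Submonoid (PT (Fin n))) (ha : permPT (swap 2 3) ∈ H)
    (hb : gB n * gA n ∈ H) (he : colPT 3 2 ∈ H) (hf : delPT 2 ∈ H) {α : PT (Fin n)}
    (hα : α ∈ PTzeta n) (h1 : α 1 = some 1) (h1' : ∀ x, x ≠ 1 → α x ≠ some 1) : α ∈ H := by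
  have e2 : (⟨2, by omega⟩ : Fin n) = 2 := Fin.ext (val_two hn).symm
  have e3 : (⟨2 + 1, by omega⟩ : Fin n) = 3 := Fin.ext (val_three hn).symm
  have v1 := val_one hn
  rw [mem_PTzeta_iff] at hα
  refine mem_of_cyc H 2 (by omega) ?_ ?_ ?_ α ?_ ?_ (Or.inl ?_)
  · rwa [← gB_mul_gA hn]
  · rwa [e2, e3]
  · rwa [e2, e3]
  · intro x hx
    have : x = 0 ∨ x = 1 := by rw [Fin.ext_iff, Fin.ext_iff, v1, val_zero]; omega
    rcases this with rfl | rfl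
    · exact hα.1
    · exact h1
  · intro x y hx hy
    have hx0 : x ≠ 0 := by rintro rfl; rw [val_zero] at hx; omega
    have hx1 : x ≠ 1 := by rintro rfl; omega
    have hy0 : y ≠ 0 := by rintro rfl; exact hα.2 x hx0 hy
    have hy1 : y ≠ 1 := by rintro rfl; exact h1' x hx1 hy
    rw [Ne, Fin.ext_iff, v1] at hy1
    have := val_ne_zero hy0
    omega
  · rwa [e2]

/-! ### The values of the relations -/

theorem gC_mul_comm {β : PT (Fin n)} (h0 : β 0 = some 0) (h1 : β 1 = some 1)
    (h : ∀ x, x ≠ 1 → β x ≠ some 1) : gC n * β = β * gC n := by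
  refine PT.ext (funext fun x => ?_)
  by_cases hx : x = 1
  · subst hx
    rw [PT.mul_apply_of_some h1, PT.mul_apply]
    simp [gC, h0]
  · have h2 := h x hx
    simp only [PT.mul_apply, gC, hx, if_false, Option.bind_some]
    rcases hy : β x with _ | y
    · rfl
    · have : y ≠ 1 := by rintro rfl; exact h2 hy
      simp [this]

theorem gD_mul_apply (α : PT (Fin n)) (x : Fin n) :
    (gD n * α) x = if x = 0 then none else α x := by
  simp only [PT.mul_apply, gD]; split_ifs <;> rfl

theorem gD_mul_comm {β : PT (Fin n)} (hβ : β ∈ PTzeta n) : gD n * β = β * gD n := by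
  rw [mem_PTzeta_iff] at hβ
  refine PT.ext (funext fun x => ?_)
  rw [gD_mul_apply, PT.mul_apply]
  split_ifs with hx
  · rw [hx, hβ.1]; simp [gD]
  · rcases hy : β x with _ | y
    · rfl
    · have : y ≠ 0 := by rintro rfl; exact hβ.2 x hx hy
      simp [gD, this]

theorem mul_gZ_apply {α : PT (Fin n)} (hα : α ∈ PTzeta n) (x : Fin n) :
    (α * gZ n) x = if x = 0 then some 1 else (α x).map fun _ => 0 := by
  rw [mem_PTzeta_iff] at hα
  split_ifs with hx
  · rw [hx, PT.mul_apply_of_some hα.1]; simp [gZ]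
  · rw [PT.mul_apply]
    rcases hy : α x with _ | y
    · rfl
    · have : y ≠ 0 := by rintro rfl; exact hα.2 x hx hy
      simp [gZ, this]

theorem mul_gZ_eq {α β : PT (Fin n)} (hα : α ∈ PTzeta n) (hβ : β ∈ PTzeta n)
    (h : ∀ x, α x = none ↔ β x = none) : α * gZ n = β * gZ n := by
  refine PT.ext (funext fun x => ?_)
  rw [mul_gZ_apply hα, mul_gZ_apply hβ]
  have := h x
  rcases hx : α x with _ | y <;> rcases hx' : β x with _ | w <;> simp_all

theorem mul_gZ_of_total {α : PT (Fin n)} (hα : α ∈ PTzeta n) (h : ∀ x, α x ≠ none) :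
    α * gZ n = gZ n := by
  rw [mul_gZ_eq hα (one_mem _) fun x => by simp [h x, PT.one_apply], one_mul]

theorem kappa_mem (hn : 4 ≤ n) : kappa n ∈ PTzeta n := by
  have h1 := one_ne_zero_of_le hn
  rw [mem_PTzeta_iff]
  exact ⟨by simp [kappa], fun x hx => by simp [kappa, hx, h1]⟩

theorem zeroId_mem : zeroId n ∈ PTzeta n := by
  rw [mem_PTzeta_iff]
  exact ⟨by simp [zeroId], fun x hx => by simp [zeroId, hx]⟩

theorem gA_total (x : Fin n) : gA n x ≠ none := by rw [gA_eq_permPT]; simp [permPT]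

theorem gB_total (hn : 4 ≤ n) (x : Fin n) : gB n x ≠ none := by
  rw [gB_eq_permPT hn]; simp [permPT]

theorem gE_total (x : Fin n) : gE n x ≠ none := by
  rw [gE_eq_colPT, colPT]; simp only; split_ifs <;> simp

theorem gD_mul_gZ (hn : 4 ≤ n) : gD n * gZ n = gZ n * gF n := by
  have h1 := one_ne_zero_of_le hn
  refine PT.ext (funext fun x => ?_)
  rw [gD_mul_apply, PT.mul_apply]
  split_ifs with h <;> simp [gZ, gF, h, h1.symm]

theorem gZ_mul_gD (hn : 4 ≤ n) : gZ n * gD n = zeroId n * gZ n := by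
  have h1 := one_ne_zero_of_le hn
  refine PT.ext (funext fun x => ?_)
  rw [mul_gZ_apply zeroId_mem, PT.mul_apply]
  split_ifs with h <;> simp [gZ, gD, h, h1, zeroId]

theorem gD_mul_zeroId_mul_gZ : gD n * zeroId n * gZ n = gD n * zeroId n := by
  refine PT.ext (funext fun x => ?_)
  rw [mul_assoc, gD_mul_apply, gD_mul_apply, mul_gZ_apply zeroId_mem]
  split_ifs with h
  · rfl
  · simp [zeroId, h]

theorem gD_mul_gD : gD n * gD n = gD n := by
  refine PT.ext (funext fun x => ?_)
  rw [gD_mul_apply]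
  split_ifs with h <;> simp [gD, h]

theorem gC_mul_apply (α : PT (Fin n)) (x : Fin n) :
    (gC n * α) x = if x = 1 then α 0 else α x := by
  simp only [PT.mul_apply, gC]; split_ifs <;> rfl

theorem gC_mul_eq {α β : PT (Fin n)} (h : ∀ x, x ≠ 1 → α x = β x) (h0 : (1 : Fin n) ≠ 0) :
    gC n * α = gC n * β := by
  refine PT.ext (funext fun x => ?_)
  rw [gC_mul_apply, gC_mul_apply, h 0 h0.symm]
  split_ifs with hx
  · rfl
  · exact h x hx

theorem mul_gC_of_notMem {α : PT (Fin n)} (h : ∀ x, α x ≠ some 1) : α * gC n = α := by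
  refine PT.ext (funext fun x => ?_)
  rw [PT.mul_apply]
  rcases hy : α x with _ | y
  · rfl
  · have : y ≠ 1 := by rintro rfl; exact h x hy
    simp [gC, this]

theorem gC_mul_gZ_mul_gC (hn : 4 ≤ n) : gC n * gZ n * gC n = gZ n * gC n := by
  have h1 := one_ne_zero_of_le hn
  refine PT.ext (funext fun x => ?_)
  rw [mul_assoc, gC_mul_apply]
  split_ifs with h
  · simp [PT.mul_apply, gZ, gC, h, h1, h1.symm]
  · rfl

theorem gZ_sq_mul_gC (hn : 4 ≤ n) : gZ n * gZ n * gC n = gZ n * gC n := by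
  have h1 := one_ne_zero_of_le hn
  rw [gZ_mul_gZ hn]
  refine PT.ext (funext fun x => ?_)
  by_cases h : x = 0 <;> simp [PT.mul_apply, gZ, gC, kappa, h, h1.symm]

theorem gC_mul_gD : gC n * gD n = gF n * gD n := by
  refine PT.ext (funext fun x => ?_)
  rw [gC_mul_apply, PT.mul_apply]
  split_ifs with h <;> simp [gF, gD, h]

theorem gC_mul_gC (hn : 4 ≤ n) : gC n * gC n = gC n := by
  have h1 := one_ne_zero_of_le hn
  refine PT.ext (funext fun x => ?_)
  rw [gC_mul_apply]
  split_ifs with h <;> simp [gC, h, h1.symm]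

theorem gE_mul_gC (hn : 4 ≤ n) : gE n * gC n = gC n * gA n * gC n := by
  have h1 := one_ne_zero_of_le hn
  have h2 := two_ne_zero_of_le hn
  have h21 := two_ne_one_of_le hn
  refine PT.ext (funext fun x => ?_)
  rw [mul_assoc, gC_mul_apply, PT.mul_apply, PT.mul_apply, PT.mul_apply]
  simp only [gE, gC, gA]
  by_cases hx1 : x = 1
  · simp [hx1, h21.symm, h1.symm, h2.symm]
  · by_cases hx2 : x = 2
    · simp [hx2, h21]
    · simp [hx1, hx2]

theorem gC_mul_gF (hn : 4 ≤ n) : gC n * gF n = gC n := by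
  have h1 := one_ne_zero_of_le hn
  conv_rhs => rw [← mul_one (gC n)]
  exact gC_mul_eq (fun x hx => by simp [gF, hx, PT.one_apply]) h1

theorem gF_mul_gC : gF n * gC n = gF n :=
  mul_gC_of_notMem fun x => by
    simp only [gF]; split_ifs with h
    · simp
    · simpa using h

theorem gD_mul_gC_mul_gZ (hn : 4 ≤ n) :
    gD n * gC n * gZ n * gB n ^ (n - 2) = gA n * (gB n * gE n) ^ (n - 3) * gD n * gC n := by
  have h1 := one_ne_zero_of_le hn
  refine PT.ext (funext fun x => ?_)
  rw [PT.mul_apply (_ * gD n) (gC n), gB_gE_pow hn, mul_assoc, mul_assoc, gD_mul_apply,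
    gC_mul_apply]
  split_ifs with h h'
  · rfl
  · rw [PT.mul_apply_of_some (show gZ n 0 = some 1 by simp [gZ]), gB_pow_apply hn _ h1,
      Option.bind_some]
    have e : (⟨((1 : Fin n).val - 1 + (n - 2)) % (n - 1) + 1, by
        have := Nat.mod_lt ((1 : Fin n).val - 1 + (n - 2)) (show 0 < n - 1 by omega)
        omega⟩ : Fin n) = ⟨n - 1, by omega⟩ := by
      apply Fin.ext
      simp only [val_one hn]
      rw [Nat.mod_eq_of_lt (by omega)]; omega
    have e' : (⟨n - 1, by omega⟩ : Fin n) ≠ 1 := by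
      rw [Ne, Fin.ext_iff, val_one hn]; simp only; omega
    rw [e]
    simp [gC, e']
  · rw [PT.mul_apply_of_some (show gZ n x = some 0 by simp [gZ, h]), gB_pow_zero_apply hn]
    simp [gC]

end Star

/-! ### Normal forms modulo the relations `R_s` -/

section Strong

variable {n : ℕ} [NeZero n] {Q : Type*} [Monoid Q]

/-- The partial identity on the domain of `α`, with `0` added to the domain. -/
def domId (α : PT (Fin n)) : PT (Fin n) :=
  ⟨fun x => if x = 0 then some 0 else (α x).map fun _ => x⟩

/-- The extension of `α` to a transformation defined everywhere: the missing values are `1`. -/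
def totalExt (α : PT (Fin n)) : PT (Fin n) := ⟨fun x => some ((α x).getD 1)⟩

/-- The modification of `α` that fixes `0`. -/
def fixZero (α : PT (Fin n)) : PT (Fin n) := ⟨fun x => if x = 0 then some 0 else α x⟩

theorem domId_mem (α : PT (Fin n)) : domId α ∈ PTzeta n := by
  rw [mem_PTzeta_iff]
  refine ⟨by simp [domId], fun x hx => ?_⟩
  rcases h : α x with _ | y <;> simp [domId, hx, h]

theorem fixZero_mem {α : PT (Fin n)} (h : ∀ x, x ≠ 0 → α x ≠ some 0) : fixZero α ∈ PTzeta n := by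
  rw [mem_PTzeta_iff]
  exact ⟨by simp [fixZero], fun x hx => by simpa [fixZero, hx] using h x hx⟩

theorem totalExt_mem (hn : 4 ≤ n) {α : PT (Fin n)} (hα : α ∈ PTzeta n) :
    totalExt α ∈ PTzeta n := by
  have h1 := one_ne_zero_of_le hn
  rw [mem_PTzeta_iff] at hα ⊢
  refine ⟨by simp [totalExt, hα.1], fun x hx => ?_⟩
  have := hα.2 x hx
  rcases h : α x with _ | y <;> simp_all [totalExt]

theorem domId_mul_totalExt {α : PT (Fin n)} (hα : α ∈ PTzeta n) :
    domId α * totalExt α = α := by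
  rw [mem_PTzeta_iff] at hα
  refine PT.ext (funext fun x => ?_)
  rw [PT.mul_apply]
  by_cases hx : x = 0
  · simp [domId, totalExt, hx, hα.1]
  · rcases h : α x with _ | y <;> simp [domId, totalExt, hx, h]

/-- The relations `R_s`, for elements `d` and `z` of a monoid `Q` and a homomorphism `J` to `Q`
from the copy of `PT(Ω_{n-1})`. -/
structure StrongRel (J : PT (Fin n) → Q) (d z : Q) : Prop where
  rep : IsRep (PTzeta n) J
  d_mul_d : d * d = d
  a_mul_d : J (gA n) * d = d * J (gA n)
  b_mul_d : J (gB n) * d = d * J (gB n)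
  e_mul_d : J (gE n) * d = d * J (gE n)
  f_mul_d : J (gF n) * d = d * J (gF n)
  a_mul_z : J (gA n) * z = z
  b_mul_z : J (gB n) * z = z
  e_mul_z : J (gE n) * z = z
  d_mul_z : d * z = z * J (gF n)
  z_mul_d : z * d = J (zeroId n) * z
  z_mul_z : z * z = J (kappa n)
  d_mul_zeroId_mul_z : d * J (zeroId n) * z = d * J (zeroId n)

namespace StrongRel

variable {J : PT (Fin n) → Q} {d z : Q} (h : StrongRel J d z) (hn : 4 ≤ n)

include h hn

theorem comm_d {α : PT (Fin n)} (hα : α ∈ PTzeta n) : J α * d = d * J α := by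
  let H : Submonoid (PT (Fin n)) :=
    { carrier := {α | α ∈ PTzeta n ∧ J α * d = d * J α}
      one_mem' := ⟨one_mem _, by rw [h.rep.one, one_mul, mul_one]⟩
      mul_mem' := fun {α β} hα hβ => ⟨mul_mem hα.1 hβ.1, by
        rw [h.rep.mul _ hα.1 _ hβ.1, mul_assoc, hβ.2, ← mul_assoc, hα.2, mul_assoc]⟩ }
  exact (mem_of_gens hn H ⟨gA_mem hn, h.a_mul_d⟩ ⟨gB_mem hn, h.b_mul_d⟩ ⟨gE_mem hn, h.e_mul_d⟩ hα
    (Or.inl ⟨gF_mem hn, h.f_mul_d⟩)).2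

theorem mul_z_of_total {α : PT (Fin n)} (hα : α ∈ PTzeta n) (ht : ∀ x, α x ≠ none) :
    J α * z = z := by
  let H : Submonoid (PT (Fin n)) :=
    { carrier := {α | α ∈ PTzeta n ∧ J α * z = z}
      one_mem' := ⟨one_mem _, by rw [h.rep.one, one_mul]⟩
      mul_mem' := fun {α β} hα hβ => ⟨mul_mem hα.1 hβ.1, by
        rw [h.rep.mul _ hα.1 _ hβ.1, mul_assoc, hβ.2, hα.2]⟩ }
  exact (mem_of_gens hn H ⟨gA_mem hn, h.a_mul_z⟩ ⟨gB_mem hn, h.b_mul_z⟩ ⟨gE_mem hn, h.e_mul_z⟩ hα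
    (Or.inr ht)).2

/-- `J α * z` depends only on the domain of `α`. -/
theorem mul_z_eq {α β : PT (Fin n)} (hα : α ∈ PTzeta n) (hβ : β ∈ PTzeta n)
    (hd : ∀ x, x ≠ 0 → (α x = none ↔ β x = none)) : J α * z = J β * z := by
  have key : ∀ γ ∈ PTzeta n, J γ * z = J (domId γ) * z := by
    intro γ hγ
    conv_lhs => rw [← domId_mul_totalExt hγ]
    rw [h.rep.mul _ (domId_mem γ) _ (totalExt_mem hn hγ), mul_assoc,
      h.mul_z_of_total hn (totalExt_mem hn hγ) (fun x => by simp [totalExt])]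
  rw [key α hα, key β hβ]
  congr 2
  refine PT.ext (funext fun x => ?_)
  by_cases hx : x = 0
  · simp [domId, hx]
  · have := hd x hx
    rcases h1 : α x with _ | y <;> rcases h2 : β x with _ | w <;> simp_all [domId]

/-- Both sides are equal to `z * z * z`. -/
theorem z_mul_kappa : z * J (kappa n) = z := by
  rw [← h.z_mul_z, ← mul_assoc, h.z_mul_z]
  exact h.mul_z_of_total hn (kappa_mem hn) fun x => by simp only [kappa]; split_ifs <;> simp

/-- `z * J β` depends only on the image of `1` under `β`. -/
theorem z_mul_eq {α β : PT (Fin n)} (hα : α ∈ PTzeta n) (hβ : β ∈ PTzeta n)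
    (h1 : α 1 = β 1) : z * J α = z * J β := by
  have : kappa n * α = kappa n * β := by
    refine PT.ext (funext fun x => ?_)
    rw [mem_PTzeta_iff] at hα hβ
    by_cases hx : x = 0
    · simp [PT.mul_apply, kappa, hx, hα.1, hβ.1]
    · simp [PT.mul_apply, kappa, hx, h1]
  rw [← h.z_mul_kappa hn, mul_assoc, mul_assoc, ← h.rep.mul _ (kappa_mem hn) _ hα, this,
    h.rep.mul _ (kappa_mem hn) _ hβ]

theorem z_mul_of_none {β : PT (Fin n)} (hβ : β ∈ PTzeta n) (h1 : β 1 = none) :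
    z * J β = d * z := by
  rw [h.d_mul_z]
  exact h.z_mul_eq hn hβ (gF_mem hn) (by simp [gF, h1])

theorem z_mul_of_some {β : PT (Fin n)} (hβ : β ∈ PTzeta n) {y : Fin n} (h1 : β 1 = some y) :
    z * J β = z * J (gB n ^ (y.val - 1)) := by
  refine h.z_mul_eq hn hβ (pow_mem (gB_mem hn) _) ?_
  have hy : y ≠ 0 := by rintro rfl; exact (mem_PTzeta_iff.1 hβ).2 1 (one_ne_zero_of_le hn) h1
  rw [h1, gB_pow_one_apply hn hy]

omit h hn in
/-- The normal forms modulo `R_s`. In the last one, `y` is the image of `0`. -/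
def Form (J : PT (Fin n) → Q) (d z q : Q) : Prop :=
  ∃ α ∈ PTzeta n, q = J α ∨ q = d * J α ∨ q = d * J α * z ∨
    ∃ y : Fin n, y ≠ 0 ∧ q = J α * z * J (gB n ^ (y.val - 1))

theorem form_mul_z_mul {α β : PT (Fin n)} (hα : α ∈ PTzeta n) (hβ : β ∈ PTzeta n) :
    Form J d z (J α * z * J β) := by
  rcases h1 : β 1 with _ | y
  · refine ⟨α, hα, Or.inr (Or.inr (Or.inl ?_))⟩
    rw [mul_assoc, h.z_mul_of_none hn hβ h1, ← mul_assoc, h.comm_d hn hα]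
  · refine ⟨α, hα, Or.inr (Or.inr (Or.inr ⟨y, ?_, ?_⟩))⟩
    · rintro rfl; exact (mem_PTzeta_iff.1 hβ).2 1 (one_ne_zero_of_le hn) h1
    · rw [mul_assoc, h.z_mul_of_some hn hβ h1, ← mul_assoc]

theorem form_mul {q : Q} (hq : Form J d z q) {β : PT (Fin n)} (hβ : β ∈ PTzeta n) :
    Form J d z (q * J β) := by
  obtain ⟨α, hα, rfl | rfl | rfl | ⟨y, hy, rfl⟩⟩ := hq
  · exact ⟨α * β, mul_mem hα hβ, Or.inl (h.rep.mul _ hα _ hβ).symm⟩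
  · exact ⟨α * β, mul_mem hα hβ, Or.inr (Or.inl (by rw [h.rep.mul _ hα _ hβ, mul_assoc]))⟩
  · refine ⟨α, hα, Or.inr (Or.inr (Or.inl ?_))⟩
    rw [← h.comm_d hn hα, mul_assoc (J α), mul_assoc (J α), h.d_mul_z, mul_assoc z,
      ← h.rep.mul _ (gF_mem hn) _ hβ, h.z_mul_of_none hn (mul_mem (gF_mem hn) hβ)
      (PT.mul_apply_of_none (by simp [gF])), h.d_mul_z]
  · have hb := pow_mem (gB_mem hn) (y.val - 1)
    rw [mul_assoc, ← h.rep.mul _ hb _ hβ]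
    exact h.form_mul_z_mul hn hα (mul_mem hb hβ)

theorem form_mul_d {q : Q} (hq : Form J d z q) : Form J d z (q * d) := by
  obtain ⟨α, hα, rfl | rfl | rfl | ⟨y, hy, rfl⟩⟩ := hq
  · exact ⟨α, hα, Or.inr (Or.inl (h.comm_d hn hα))⟩
  · exact ⟨α, hα, Or.inr (Or.inl (by rw [mul_assoc, h.comm_d hn hα, ← mul_assoc, h.d_mul_d]))⟩
  · refine ⟨α * zeroId n, mul_mem hα zeroId_mem, Or.inr (Or.inr (Or.inl ?_))⟩
    rw [mul_assoc, h.z_mul_d, h.rep.mul _ hα _ zeroId_mem]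
    simp only [mul_assoc]
  · have hb := pow_mem (gB_mem hn) (y.val - 1)
    rw [mul_assoc, h.comm_d hn hb, ← mul_assoc, mul_assoc (J α), h.z_mul_d, ← mul_assoc,
      ← h.rep.mul _ hα _ zeroId_mem]
    exact h.form_mul_z_mul hn (mul_mem hα zeroId_mem) hb

theorem form_mul_z {q : Q} (hq : Form J d z q) : Form J d z (q * z) := by
  obtain ⟨α, hα, rfl | rfl | rfl | ⟨y, hy, rfl⟩⟩ := hq
  · have := h.form_mul_z_mul hn hα (one_mem _)
    rwa [h.rep.one, mul_one] at this
  · exact ⟨α, hα, Or.inr (Or.inr (Or.inl rfl))⟩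
  · refine ⟨α * kappa n, mul_mem hα (kappa_mem hn), Or.inr (Or.inl ?_)⟩
    rw [mul_assoc, h.z_mul_z, h.rep.mul _ hα _ (kappa_mem hn), mul_assoc]
  · refine ⟨α * kappa n, mul_mem hα (kappa_mem hn), Or.inl ?_⟩
    rw [mul_assoc, h.mul_z_of_total hn (pow_mem (gB_mem hn) _), mul_assoc, h.z_mul_z,
      h.rep.mul _ hα _ (kappa_mem hn)]
    intro x
    by_cases hx : x = 0
    · rw [hx, gB_pow_zero_apply hn]; simp
    · rw [gB_pow_apply hn _ hx]; simp

omit h in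
theorem mul_gZ_mul_pow_zero {α : PT (Fin n)} (hα : α ∈ PTzeta n) {y : Fin n} (hy : y ≠ 0) :
    (α * gZ n * gB n ^ (y.val - 1)) 0 = some y := by
  rw [PT.mul_apply, mul_gZ_apply hα, if_pos rfl, Option.bind_some, gB_pow_one_apply hn hy]

omit h in
theorem mul_gZ_mul_pow_of_ne {α : PT (Fin n)} (hα : α ∈ PTzeta n) (l : ℕ) {x : Fin n}
    (hx : x ≠ 0) : (α * gZ n * gB n ^ l) x = (α x).map fun _ => 0 := by
  rw [PT.mul_apply, mul_gZ_apply hα, if_neg hx]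
  rcases α x with _ | y
  · rfl
  · simp [gB_pow_zero_apply hn]

/-- Normal forms with the same value are equal. -/
theorem form_unique (E : Q →* PT (Fin n)) (hE : ∀ α ∈ PTzeta n, E (J α) = α) (hd : E d = gD n)
    (hz : E z = gZ n) {p q : Q} (hp : Form J d z p) (hq : Form J d z q) (hpq : E p = E q) :
    p = q := by
  have map_eq : ∀ {s t : Option (Fin n)}, (s.map fun _ => (0 : Fin n)) = t.map (fun _ => 0) →
      (s = none ↔ t = none) := by
    intro s t hst
    rcases s with _ | s <;> rcases t with _ | t <;> simp_all
  -- the two shapes whose values can coincide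
  have mixed : ∀ α ∈ PTzeta n, ∀ β ∈ PTzeta n, gD n * α = gD n * β * gZ n →
      d * J α = d * J β * z := by
    intro α hα β hβ heq
    have hx : ∀ x, x ≠ 0 → α x = none ∧ β x = none := by
      intro x hx
      have := congrArg (fun γ : PT (Fin n) => γ x) heq
      simp only [mul_assoc, gD_mul_apply, mul_gZ_apply hβ, hx, if_false] at this
      have h2 := (mem_PTzeta_iff.1 hα).2 x hx
      rcases hx' : β x with _ | w <;> simp_all
    have zero_of : ∀ γ ∈ PTzeta n, (∀ x, x ≠ 0 → γ x = none) → γ = zeroId n := by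
      intro γ hγ hγx
      refine PT.ext (funext fun x => ?_)
      by_cases hx : x = 0
      · simp [hx, (mem_PTzeta_iff.1 hγ).1, zeroId]
      · simp [hx, hγx x hx, zeroId]
    rw [zero_of α hα fun x hx' => (hx x hx').1, zero_of β hβ fun x hx' => (hx x hx').2,
      h.d_mul_zeroId_mul_z]
  obtain ⟨α, hα, hp⟩ := hp
  obtain ⟨β, hβ, hq⟩ := hq
  have hα0 := (mem_PTzeta_iff.1 hα).1
  have hβ0 := (mem_PTzeta_iff.1 hβ).1
  have h0 := congrArg (fun γ : PT (Fin n) => γ 0) hpq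
  have v2 : ∀ γ : PT (Fin n), (gD n * γ) 0 = none := fun γ => by rw [gD_mul_apply, if_pos rfl]
  have hEb : ∀ l, E (J (gB n ^ l)) = gB n ^ l := fun l => hE _ (pow_mem (gB_mem hn) l)
  obtain rfl | rfl | rfl | ⟨y, hy, rfl⟩ := hp <;> obtain rfl | rfl | rfl | ⟨w, hw, rfl⟩ := hq <;>
    simp only [map_mul, hE α hα, hE β hβ, hd, hz, hEb, mul_assoc (gD n), v2, hα0, hβ0] at h0 hpq <;>
    (try rw [mul_gZ_mul_pow_zero hn hα hy] at h0) <;>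
    (try rw [mul_gZ_mul_pow_zero hn hβ hw] at h0) <;>
    (try simp only [reduceCtorEq, Option.some.injEq] at h0)
  · rw [hpq]
  · exact absurd h0.symm hw
  · congr 2
    refine PT.ext (funext fun x => ?_)
    by_cases hx : x = 0
    · rw [hx, hα0, hβ0]
    · have := congrArg (fun γ : PT (Fin n) => γ x) hpq
      simpa [gD_mul_apply, hx] using this
  · exact mixed α hα β hβ (by rw [hpq, mul_assoc])
  · exact (mixed β hβ α hα (by rw [← hpq, mul_assoc])).symm
  · rw [mul_assoc, mul_assoc d]
    congr 1
    refine h.mul_z_eq hn hα hβ fun x hx => ?_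
    have := congrArg (fun γ : PT (Fin n) => γ x) hpq
    simp only [gD_mul_apply, mul_gZ_apply hα, mul_gZ_apply hβ, hx, if_false] at this
    exact map_eq this
  · exact absurd h0 hy
  · subst h0
    congr 1
    refine h.mul_z_eq hn hα hβ fun x hx => ?_
    have := congrArg (fun γ : PT (Fin n) => γ x) hpq
    simp only [mul_gZ_mul_pow_of_ne hn hα _ hx, mul_gZ_mul_pow_of_ne hn hβ _ hx] at this
    exact map_eq this

end StrongRel

theorem gD_mem : gD n ∈ PsEnd (starS n) := by
  refine mem_PsEnd_iff.2 (Or.inr (Or.inl ⟨by simp [gD], fun x => ?_⟩))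
  simp only [gD]; split_ifs with hx <;> simp [hx]

theorem gZ_mem (hn : 4 ≤ n) : gZ n ∈ PsEnd (starS n) :=
  mem_PsEnd_iff.2 (Or.inr (Or.inr (Or.inr
    ⟨1, one_ne_zero_of_le hn, by simp [gZ], fun x hx => by simp [gZ, hx]⟩)))

/-- Every strong endomorphism is a value of a normal form. -/
theorem eq_of_mem_PsEnd (hn : 4 ≤ n) {α : PT (Fin n)} (hα : α ∈ PsEnd (starS n)) :
    α ∈ PTzeta n ∨ α 0 = none ∧ (∀ x, α x ≠ some 0) ∧ α = gD n * fixZero α ∨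
      α = gD n * domId α * gZ n ∨
      ∃ y, y ≠ 0 ∧ α 0 = some y ∧ α = domId α * gZ n * gB n ^ (y.val - 1) := by
  rcases mem_PsEnd_iff.1 hα with h | ⟨h0, h⟩ | ⟨h0, h⟩ | ⟨y, hy, h0, h⟩
  · exact Or.inl (mem_PTzeta_iff.2 h)
  · refine Or.inr (Or.inl ⟨h0, h, PT.ext (funext fun x => ?_)⟩)
    rw [gD_mul_apply]
    split_ifs with hx <;> simp [hx, h0, fixZero]
  · refine Or.inr (Or.inr (Or.inl (PT.ext (funext fun x => ?_))))
    rw [mul_assoc, gD_mul_apply, mul_gZ_apply (domId_mem α)]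
    split_ifs with hx
    · rw [hx, h0]
    · rcases h x with h1 | h1 <;> simp [domId, hx, h1]
  · refine Or.inr (Or.inr (Or.inr ⟨y, hy, h0, PT.ext (funext fun x => ?_)⟩))
    by_cases hx : x = 0
    · rw [hx, StrongRel.mul_gZ_mul_pow_zero hn (domId_mem α) hy, h0]
    · rw [StrongRel.mul_gZ_mul_pow_of_ne hn (domId_mem α) _ hx]
      rcases h x hx with h1 | h1 <;> simp [domId, hx, h1]

end Strong

/-! ### The presentation of `PsEnd(S_n)` -/

section StrongPresentation

variable {Q : Type*} [Monoid Q]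

/-- Induction on words by right multiplication with letters. -/
theorem lift_induction {X : Type*} (f : X → Q) (P : Q → Prop) (h1 : P 1)
    (hmul : ∀ q x, P q → P (q * f x)) (w : FreeMonoid X) : P (FreeMonoid.lift f w) := by
  have key : ∀ w : FreeMonoid X, ∀ q, P q → P (q * FreeMonoid.lift f w) := by
    intro w
    induction w using FreeMonoid.inductionOn' with
    | one => intro q hq; simpa using hq
    | of_mul x w ih =>
      intro q hq
      rw [map_mul, FreeMonoid.lift_eval_of, ← mul_assoc]
      exact ih _ (hmul q x hq)
  have := key w 1 h1
  rwa [one_mul] at this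

theorem mk_eq_lift {X : Type*} (r : FreeMonoid X → FreeMonoid X → Prop) (w : FreeMonoid X) :
    PresentedMonoid.mk r w = FreeMonoid.lift (PresentedMonoid.of r) w :=
  congrArg (fun φ : FreeMonoid X →* _ => φ w) (FreeMonoid.hom_eq fun _ => rfl)

/-- What it means for the letters `f x` to satisfy the relations `R_s`, spelled out. -/
theorem relS_iff (n : ℕ) (R₀ : Set (FreeMonoid LetterT × FreeMonoid LetterT)) (f : LetterS → Q) :
    (∀ u v, (u, v) ∈ relS n R₀ → FreeMonoid.lift f u = FreeMonoid.lift f v) ↔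
    (∀ u v, (u, v) ∈ R₀ → FreeMonoid.lift (fun x => f (LetterT.toS x)) u =
      FreeMonoid.lift (fun x => f (LetterT.toS x)) v) ∧
    (f .d ^ 2 = f .d ∧ f .a * f .d = f .d * f .a ∧ f .b * f .d = f .d * f .b ∧
      f .e * f .d = f .d * f .e ∧ f .f * f .d = f .d * f .f) ∧
    f .a * f .z = f .z ∧ f .b * f .z = f .z ∧ f .e * f .z = f .z ∧ f .d * f .z = f .z * f .f ∧
    f .z * f .d = (f .f * f .b) ^ (n - 1) * f .z ∧
    f .z ^ 2 = (f .e * f .b) ^ (n - 3) * f .e ∧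
    f .d * (f .f * f .b) ^ (n - 1) * f .z = f .d * (f .f * f .b) ^ (n - 1) := by
  have key : ∀ u v, (u, v) ∈ relS n R₀ ↔ _ := fun u v => by
    simp only [relS, relD, mapRel, Set.mem_union, Set.mem_image, Set.mem_insert_iff,
      Set.mem_singleton_iff, Prod.exists, Prod.mk.injEq]
    exact Iff.rfl
  simp only [key, or_imp, forall_and, forall_exists_index, and_imp]
  simp only [← lift_map_eq]
  constructor
  · rintro ⟨⟨h0, h1, h2, h3, h4, h5⟩, h6, h7, h8, h9, h10, h11, h12⟩
    refine ⟨fun u v h => h0 _ _ u v h rfl rfl, ⟨?_, ?_, ?_, ?_, ?_⟩, ?_, ?_, ?_, ?_, ?_, ?_, ?_⟩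
    · simpa using h1 _ _ rfl rfl
    · simpa using h2 _ _ rfl rfl
    · simpa using h3 _ _ rfl rfl
    · simpa using h4 _ _ rfl rfl
    · simpa using h5 _ _ rfl rfl
    · simpa using h6 _ _ rfl rfl
    · simpa using h7 _ _ rfl rfl
    · simpa using h8 _ _ rfl rfl
    · simpa using h9 _ _ rfl rfl
    · simpa using h10 _ _ rfl rfl
    · simpa using h11 _ _ rfl rfl
    · simpa using h12 _ _ rfl rfl
  · rintro ⟨h0, ⟨h1, h2, h3, h4, h5⟩, h6, h7, h8, h9, h10, h11, h12⟩
    refine ⟨⟨?_, ?_, ?_, ?_, ?_, ?_⟩, ?_, ?_, ?_, ?_, ?_, ?_, ?_⟩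
    · rintro _ _ u v h rfl rfl; exact h0 u v h
    all_goals
      rintro _ _ rfl rfl
      simpa

variable {n : ℕ} [NeZero n]

theorem genT_mem (hn : 4 ≤ n) (x : LetterT) : genT n x ∈ PTzeta n := by
  cases x
  · exact gA_mem hn
  · exact gB_mem hn
  · exact gE_mem hn
  · exact gF_mem hn

theorem genS_mem (hn : 4 ≤ n) (x : LetterS) : genS n x ∈ PsEnd (starS n) := by
  cases x
  · exact PTzeta_le_PsEnd (gA_mem hn)
  · exact PTzeta_le_PsEnd (gB_mem hn)
  · exact PTzeta_le_PsEnd (gE_mem hn)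
  · exact PTzeta_le_PsEnd (gF_mem hn)
  · exact gD_mem
  · exact gZ_mem hn

variable {R₀ : Set (FreeMonoid LetterT × FreeMonoid LetterT)}

/-- The relations `R_s` hold for the transformations denoted by the letters. -/
theorem relS_sound (hn : 4 ≤ n) (hR₀ : Defines R₀ (PTzeta n) (genT n)) :
    ∀ u v, (u, v) ∈ relS n R₀ →
      FreeMonoid.lift (genS n) u = FreeMonoid.lift (genS n) v := by
  refine (relS_iff n R₀ (genS n)).2 ⟨fun u v h => hR₀.rel h, ⟨?_, ?_, ?_, ?_, ?_⟩,
    ?_, ?_, ?_, ?_, ?_, ?_, ?_⟩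
  · rw [pow_two]; exact gD_mul_gD
  · exact (gD_mul_comm (gA_mem hn)).symm
  · exact (gD_mul_comm (gB_mem hn)).symm
  · exact (gD_mul_comm (gE_mem hn)).symm
  · exact (gD_mul_comm (gF_mem hn)).symm
  · exact mul_gZ_of_total (gA_mem hn) gA_total
  · exact mul_gZ_of_total (gB_mem hn) (gB_total hn)
  · exact mul_gZ_of_total (gE_mem hn) gE_total
  · exact gD_mul_gZ hn
  · exact (gZ_mul_gD hn).trans (by rw [← gF_gB_pow hn]; rfl)
  · rw [pow_two]; exact (gZ_mul_gZ hn).trans (gE_gB_pow hn).symm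
  · have := gD_mul_zeroId_mul_gZ (n := n)
    rw [← gF_gB_pow hn] at this
    exact this

/-- A monoid with elements satisfying `R_s` receives a homomorphism from the copy of
`PT(Ω_{n-1})`, and the relations take the form used in `StrongRel`. -/
theorem exists_strongRel (hn : 4 ≤ n) (hR₀ : Defines R₀ (PTzeta n) (genT n)) (f : LetterS → Q)
    (hf : ∀ u v, (u, v) ∈ relS n R₀ → FreeMonoid.lift f u = FreeMonoid.lift f v) :
    ∃ J : PT (Fin n) → Q, StrongRel J (f .d) (f .z) ∧
      ∀ x, J (genT n x) = f (LetterT.toS x) := by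
  obtain ⟨h0, ⟨h1, h2, h3, h4, h5⟩, h6, h7, h8, h9, h10, h11, h12⟩ := (relS_iff n R₀ f).1 hf
  obtain ⟨J, hJ, hJg⟩ := hR₀.exists_isRep _ h0
  have ha : J (gA n) = f .a := hJg .a
  have hb : J (gB n) = f .b := hJg .b
  have he : J (gE n) = f .e := hJg .e
  have hf' : J (gF n) = f .f := hJg .f
  have hk : J (kappa n) = (f .e * f .b) ^ (n - 3) * f .e := by
    have := mul_mem (gE_mem hn) (gB_mem hn)
    rw [← gE_gB_pow hn, hJ.mul _ (pow_mem this _) _ (gE_mem hn), hJ.pow this,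
      hJ.mul _ (gE_mem hn) _ (gB_mem hn), he, hb]
  have h0 : J (zeroId n) = (f .f * f .b) ^ (n - 1) := by
    rw [← gF_gB_pow hn, hJ.pow (mul_mem (gF_mem hn) (gB_mem hn)),
      hJ.mul _ (gF_mem hn) _ (gB_mem hn), hf', hb]
  refine ⟨J, ⟨hJ, ?_, ?_, ?_, ?_, ?_, ?_, ?_, ?_, ?_, ?_, ?_, ?_⟩, hJg⟩
  · rw [← pow_two, h1]
  · rw [ha, h2]
  · rw [hb, h3]
  · rw [he, h4]
  · rw [hf', h5]
  · rw [ha, h6]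
  · rw [hb, h7]
  · rw [he, h8]
  · rw [hf', h9]
  · rw [h0, h10]
  · rw [hk, ← pow_two, h11]
  · rw [h0, h12]

theorem exists_word_of_mem_PsEnd (hn : 4 ≤ n) (hR₀ : Defines R₀ (PTzeta n) (genT n))
    {α : PT (Fin n)} (hα : α ∈ PsEnd (starS n)) : ∃ w, FreeMonoid.lift (genS n) w = α := by
  have hl : ∀ x, genS n x ∈ MonoidHom.mrange (FreeMonoid.lift (genS n)) :=
    fun x => ⟨FreeMonoid.of x, rfl⟩
  have hT : PTzeta n ≤ MonoidHom.mrange (FreeMonoid.lift (genS n)) := hR₀.le _ fun x => hl _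
  have hb : ∀ l, gB n ^ l ∈ MonoidHom.mrange (FreeMonoid.lift (genS n)) :=
    fun l => pow_mem (hl .b) l
  change α ∈ MonoidHom.mrange (FreeMonoid.lift (genS n))
  rcases eq_of_mem_PsEnd hn hα with h | ⟨-, h, h'⟩ | h | ⟨y, -, -, h⟩
  · exact hT h
  · rw [h']; exact mul_mem (hl .d) (hT (fixZero_mem fun x _ => h x))
  · rw [h]; exact mul_mem (mul_mem (hl .d) (hT (domId_mem α))) (hl .z)
  · rw [h]; exact mul_mem (mul_mem (hT (domId_mem α)) (hl .z)) (hb _)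

/-- The presentation `⟨a₀, b₀, e₀, f₀, d, z | R_s⟩` defines `PsEnd(S_n)`. -/
theorem defines_PsEnd (hn : 4 ≤ n) (hR₀ : Defines R₀ (PTzeta n) (genT n)) :
    Defines (relS n R₀) (PsEnd (starS n)) (genS n) := by
  refine Defines.of_words (genS_mem hn) (relS_sound hn hR₀)
    (fun α hα => exists_word_of_mem_PsEnd hn hR₀ hα) fun u v huv => ?_
  let r : FreeMonoid LetterS → FreeMonoid LetterS → Prop := fun u v => (u, v) ∈ relS n R₀
  obtain ⟨J, hJ, hJg⟩ := exists_strongRel hn hR₀ (PresentedMonoid.of r) fun u v h => by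
    rw [← mk_eq_lift, ← mk_eq_lift]; exact PresentedMonoid.mk_eq_mk_of_rel h
  let E : PresentedMonoid r →* PT (Fin n) := PresentedMonoid.lift (genS n) (relS_sound hn hR₀)
  have hform : ∀ w, StrongRel.Form J (PresentedMonoid.of r .d) (PresentedMonoid.of r .z)
      (PresentedMonoid.mk r w) := by
    intro w
    rw [mk_eq_lift]
    refine lift_induction _ _ ⟨1, one_mem _, Or.inl hJ.rep.one.symm⟩ (fun q x hq => ?_) w
    cases x
    · exact hJg .a ▸ hJ.form_mul hn hq (gA_mem hn)
    · exact hJg .b ▸ hJ.form_mul hn hq (gB_mem hn)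
    · exact hJg .e ▸ hJ.form_mul hn hq (gE_mem hn)
    · exact hJg .f ▸ hJ.form_mul hn hq (gF_mem hn)
    · exact hJ.form_mul_d hn hq
    · exact hJ.form_mul_z hn hq
  have hE : ∀ α ∈ PTzeta n, E (J α) = α := by
    intro α hα
    obtain ⟨w, rfl⟩ := hR₀.exists_word hα
    rw [hJ.rep.apply_lift (genT_mem hn)]
    induction w using FreeMonoid.inductionOn' with
    | one => simp
    | of_mul x w ih =>
      rw [map_mul, map_mul, map_mul, ih (lift_mem (genT_mem hn) w), FreeMonoid.lift_eval_of,
        FreeMonoid.lift_eval_of, hJg]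
      rfl
  exact PresentedMonoid.mk_eq_mk_iff.1
    (hJ.form_unique hn E hE rfl rfl (hform u) (hform v) huv)

end StrongPresentation

/-! ### The sets `Γ_k` -/

section Bijections

variable {n : ℕ}

/-- The preimage of `w` under `σ_k`, for `w ≠ 0, k`. -/
def shift (k w : Fin n) : Fin n := if h : w.val < k.val then ⟨w.val + 1, by omega⟩ else w

theorem shift_val (k w : Fin n) :
    (shift k w).val = if w.val < k.val then w.val + 1 else w.val := by
  simp only [shift]; split_ifs <;> rfl

variable [NeZero n]

theorem shift_ne (hn : 4 ≤ n) {k w : Fin n} (hk : k ≠ 0) (hw : w ≠ 0) (hwk : w ≠ k) :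
    shift k w ≠ 0 ∧ shift k w ≠ 1 := by
  have h1 := val_one hn
  have := val_ne_zero hk
  have := val_ne_zero hw
  have h0 := val_zero (n := n)
  rw [Ne, Fin.ext_iff] at hwk
  constructor <;> rw [Ne, Fin.ext_iff, shift_val] <;> split_ifs <;> omega

theorem sigma_apply_of_ne {k x : Fin n} (hx : x ≠ 0) (hx1 : x ≠ 1) :
    sigma k x = some (if x ≤ k then x - 1 else x) := by
  simp only [sigma, hx, hx1, if_false]; split_ifs <;> rfl

theorem sigma_shift (hn : 4 ≤ n) {k w : Fin n} (hk : k ≠ 0) (hw : w ≠ 0) (hwk : w ≠ k) :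
    sigma k (shift k w) = some w := by
  obtain ⟨h0, h1⟩ := shift_ne hn hk hw hwk
  rw [sigma_apply_of_ne h0 h1, Option.some.injEq, Fin.ext_iff]
  have := shift_val k w
  rw [Ne, Fin.ext_iff] at hwk
  split_ifs with h
  · rw [Fin.val_sub_one_of_ne_zero h0]
    rw [Fin.le_def] at h
    split_ifs at this <;> omega
  · rw [Fin.le_def] at h
    split_ifs at this <;> omega

theorem exists_shift_eq (hn : 4 ≤ n) {k y : Fin n} (hy : y ≠ 0) (hy1 : y ≠ 1) :
    ∃ w, w ≠ 0 ∧ w ≠ k ∧ shift k w = y := by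
  have h1 := val_one hn
  have := val_ne_zero hy
  rw [Ne, Fin.ext_iff, h1] at hy1
  by_cases h : y.val ≤ k.val
  · refine ⟨⟨y.val - 1, by omega⟩, ?_, ?_, ?_⟩
    · rw [Ne, Fin.ext_iff, val_zero]; simp only; omega
    · rw [Ne, Fin.ext_iff]; simp only; omega
    · rw [Fin.ext_iff, shift_val]; simp only; split_ifs <;> omega
  · refine ⟨y, hy, ?_, ?_⟩
    · rintro rfl; exact h le_rfl
    · rw [Fin.ext_iff, shift_val]; split_ifs <;> omega

theorem gC_sigma_zero (hn : 4 ≤ n) (k : Fin n) : (gC n * sigma k) 0 = some 0 := by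
  rw [gC_mul_apply, if_neg (one_ne_zero_of_le hn).symm]; simp [sigma]

theorem gC_sigma_one (k : Fin n) : (gC n * sigma k) 1 = some 0 := by
  rw [gC_mul_apply, if_pos rfl]; simp [sigma]

theorem gC_sigma_shift (hn : 4 ≤ n) {k w : Fin n} (hk : k ≠ 0) (hw : w ≠ 0) (hwk : w ≠ k) :
    (gC n * sigma k) (shift k w) = some w := by
  rw [gC_mul_apply, if_neg (shift_ne hn hk hw hwk).2, sigma_shift hn hk hw hwk]

/-- The map from `Γ_k` to `D_k` inverse to `α ↦ α c₀ σ_k`: on `Ω_{n-1}`, a value `0` must come from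
`1`, and any other value from its preimage under `σ_k`. -/
def unfoldC (k : Fin n) (α : PT (Fin n)) : PT (Fin n) :=
  ⟨fun x => if x = 0 then α 0 else (α x).map fun w => if w = 0 then 1 else shift k w⟩

theorem unfoldC_mul (hn : 4 ≤ n) {k : Fin n} (hk : k ≠ 0) {α : PT (Fin n)}
    (h0 : α 0 = none ∨ α 0 = some 0) (hαk : ∀ x, x ≠ 0 → α x ≠ some k) :
    unfoldC k α * gC n * sigma k = α := by
  refine PT.ext (funext fun x => ?_)
  rw [mul_assoc, PT.mul_apply]
  by_cases hx : x = 0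
  · rcases h0 with h0 | h0
    · simp [unfoldC, hx, h0]
    · simp [unfoldC, hx, h0, gC_sigma_zero hn]
  · rcases hw : α x with _ | w
    · simp [unfoldC, hx, hw]
    · by_cases hw0 : w = 0
      · simp [unfoldC, hx, hw, hw0, gC_sigma_one]
      · have hwk : w ≠ k := by rintro rfl; exact hαk x hx hw
        simp [unfoldC, hx, hw, hw0, gC_sigma_shift hn hk hw0 hwk]

theorem unfoldC_of_mul (hn : 4 ≤ n) {k : Fin n} (hk : k ≠ 0) {α : PT (Fin n)}
    (h0 : α 0 = none ∨ α 0 = some 0) (hα : ∀ x, x ≠ 0 → α x ≠ some 0) :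
    unfoldC k (α * gC n * sigma k) = α := by
  refine PT.ext (funext fun x => ?_)
  rw [mul_assoc]
  by_cases hx : x = 0
  · rcases h0 with h0 | h0
    · simp [unfoldC, hx, h0, PT.mul_apply]
    · simp [unfoldC, hx, h0, PT.mul_apply (α), gC_sigma_zero hn]
  · rcases hw : α x with _ | w
    · simp [unfoldC, hx, hw, PT.mul_apply]
    · have hw0 : w ≠ 0 := by rintro rfl; exact hα x hx hw
      by_cases hw1 : w = 1
      · simp [unfoldC, hx, hw, hw1, PT.mul_apply (α), gC_sigma_one]
      · obtain ⟨v, hv0, hvk, rfl⟩ := exists_shift_eq (k := k) hn hw0 hw1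
        simp [unfoldC, hx, hw, PT.mul_apply (α), gC_sigma_shift hn hk hv0 hvk, hv0]

theorem mem_setDk_iff (hn : 4 ≤ n) {k : Fin n} (hk : k ≠ 0) {α : PT (Fin n)} :
    α ∈ setDk k ↔ (∀ x, x ≠ 0 → α x ≠ some 0) ∧ (∀ j, j ≠ 0 → j ≤ k → ∃ x, α x = some j) ∧
      (α 0 = some 0 ∨ α 0 = none ∧ ∃ x y, α x = some y ∧ y ≠ 1) := by
  have h1 := one_ne_zero_of_le hn
  have h1k : (1 : Fin n) ≤ k := by
    have := val_ne_zero hk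
    rw [Fin.le_def, val_one hn]; omega
  have him : ∀ j, j ∈ α.im ↔ ∃ x, α x = some j := fun j => by simp [PT.im, PT.imageOf]
  have hdom : 0 ∉ α.dom ↔ α 0 = none := by simp [PT.dom, Option.eq_none_iff_forall_ne_some]
  simp only [setDk, Set.mem_ofPred_eq, hdom]
  constructor
  · rintro ⟨hs, hk', h0⟩
    have hj : ∀ j, j ≠ 0 → j ≤ k → ∃ x, α x = some j := fun j hj hjk => (him j).1 (hk' ⟨hj, hjk⟩)
    obtain ⟨x, hx⟩ := hj 1 h1 h1k
    refine ⟨?_, hj, h0.imp id fun ⟨h0, h2⟩ => ⟨h0, ?_⟩⟩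
    · rcases mem_PsEnd_iff.1 hs with h | ⟨-, h⟩ | ⟨-, h⟩ | ⟨y, hy, h, -⟩
      · exact h.2
      · exact fun x _ => h x
      · rcases h x with h | h <;> simp_all
      · rcases h0 with h0 | h0 <;> simp_all
    · obtain ⟨a, b, ha, hb, hab⟩ := (Set.one_lt_ncard_iff (Set.toFinite _)).1 h2
      rw [him] at ha hb
      obtain ⟨u, hu⟩ := ha
      obtain ⟨v, hv⟩ := hb
      by_cases ha1 : a = 1
      · exact ⟨v, b, hv, fun hb1 => hab (ha1.trans hb1.symm)⟩
      · exact ⟨u, a, hu, ha1⟩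
  · rintro ⟨hz, hj, h0⟩
    refine ⟨?_, fun j hj' => (him j).2 (hj j hj'.1 hj'.2), h0.imp id fun ⟨h0, x, y, hx, hy⟩ =>
      ⟨h0, ?_⟩⟩
    · rcases h0 with h0 | ⟨h0, -⟩
      · exact mem_PsEnd_iff.2 (Or.inl ⟨h0, hz⟩)
      · refine mem_PsEnd_iff.2 (Or.inr (Or.inl ⟨h0, fun x => ?_⟩))
        by_cases hx : x = 0
        · simp [hx, h0]
        · exact hz x hx
    · exact (Set.one_lt_ncard_iff (Set.toFinite _)).2
        ⟨1, y, (him 1).2 (hj 1 h1 h1k), (him y).2 ⟨x, hx⟩, hy.symm⟩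

theorem gC_mem (hn : 4 ≤ n) : gC n ∈ PwEnd (starS n) := by
  refine mem_PwEnd_iff.2 fun y hy h0 => ?_
  simp only [gC, (one_ne_zero_of_le hn).symm, if_false, Option.some.injEq] at h0
  exact absurd h0.symm hy

theorem setDk_zero {k : Fin n} {α : PT (Fin n)} (hn : 4 ≤ n) (hk : k ≠ 0) (hα : α ∈ setDk k) :
    α 0 = none ∨ α 0 = some 0 := by
  rcases ((mem_setDk_iff hn hk).1 hα).2.2 with h | h
  · exact Or.inr h
  · exact Or.inl h.1

theorem mapsTo_setGammak (hn : 4 ≤ n) {k : Fin n} (hk : k ≠ 0) :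
    Set.MapsTo (fun α => α * gC n * sigma k) (setDk k) (setGammak k) := by
  intro α hα
  have h0' := setDk_zero hn hk hα
  have hps := hα.1
  obtain ⟨hz, hj, h0⟩ := (mem_setDk_iff hn hk).1 hα
  have h1 := one_ne_zero_of_le hn
  have h1k : (1 : Fin n) ≤ k := by
    have := val_ne_zero hk
    rw [Fin.le_def, val_one hn]; omega
  have hv : ∀ {x y}, α x = some y → (α * gC n * sigma k) x = (gC n * sigma k) y := fun h => by
    rw [mul_assoc, PT.mul_apply_of_some h]
  have hv0 : (α * gC n * sigma k) 0 = α 0 := by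
    rcases h0' with h | h
    · rw [mul_assoc, PT.mul_apply_of_none h, h]
    · rw [hv h, h, gC_sigma_zero hn]
  obtain ⟨u, hu⟩ := hj 1 h1 h1k
  have hu0 : u ≠ 0 := by
    rintro rfl
    rcases h0' with h | h <;> simp_all
  have huv := (hv hu).trans (gC_sigma_one k)
  have hdom : ∀ γ : PT (Fin n), 0 ∉ γ.dom ↔ γ 0 = none := fun γ => by
    simp [PT.dom, Option.eq_none_iff_forall_ne_some]
  refine ⟨mul_mem (mul_mem (PsEnd_le_PwEnd hps) (gC_mem hn))
    (PsEnd_le_PwEnd (PTzeta_le_PsEnd (sigma_mem hn hk))), ?_, ⟨⟨hk, ?_⟩, ?_⟩, ?_⟩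
  · simp only [mem_PsEnd_iff, hv0]
    rintro (h | ⟨-, h⟩ | ⟨h, h'⟩ | ⟨y, hy, h, -⟩)
    · exact h.2 u hu0 huv
    · exact h u huv
    · rcases h0 with h0 | ⟨-, x, y, hx, hy⟩
      · simp [h] at h0
      · have hx0 : x ≠ 0 := by rintro rfl; simp [h] at hx
        have hy0 : y ≠ 0 := by rintro rfl; exact hz x hx0 hx
        obtain ⟨w, hw0, hwk, rfl⟩ := exists_shift_eq (k := k) hn hy0 hy
        have := h' x
        rw [hv hx, gC_sigma_shift hn hk hw0 hwk] at this
        simp [hw0] at this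
    · rcases h0' with h' | h' <;> simp_all
  · rintro ⟨x, hx, hxk⟩
    simp only [mul_assoc] at hxk
    rw [PT.mul_apply, Option.bind_eq_some_iff] at hxk
    obtain ⟨y, hy, hyk⟩ := hxk
    by_cases hy0 : y = 0
    · rw [hy0, gC_sigma_zero hn] at hyk
      exact hk (Option.some.inj hyk).symm
    · by_cases hy1 : y = 1
      · rw [hy1, gC_sigma_one] at hyk
        exact hk (Option.some.inj hyk).symm
      · obtain ⟨w, hw0, hwk, rfl⟩ := exists_shift_eq (k := k) hn hy0 hy1
        rw [gC_sigma_shift hn hk hw0 hwk] at hyk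
        exact hwk (Option.some.inj hyk)
  · rintro j ⟨hj0, hjim⟩
    by_contra hlt
    rw [not_le] at hlt
    refine hjim ?_
    have hjk : j ≠ k := hlt.ne
    have hs := shift_val k j
    rw [if_pos (Fin.lt_def.1 hlt)] at hs
    obtain ⟨x, hx⟩ := hj (shift k j) (shift_ne hn hk hj0 hjk).1
      (by rw [Fin.le_def, hs]; exact Fin.lt_def.1 hlt)
    refine ⟨x, ?_, (hv hx).trans (gC_sigma_shift hn hk hj0 hjk)⟩
    rintro rfl
    have := (shift_ne hn hk hj0 hjk).1
    rcases h0' with h' | h' <;> simp_all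
  · simp only [hdom, hv0]
    exact h0'

theorem mapsTo_setDk (hn : 4 ≤ n) {k : Fin n} (hk : k ≠ 0) :
    Set.MapsTo (unfoldC k) (setGammak k) (setDk k) := by
  rintro α ⟨-, hns, ⟨⟨-, hk'⟩, hmin⟩, h0⟩
  have h1 := one_ne_zero_of_le hn
  have hdom : 0 ∉ α.dom ↔ α 0 = none := by simp [PT.dom, Option.eq_none_iff_forall_ne_some]
  rw [hdom] at h0
  have hαk : ∀ x, x ≠ 0 → ∀ w, α x = some w → w ≠ k := by
    rintro x hx w hw rfl
    exact hk' ⟨x, hx, hw⟩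
  have hne : ∃ x, x ≠ 0 ∧ α x = some 0 := by
    by_contra! hcon
    refine hns (mem_PsEnd_iff.2 ?_)
    rcases h0 with h0 | h0
    · refine Or.inr (Or.inl ⟨h0, fun x => ?_⟩)
      by_cases hx : x = 0
      · simp [hx, h0]
      · exact hcon x hx
    · exact Or.inl ⟨h0, hcon⟩
  have hval : ∀ x w, x ≠ 0 → α x = some w → w ≠ 0 → unfoldC k α x = some (shift k w) := by
    intro x w hx hw hw0
    simp [unfoldC, hx, hw, hw0]
  refine (mem_setDk_iff hn hk).2 ⟨fun x hx hx0 => ?_, fun j hj hjk => ?_, ?_⟩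
  · simp only [unfoldC, hx, if_false, Option.map_eq_some_iff] at hx0
    obtain ⟨w, hw, hw0⟩ := hx0
    split_ifs at hw0 with h
    · exact h1 hw0
    · exact (shift_ne hn hk h (hαk x hx w hw)).1 hw0
  · by_cases hj1 : j = 1
    · obtain ⟨x, hx, hx0⟩ := hne
      exact ⟨x, by simp [unfoldC, hx, hx0, hj1]⟩
    · obtain ⟨w, hw0, hwk, rfl⟩ := exists_shift_eq (k := k) hn hj hj1
      have hwlt : w < k := by
        have := shift_val k w
        rw [Fin.le_def] at hjk
        rw [Ne, Fin.ext_iff] at hwk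
        rw [Fin.lt_def]
        split_ifs at this <;> omega
      by_contra hcon
      refine absurd (hmin ⟨hw0, ?_⟩) (not_le.2 hwlt)
      rintro ⟨x, hx, hxw⟩
      exact hcon ⟨x, hval x w hx hxw hw0⟩
  · rcases h0 with h0 | h0
    · right
      refine ⟨by simp [unfoldC, h0], ?_⟩
      by_contra! hcon
      refine hns (mem_PsEnd_iff.2 (Or.inr (Or.inr (Or.inl ⟨h0, fun x => ?_⟩))))
      by_cases hx : x = 0
      · exact Or.inl (hx ▸ h0)
      · rcases hw : α x with _ | w
        · exact Or.inl rfl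
        · by_cases hw0 : w = 0
          · exact Or.inr (by rw [hw0])
          · exact absurd (hcon x _ (hval x w hx hw hw0)) (shift_ne hn hk hw0 (hαk x hx w hw)).2
    · exact Or.inl (by simp [unfoldC, h0])

theorem bijOn_setGammak (hn : 4 ≤ n) {k : Fin n} (hk : k ≠ 0) :
    Set.BijOn (fun α => α * gC n * sigma k) (setDk k) (setGammak k) := by
  refine Set.InvOn.bijOn (f' := unfoldC k) ⟨fun α hα => ?_, fun α hα => ?_⟩
    (mapsTo_setGammak hn hk) (mapsTo_setDk hn hk)
  · exact unfoldC_of_mul hn hk (setDk_zero hn hk hα) ((mem_setDk_iff hn hk).1 hα).1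
  · obtain ⟨-, -, ⟨⟨-, hk'⟩, -⟩, h0⟩ := hα
    have hdom : 0 ∉ α.dom ↔ α 0 = none := by simp [PT.dom, Option.eq_none_iff_forall_ne_some]
    rw [hdom] at h0
    exact unfoldC_mul hn hk h0 fun x hx hxk => hk' ⟨x, hx, hxk⟩

/-! ### The endomorphisms that move the centre -/

/-- The value `α c₀ z b₀^{y-1}` for `α ∈ D`. -/
theorem mul_gC_mul_gZ_apply (hn : 4 ≤ n) {α : PT (Fin n)} (hα : α ∈ setD n) {y : Fin n}
    (hy : y ≠ 0) (x : Fin n) : (α * gC n * gZ n * gB n ^ (y.val - 1)) x =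
      if x = 0 then some y else (α x).map fun w => if w = 1 then y else 0 := by
  have h1 := one_ne_zero_of_le hn
  have h2 := two_ne_zero_of_le hn
  have h21 := two_ne_one_of_le hn
  obtain ⟨h0, h, -⟩ := hα
  have hb := gB_pow_one_apply hn hy
  have hb0 := gB_pow_zero_apply hn (y.val - 1)
  simp only [PT.mul_apply (_ * gZ n), PT.mul_apply (_ * gC n), PT.mul_apply α]
  split_ifs with hx
  · simp [hx, h0, gC, gZ, h1.symm, hb]
  · rcases h x hx with h | h | h
    · simp [h]
    · simp [h, gC, gZ, hb]
    · simp [h, gC, gZ, h2, h21, hb0]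

/-- `Γ₀` is parametrized by `D` and the image `y` of `0`. -/
theorem bijOn_setGamma0 (hn : 4 ≤ n) :
    Set.BijOn (fun p : PT (Fin n) × Fin n => p.1 * gC n * gZ n * gB n ^ (p.2.val - 1))
      (setD n ×ˢ {y | y ≠ 0}) (setGamma0 n) := by
  have h1 := one_ne_zero_of_le hn
  have h2 := two_ne_zero_of_le hn
  have h21 := two_ne_one_of_le hn
  refine ⟨?_, ?_, ?_⟩
  · rintro ⟨α, y⟩ ⟨hα, hy⟩
    have hα' : α ∈ setD n := hα
    obtain ⟨h0, h, u, hu, hu1⟩ := hα'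
    have hy : y ≠ 0 := hy
    have hv := mul_gC_mul_gZ_apply hn hα hy
    have hαm : α ∈ PTzeta n := by
      refine mem_PTzeta_iff.2 ⟨h0, fun x hx => ?_⟩
      rcases h x hx with h | h | h <;> simp [h, h1, h2]
    refine ⟨mul_mem (mul_mem (mul_mem (PsEnd_le_PwEnd (PTzeta_le_PsEnd hαm)) (gC_mem hn))
      (PsEnd_le_PwEnd (gZ_mem hn))) (PsEnd_le_PwEnd (PTzeta_le_PsEnd (pow_mem (gB_mem hn) _))),
      ?_, y, hy, by simp only [hv, if_true]⟩
    simp only [mem_PsEnd_iff, hv, if_true]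
    rintro (h | ⟨h, -⟩ | ⟨h, -⟩ | ⟨w, hw, -, h⟩)
    · exact hy (Option.some.inj h.1)
    · simp at h
    · simp at h
    · have := h u hu
      simp [hu, hu1, hy] at this
  · rintro ⟨α, y⟩ ⟨hα, hy⟩ ⟨β, w⟩ ⟨hβ, hw⟩ heq
    have hy : y ≠ 0 := hy
    have hw : w ≠ 0 := hw
    have hx : ∀ x, (if x = 0 then some y else (α x).map fun w => if w = 1 then y else 0) =
        (if x = 0 then some w else (β x).map fun v => if v = 1 then w else 0) := fun x => by
      rw [← mul_gC_mul_gZ_apply hn hα hy, ← mul_gC_mul_gZ_apply hn hβ hw]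
      exact congrArg (fun γ : PT (Fin n) => γ x) heq
    have hyw : y = w := by simpa using hx 0
    subst hyw
    refine Prod.ext (PT.ext (funext fun x => ?_)) rfl
    by_cases hx0 : x = 0
    · rw [hx0]; exact hα.1.trans hβ.1.symm
    · have := hx x
      simp only [hx0, if_false] at this
      have hα' : α x = none ∨ α x = some 1 ∨ α x = some 2 := hα.2.1 x hx0
      have hβ' : β x = none ∨ β x = some 1 ∨ β x = some 2 := hβ.2.1 x hx0
      rcases hα' with h | h | h <;> rcases hβ' with h' | h' | h' <;>
        simp [h, h', hy, hy.symm, h21] at this ⊢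
  · rintro α ⟨hw, hns, y, hy, h0⟩
    have hval := mem_PwEnd_iff.1 hw y hy h0
    let β : PT (Fin n) := ⟨fun x => if x = 0 then some 0 else
      (α x).map fun w => if w = y then 1 else 2⟩
    have hβ : β ∈ setD n := by
      refine ⟨by simp [β], fun x hx => ?_, ?_⟩
      · rcases hval x with h | h | h <;> simp [β, hx, h, hy.symm]
      · by_contra! hcon
        refine hns (mem_PsEnd_iff.2 (Or.inr (Or.inr (Or.inr ⟨y, hy, h0, fun x hx => ?_⟩))))
        rcases hval x with h | h | h
        · exact Or.inl h
        · exact Or.inr h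
        · exact absurd (by simp [β, hx, h]) (hcon x hx)
    refine ⟨(β, y), ⟨hβ, hy⟩, PT.ext (funext fun x => ?_)⟩
    simp only [mul_gC_mul_gZ_apply hn hβ hy]
    split_ifs with hx
    · rw [hx, h0]
    · rcases hval x with h | h | h <;> simp [β, hx, h, hy.symm, h21]

theorem notMem_setGamma0 {k : Fin n} {γ : PT (Fin n)} (hγ : γ ∈ setGammak k) :
    γ ∉ setGamma0 n := by
  rintro ⟨-, -, y, hy, hy0⟩
  rcases hγ.2.2.2 with h | h
  · exact h ⟨y, hy0⟩
  · rw [hy0] at h; exact hy (Option.some.inj h)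

theorem ncard_setGamma0 (hn : 4 ≤ n) : (setGamma0 n).ncard = (n - 1) * (setD n).ncard := by
  rw [← (bijOn_setGamma0 hn).image_eq, (bijOn_setGamma0 hn).injOn.ncard_image,
    Set.ncard_prod, mul_comm]
  congr 1
  rw [show {y : Fin n | y ≠ 0} = ({0}ᶜ : Set (Fin n)) from rfl, Set.ncard_compl]
  simp

end Bijections

/-! ### Normal forms modulo the relations `R_w` -/

section Weak

variable {n : ℕ} [NeZero n] {Q : Type*} [Monoid Q]

/-- If some vertex `u ≠ 0` is not mapped to a nonzero vertex, then some nonzero vertex is not the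
image of a nonzero vertex. -/
theorem exists_missing {β : PT (Fin n)} {u : Fin n} (hu : u ≠ 0)
    (h : β u = none ∨ β u = some 0) : ∃ k, k ≠ 0 ∧ ∀ x, x ≠ 0 → β x ≠ some k := by
  by_contra! hcon
  let f : Fin n → Fin n := fun x => if x = 0 then 0 else (β x).getD 0
  have hf : Function.Surjective f := by
    intro k
    by_cases hk : k = 0
    · exact ⟨0, by simp [f, hk]⟩
    · obtain ⟨x, hx, hxk⟩ := hcon k hk
      exact ⟨x, by simp [f, hx, hxk]⟩
  refine hu (Finite.injective_iff_surjective.2 hf ?_)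
  rcases h with h | h <;> simp [f, hu, h]

/-- The relations of `R_w` that involve `c₀`, for an element `c` of a monoid `Q` and a
homomorphism `J` to `Q` from `PsEnd(S_n)`. -/
structure WeakRel (J : PT (Fin n) → Q) (c : Q) : Prop where
  rep : IsRep (PsEnd (starS n)) J
  c_mul_c : c * c = c
  e_mul_c : J (gE n) * c = c * J (gA n) * c
  c_mul_f : c * J (gF n) = c
  f_mul_c : J (gF n) * c = J (gF n)
  c_mul_d : c * J (gD n) = J (gF n) * J (gD n)
  c_mul_swap : c * J (permPT (swap 2 3)) = J (permPT (swap 2 3)) * c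
  c_mul_cyc : c * J (gB n * gA n) = J (gB n * gA n) * c
  c_mul_del : c * J (delPT 2) = J (delPT 2) * c
  c_mul_col : c * J (colPT 3 2) = J (colPT 3 2) * c
  c_mul_z_mul_c : c * J (gZ n) * c = J (gZ n) * c
  kappa_mul_c : J (kappa n) * c = J (gZ n) * c
  d_mul_c_mul_z : J (gD n) * c * J (gZ n) * J (gB n ^ (n - 2)) =
    J (gA n * (gB n * gE n) ^ (n - 3) * gD n) * c

theorem swap_two_three_mem (hn : 4 ≤ n) : permPT (swap 2 3) ∈ PTzeta n := by
  rw [← gB_pow_conj hn]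
  exact mul_mem (mul_mem (pow_mem (gB_mem hn) _) (gA_mem hn)) (gB_mem hn)

theorem delPT_two_mem (hn : 4 ≤ n) : delPT 2 ∈ PTzeta n := by
  rw [← gA_conj_gF]
  exact mul_mem (mul_mem (gA_mem hn) (gF_mem hn)) (gA_mem hn)

theorem colPT_three_two_mem (hn : 4 ≤ n) : colPT 3 2 ∈ PTzeta n := by
  have hb := pow_mem (gB_mem hn) (n - 2)
  rw [← gE_conj hn]
  exact mul_mem (mul_mem (mul_mem (mul_mem (mul_mem (mul_mem (mul_mem (mul_mem (gA_mem hn) hb)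
    (gA_mem hn)) (gB_mem hn)) (gE_mem hn)) hb) (gA_mem hn)) (gB_mem hn)) (gA_mem hn)

theorem setD_subset (hn : 4 ≤ n) {α : PT (Fin n)} (hα : α ∈ setD n) :
    α ∈ PTzeta n := by
  refine mem_PTzeta_iff.2 ⟨hα.1, fun x hx => ?_⟩
  rcases hα.2.1 x hx with h | h | h <;>
    simp [h, one_ne_zero_of_le hn, two_ne_zero_of_le hn]

theorem setD_subset_PsEnd (hn : 4 ≤ n) {α : PT (Fin n)} (hα : α ∈ setD n) :
    α ∈ PsEnd (starS n) := PTzeta_le_PsEnd (setD_subset hn hα)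

theorem sigma_mem_PsEnd (hn : 4 ≤ n) {k : Fin n} (hk : k ≠ 0) :
    sigma k ∈ PsEnd (starS n) := PTzeta_le_PsEnd (sigma_mem hn hk)

namespace WeakRel

variable {J : PT (Fin n) → Q} {c : Q}

/-- The normal forms modulo `R_w`: strong endomorphisms, the forms `α c₀ σ_k` with `α ∈ D_k`, and
the forms `α c₀ z b₀^{y-1}` with `α ∈ D` and `y ≠ 0`, for which `y` is the image of `0`. -/
def Form (J : PT (Fin n) → Q) (c q : Q) : Prop :=
  (∃ α ∈ PsEnd (starS n), q = J α) ∨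
  (∃ k : Fin n, k ≠ 0 ∧ ∃ α ∈ setDk k, q = J α * c * J (sigma k)) ∨
  ∃ α ∈ setD n, ∃ y : Fin n, y ≠ 0 ∧ q = J α * c * J (gZ n) * J (gB n ^ (y.val - 1))

variable (h : WeakRel J c) (hn : 4 ≤ n)

include h hn

/-- `c` commutes with the transformations for which `1` is an isolated fixed point. -/
theorem comm_c {β : PT (Fin n)} (hβ : β ∈ PTzeta n) (h1 : β 1 = some 1)
    (h1' : ∀ x, x ≠ 1 → β x ≠ some 1) : c * J β = J β * c := by
  let H : Submonoid (PT (Fin n)) :=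
    { carrier := {α | α ∈ PTzeta n ∧ c * J α = J α * c}
      one_mem' := ⟨one_mem _, by rw [h.rep.one, one_mul, mul_one]⟩
      mul_mem' := fun {α β} hα hβ => ⟨mul_mem hα.1 hβ.1, by
        rw [h.rep.mul _ (PTzeta_le_PsEnd hα.1) _ (PTzeta_le_PsEnd hβ.1), ← mul_assoc, hα.2,
          mul_assoc, hβ.2, mul_assoc]⟩ }
  exact (mem_of_gens_two hn H ⟨swap_two_three_mem hn, h.c_mul_swap⟩
    ⟨mul_mem (gB_mem hn) (gA_mem hn), h.c_mul_cyc⟩ ⟨colPT_three_two_mem hn, h.c_mul_col⟩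
    ⟨delPT_two_mem hn, h.c_mul_del⟩ hβ h1 h1').2

/-- `c * J α` does not depend on the value of `α` at `1`. -/
theorem c_mul_eq {α β : PT (Fin n)} (hα : α ∈ PTzeta n) (hβ : β ∈ PTzeta n)
    (hαβ : ∀ x, x ≠ 1 → α x = β x) : c * J α = c * J β := by
  have hf := PTzeta_le_PsEnd (gF_mem hn)
  have : gF n * α = gF n * β := by
    refine PT.ext (funext fun x => ?_)
    by_cases hx : x = 1
    · simp [PT.mul_apply, gF, hx]
    · simp [PT.mul_apply, gF, hx, hαβ x hx]
  rw [← h.c_mul_f, mul_assoc, mul_assoc, ← h.rep.mul _ hf _ (PTzeta_le_PsEnd hα), this,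
    h.rep.mul _ hf _ (PTzeta_le_PsEnd hβ)]

theorem mul_c_of_notMem {α : PT (Fin n)} (hα : α ∈ PsEnd (starS n)) (h1 : ∀ x, α x ≠ some 1) :
    J α * c = J α := by
  have hf := PTzeta_le_PsEnd (gF_mem hn)
  have : α = α * gF n := by
    refine PT.ext (funext fun x => ?_)
    rw [PT.mul_apply]
    rcases hx : α x with _ | y
    · rfl
    · have : y ≠ 1 := by rintro rfl; exact h1 x hx
      simp [gF, this]
  rw [this, h.rep.mul _ hα _ hf, mul_assoc, h.f_mul_c]

/-- If `α` maps its domain to `1`, then `α c₀` is strong. -/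
theorem mul_c_of_const {α : PT (Fin n)} (hα : α ∈ PsEnd (starS n))
    (h1 : ∀ x y, α x = some y → y = 1) : J α * c = J (α * gZ n) := by
  have hne := one_ne_zero_of_le hn
  have : α = α * kappa n := by
    refine PT.ext (funext fun x => ?_)
    rw [PT.mul_apply]
    rcases hx : α x with _ | y
    · rfl
    · simp [h1 x y hx, kappa, hne]
  conv_lhs => rw [this, h.rep.mul _ hα _ (PTzeta_le_PsEnd (kappa_mem hn)), mul_assoc,
    h.kappa_mul_c, ← mul_assoc, ← h.rep.mul _ hα _ (gZ_mem hn)]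
  refine h.mul_c_of_notMem hn (mul_mem hα (gZ_mem hn)) fun x => ?_
  rw [PT.mul_apply]
  rcases hx : α x with _ | y
  · simp
  · simp [h1 x y hx, gZ, hne, hne.symm]

/-- If `α` maps `0` to `1`, then `α c₀` can be rewritten so that `0` becomes fixed. -/
theorem mul_c_of_zero {α : PT (Fin n)} (h0 : α 0 = some 1)
    (hα : ∀ x, x ≠ 0 → α x = none ∨ α x = some 0) :
    J α * c = J (domId α * kappa n) * c := by
  have hd := PTzeta_le_PsEnd (domId_mem α)
  have : α = domId α * gZ n := by
    refine PT.ext (funext fun x => ?_)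
    rw [mul_gZ_apply (domId_mem α)]
    split_ifs with hx
    · rw [hx, h0]
    · rcases hα x hx with h | h <;> simp [domId, hx, h]
  conv_lhs => rw [this]
  rw [h.rep.mul _ hd _ (gZ_mem hn), mul_assoc, ← h.kappa_mul_c, ← mul_assoc,
    ← h.rep.mul _ hd _ (PTzeta_le_PsEnd (kappa_mem hn))]

/-- The main case of `form_c_mul`: `0` is fixed or outside the domain of `α`, no other vertex is
mapped to `0`, and `1` is in the image. -/
theorem form_c_mul_aux {α β : PT (Fin n)} (h0 : α 0 = none ∨ α 0 = some 0)
    (hα : ∀ x, x ≠ 0 → α x ≠ some 0) (h1 : ∃ x, α x = some 1) (hβ : β ∈ PTzeta n) :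
    Form J c (J α * c * J β) := by
  classical
  have hne := one_ne_zero_of_le hn
  have hαs : α ∈ PsEnd (starS n) := by
    rcases h0 with h0 | h0
    · refine mem_PsEnd_iff.2 (Or.inr (Or.inl ⟨h0, fun x => ?_⟩))
      by_cases hx : x = 0
      · simp [hx, h0]
      · exact hα x hx
    · exact mem_PsEnd_iff.2 (Or.inl ⟨h0, hα⟩)
  have hβ' := mem_PTzeta_iff.1 hβ
  -- the least nonzero vertex `k` that is not in the image of `α c₀ β`
  let M : Set (Fin n) := {j | j ≠ 0 ∧ ∀ x y, α x = some y → y ≠ 0 → y ≠ 1 → β y ≠ some j}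
  have hM : M.Nonempty := by
    obtain ⟨k, hk, hk'⟩ := exists_missing (β := gF n * β) hne
      (Or.inl (PT.mul_apply_of_none (by simp [gF])))
    refine ⟨k, hk, fun x y _ hy0 hy1 hyk => hk' y hy0 ?_⟩
    simp [PT.mul_apply, gF, hy1, hyk]
  obtain ⟨k, ⟨hk, hkM⟩, hmin⟩ := WellFounded.has_min
    (wellFounded_lt : WellFounded ((· < ·) : Fin n → Fin n → Prop)) M hM
  -- restricted to the image of `α`, and away from `1`, the map `β` is `γ σ_k`
  let ρ : PT (Fin n) := ⟨fun y => if y = 0 ∨ y = 1 ∨ ∃ x, α x = some y then some y else none⟩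
  let γ : PT (Fin n) := ⟨fun y => if y = 0 then some 0 else if y = 1 then some 1 else
    if ∃ x, α x = some y then (β y).map (shift k) else none⟩
  have hρ : ρ ∈ PTzeta n := by
    refine mem_PTzeta_iff.2 ⟨by simp [ρ], fun x hx => ?_⟩
    simp only [ρ]; split_ifs <;> simp [hx]
  have hγv : ∀ y, y ≠ 0 → y ≠ 1 → ∀ v, γ y = some v → v ≠ 0 ∧ v ≠ 1 := by
    intro y hy0 hy1 v hv
    simp only [γ, hy0, hy1, if_false] at hv
    split_ifs at hv with hex
    · obtain ⟨x, hx⟩ := hex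
      rw [Option.map_eq_some_iff] at hv
      obtain ⟨w, hw, rfl⟩ := hv
      have hw0 : w ≠ 0 := by rintro rfl; exact hβ'.2 y hy0 hw
      have hwk : w ≠ k := by rintro rfl; exact hkM x y hx hy0 hy1 hw
      exact shift_ne hn hk hw0 hwk
  have hγ1 : γ 1 = some 1 := by simp [γ, hne]
  have hγ0 : γ 0 = some 0 := by simp [γ]
  have hγ : γ ∈ PTzeta n := by
    refine mem_PTzeta_iff.2 ⟨hγ0, fun y hy hy0 => ?_⟩
    by_cases hy1 : y = 1
    · subst hy1
      rw [hγ1] at hy0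
      exact hne (Option.some.inj hy0)
    · exact (hγv y hy hy1 0 hy0).1 rfl
  have hγ1' : ∀ y, y ≠ 1 → γ y ≠ some 1 := by
    intro y hy1 hy
    by_cases hy0 : y = 0
    · subst hy0
      rw [hγ0] at hy
      exact hne (Option.some.inj hy).symm
    · exact (hγv y hy0 hy1 1 hy).2 rfl
  have hαρ : α * ρ = α := by
    refine PT.ext (funext fun x => ?_)
    rw [PT.mul_apply]
    rcases hx : α x with _ | y
    · rfl
    · have : ∃ x, α x = some y := ⟨x, hx⟩
      simp [ρ, this]
  have hσ := sigma_mem hn hk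
  have hρβ : ∀ y, y ≠ 1 → (ρ * β) y = (γ * sigma k) y := by
    intro y hy1
    by_cases hy0 : y = 0
    · rw [hy0, (mem_PTzeta_iff.1 (mul_mem hρ hβ)).1, (mem_PTzeta_iff.1 (mul_mem hγ hσ)).1]
    · simp only [PT.mul_apply, ρ, γ, hy0, hy1, if_false, false_or]
      split_ifs with hex
      · obtain ⟨x, hx⟩ := hex
        rw [Option.bind_some]
        rcases hw : β y with _ | w
        · rfl
        · have hw0 : w ≠ 0 := by rintro rfl; exact hβ'.2 y hy0 hw
          have hwk : w ≠ k := by rintro rfl; exact hkM x y hx hy0 hy1 hw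
          rw [Option.map_some, Option.bind_some, sigma_shift hn hk hw0 hwk]
      · rfl
  have hρ1 : ∀ x, x ≠ 1 → ρ x ≠ some 1 := by
    intro x hx
    simp only [ρ]; split_ifs <;> simp [hx]
  have hαγ : α * γ ∈ PsEnd (starS n) := mul_mem hαs (PTzeta_le_PsEnd hγ)
  have key : J α * c * J β = J (α * γ) * c * J (sigma k) := by
    conv_lhs => rw [← hαρ]
    rw [h.rep.mul _ hαs _ (PTzeta_le_PsEnd hρ), mul_assoc (J α),
      ← h.comm_c hn hρ (by simp [ρ]) hρ1, mul_assoc (J α), mul_assoc c,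
      ← h.rep.mul _ (PTzeta_le_PsEnd hρ) _ (PTzeta_le_PsEnd hβ),
      h.c_mul_eq hn (mul_mem hρ hβ) (mul_mem hγ hσ) hρβ,
      h.rep.mul _ (PTzeta_le_PsEnd hγ) _ (PTzeta_le_PsEnd hσ), ← mul_assoc c,
      h.comm_c hn hγ hγ1 hγ1', h.rep.mul _ hαs _ (PTzeta_le_PsEnd hγ)]
    simp only [mul_assoc]
  rw [key]
  have h0' : (α * γ) 0 = α 0 := by
    rcases h0 with h0 | h0
    · rw [PT.mul_apply_of_none h0, h0]
    · rw [PT.mul_apply_of_some h0, hγ0, h0]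
  -- if `α γ` has image `{1}` and `0` is not in its domain, then it is not in `D_k`
  by_cases hdeg : α 0 = none ∧ ∀ x y, (α * γ) x = some y → y = 1
  · left
    rw [h.mul_c_of_const hn hαγ hdeg.2]
    have hz := mul_mem hαγ (gZ_mem hn)
    exact ⟨_, mul_mem hz (PTzeta_le_PsEnd hσ), (h.rep.mul _ hz _ (PTzeta_le_PsEnd hσ)).symm⟩
  · refine Or.inr (Or.inl ⟨k, hk, _, (mem_setDk_iff hn hk).2 ⟨?_, ?_, ?_⟩, rfl⟩)
    · intro x hx hx0
      rw [PT.mul_apply, Option.bind_eq_some_iff] at hx0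
      obtain ⟨y, hy, hy0⟩ := hx0
      have : y ≠ 0 := by rintro rfl; exact hα x hx hy
      exact (mem_PTzeta_iff.1 hγ).2 y this hy0
    · intro j hj hjk
      by_cases hj1 : j = 1
      · obtain ⟨x, hx⟩ := h1
        exact ⟨x, by rw [PT.mul_apply_of_some hx, hγ1, hj1]⟩
      · obtain ⟨w, hw0, hwk, rfl⟩ := exists_shift_eq (k := k) hn hj hj1
        have hwlt : w < k := by
          have := shift_val k w
          rw [Fin.le_def] at hjk
          rw [Ne, Fin.ext_iff] at hwk
          rw [Fin.lt_def]
          split_ifs at this <;> omega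
        have hwM : w ∉ M := fun hw => hmin w hw hwlt
        simp only [M, Set.mem_ofPred_eq, not_and, not_forall, not_not] at hwM
        obtain ⟨x, y, hx, hy0, hy1, hy⟩ := hwM hw0
        refine ⟨x, ?_⟩
        have hex : ∃ x, α x = some y := ⟨x, hx⟩
        rw [PT.mul_apply_of_some hx]
        simp [γ, hy0, hy1, hex, hy]
    · rw [h0']
      rcases h0 with h0 | h0
      · right
        refine ⟨h0, ?_⟩
        by_contra! hcon
        exact hdeg ⟨h0, hcon⟩
      · exact Or.inl h0

/-- `α c₀ β` has a normal form, for every strong `α` and every `β` that fixes `0` and preserves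
`Ω_{n-1}`. -/
theorem form_c_mul {α β : PT (Fin n)} (hα : α ∈ PsEnd (starS n)) (hβ : β ∈ PTzeta n) :
    Form J c (J α * c * J β) := by
  have hβs := PTzeta_le_PsEnd hβ
  have triv : ∀ α ∈ PsEnd (starS n), (∀ x, α x ≠ some 1) → Form J c (J α * c * J β) := by
    intro α hα h1
    rw [h.mul_c_of_notMem hn hα h1]
    exact Or.inl ⟨_, mul_mem hα hβs, (h.rep.mul _ hα _ hβs).symm⟩
  by_cases h1 : ∀ x, α x ≠ some 1
  · exact triv α hα h1
  push Not at h1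
  rcases mem_PsEnd_iff.1 hα with ⟨h0, hz⟩ | ⟨h0, hz⟩ | ⟨h0, hz⟩ | ⟨y, hy, h0, hz⟩
  · exact h.form_c_mul_aux hn (Or.inr h0) hz h1 hβ
  · exact h.form_c_mul_aux hn (Or.inl h0) (fun x _ => hz x) h1 hβ
  · obtain ⟨x, hx⟩ := h1
    have := hz x
    simp [hx, one_ne_zero_of_le hn] at this
  · have hy1 : y = 1 := by
      obtain ⟨x, hx⟩ := h1
      by_cases hx0 : x = 0
      · rw [hx0, h0] at hx; exact Option.some.inj hx
      · have := hz x hx0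
        simp [hx, one_ne_zero_of_le hn] at this
    rw [hy1] at h0
    have hm := mul_mem (domId_mem α) (kappa_mem hn)
    rw [h.mul_c_of_zero hn h0 hz]
    by_cases h1' : ∀ x, (domId α * kappa n) x ≠ some 1
    · exact triv _ (PTzeta_le_PsEnd hm) h1'
    · push Not at h1'
      rw [mem_PTzeta_iff] at hm
      exact h.form_c_mul_aux hn (Or.inr hm.1) hm.2 h1' hβ

/-- The case of `form_c_z_mul` in which `α` fixes `0`: all that matters about the points other than
`0` and `1` in the image of `α` is that they are there, so they can be collapsed to `2`. -/
theorem form_c_z_aux {α : PT (Fin n)} (hα : α ∈ PTzeta n) {y : Fin n} (hy : y ≠ 0) :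
    Form J c (J α * c * J (gZ n) * J (gB n ^ (y.val - 1))) := by
  have hne := one_ne_zero_of_le hn
  have h2 := two_ne_zero_of_le hn
  have h21 := two_ne_one_of_le hn
  have hb := PTzeta_le_PsEnd (pow_mem (gB_mem hn) (y.val - 1))
  by_cases h1 : ∀ x, α x ≠ some 1
  · have hαs := PTzeta_le_PsEnd hα
    have hz := mul_mem hαs (gZ_mem hn)
    rw [h.mul_c_of_notMem hn hαs h1, ← h.rep.mul _ hαs _ (gZ_mem hn), ← h.rep.mul _ hz _ hb]
    exact Or.inl ⟨_, mul_mem hz hb, rfl⟩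
  push Not at h1
  rw [mem_PTzeta_iff] at hα
  let μ : PT (Fin n) := ⟨fun x => if x = 0 then some 0 else if x = 1 then some 1 else some 2⟩
  have hμ : μ ∈ PTzeta n := by
    refine mem_PTzeta_iff.2 ⟨by simp [μ], fun x hx => ?_⟩
    simp only [μ, hx, if_false]; split_ifs <;> simp [hne, h2]
  have hμt : ∀ x, μ x ≠ none := by
    intro x; simp only [μ]; split_ifs <;> simp
  have hμ1 : ∀ x, x ≠ 1 → μ x ≠ some 1 := by
    intro x hx; simp only [μ, hx, if_false]; split_ifs <;> simp [hne.symm, h21]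
  have hαs := PTzeta_le_PsEnd (mem_PTzeta_iff.2 hα)
  have hμs := PTzeta_le_PsEnd hμ
  have key : J α * c * J (gZ n) = J (α * μ) * c * J (gZ n) := by
    conv_lhs => rw [← mul_gZ_of_total hμ hμt]
    rw [h.rep.mul _ hμs _ (gZ_mem hn), h.rep.mul _ hαs _ hμs, ← mul_assoc, mul_assoc (J α),
      h.comm_c hn hμ (by simp [μ, hne]) hμ1]
    simp only [mul_assoc]
  refine Or.inr (Or.inr ⟨α * μ, ⟨?_, ?_, ?_⟩, y, hy, by rw [key]⟩)
  · rw [PT.mul_apply_of_some hα.1]; simp [μ]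
  · intro x hx
    rw [PT.mul_apply]
    rcases hw : α x with _ | w
    · exact Or.inl rfl
    · right
      have : w ≠ 0 := by rintro rfl; exact hα.2 x hx hw
      simp only [Option.bind_some, μ, this, if_false]
      split_ifs
      · exact Or.inl rfl
      · exact Or.inr rfl
  · obtain ⟨x, hx⟩ := h1
    refine ⟨x, ?_, ?_⟩
    · rintro rfl
      rw [hα.1] at hx
      exact hne (Option.some.inj hx).symm
    · rw [PT.mul_apply_of_some hx]; simp [μ, hne]

/-- `α c₀ z β` has a normal form, for every strong `α` and every `β` that fixes `0` and preserves
`Ω_{n-1}`. -/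
theorem form_c_z_mul {α β : PT (Fin n)} (hα : α ∈ PsEnd (starS n)) (hβ : β ∈ PTzeta n) :
    Form J c (J α * c * J (gZ n) * J β) := by
  have hne := one_ne_zero_of_le hn
  have hβs := PTzeta_le_PsEnd hβ
  have hβ' := mem_PTzeta_iff.1 hβ
  have hz := gZ_mem hn
  have hd := gD_mem (n := n)
  have hf := PTzeta_le_PsEnd (gF_mem hn)
  rcases hb1 : β 1 with _ | y
  · -- then `z β = d z`, and `c₀ d = f₀ d` is strong
    have hzβ : gZ n * β = gD n * gZ n := by
      refine PT.ext (funext fun x => ?_)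
      rw [gD_mul_apply, PT.mul_apply]
      split_ifs with hx <;> simp [gZ, hx, hb1, hβ'.1]
    left
    refine ⟨α * (gF n * gD n * gZ n), mul_mem hα (mul_mem (mul_mem hf hd) hz), ?_⟩
    rw [mul_assoc, ← h.rep.mul _ hz _ hβs, hzβ, h.rep.mul _ hd _ hz, mul_assoc, ← mul_assoc c,
      h.c_mul_d, h.rep.mul _ hα _ (mul_mem (mul_mem hf hd) hz),
      h.rep.mul _ (mul_mem hf hd) _ hz, h.rep.mul _ hf _ hd]
  have hy : y ≠ 0 := by rintro rfl; exact hβ'.2 1 hne hb1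
  have hbm := pow_mem (gB_mem hn) (y.val - 1)
  have hbs := PTzeta_le_PsEnd hbm
  have hzβ : gZ n * β = gZ n * gB n ^ (y.val - 1) := by
    refine PT.ext (funext fun x => ?_)
    rw [PT.mul_apply, PT.mul_apply]
    by_cases hx : x = 0
    · simp [gZ, hx, hb1, gB_pow_one_apply hn hy]
    · simp [gZ, hx, hβ'.1, gB_pow_zero_apply hn]
  rw [mul_assoc, ← h.rep.mul _ hz _ hβs, hzβ, h.rep.mul _ hz _ hbs, ← mul_assoc]
  by_cases h1 : ∀ x, α x ≠ some 1
  · have hαz := mul_mem hα hz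
    rw [h.mul_c_of_notMem hn hα h1, ← h.rep.mul _ hα _ hz, ← h.rep.mul _ hαz _ hbs]
    exact Or.inl ⟨_, mul_mem hαz hbs, rfl⟩
  push Not at h1
  rcases mem_PsEnd_iff.1 hα with h0 | ⟨h0, hz'⟩ | ⟨h0, hz'⟩ | ⟨w, hw, h0, hz'⟩
  · exact h.form_c_z_aux hn (mem_PTzeta_iff.2 h0) hy
  · -- here `α = α' d` with `0 α' = 0`, and `d c₀ z = ξ c₀ b₀` for a strong `ξ`
    have hfz : fixZero α ∈ PTzeta n := fixZero_mem fun x _ => hz' x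
    have hαd : α = fixZero α * gD n := by
      rw [← gD_mul_comm hfz]
      refine PT.ext (funext fun x => ?_)
      rw [gD_mul_apply]
      split_ifs with hx <;> simp [hx, h0, fixZero]
    have hξ : gA n * (gB n * gE n) ^ (n - 3) * gD n ∈ PsEnd (starS n) :=
      mul_mem (PTzeta_le_PsEnd (mul_mem (gA_mem hn)
        (pow_mem (mul_mem (gB_mem hn) (gE_mem hn)) _))) hd
    have hb := PTzeta_le_PsEnd (gB_mem hn)
    have hbn : J (gB n ^ (n - 2)) * J (gB n) = 1 := by
      rw [← h.rep.mul _ (pow_mem hb _) _ hb, ← pow_succ, show n - 2 + 1 = n - 1 by omega,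
        gB_pow_card hn, h.rep.one]
    have hdcz : J (gD n) * c * J (gZ n) =
        J (gA n * (gB n * gE n) ^ (n - 3) * gD n) * c * J (gB n) := by
      rw [← h.d_mul_c_mul_z, mul_assoc _ _ (J (gB n)), hbn, mul_one]
    have hs := PTzeta_le_PsEnd hfz
    have key : J α * c * J (gZ n) * J (gB n ^ (y.val - 1)) =
        J (fixZero α * (gA n * (gB n * gE n) ^ (n - 3) * gD n)) * c *
          J (gB n * gB n ^ (y.val - 1)) := by
      conv_lhs => rw [hαd, h.rep.mul _ hs _ hd, mul_assoc (J (fixZero α)),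
        mul_assoc (J (fixZero α)), hdcz]
      rw [h.rep.mul _ hs _ hξ, h.rep.mul _ hb _ hbs]
      simp only [mul_assoc]
    rw [key]
    exact h.form_c_mul hn (mul_mem hs hξ) (mul_mem (gB_mem hn) hbm)
  · obtain ⟨x, hx⟩ := h1
    have := hz' x
    simp [hx, hne] at this
  · have hw1 : w = 1 := by
      obtain ⟨x, hx⟩ := h1
      by_cases hx0 : x = 0
      · rw [hx0, h0] at hx; exact Option.some.inj hx
      · have := hz' x hx0
        simp [hx, hne] at this
    rw [hw1] at h0
    rw [h.mul_c_of_zero hn h0 hz']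
    exact h.form_c_z_aux hn (mul_mem (domId_mem α) (kappa_mem hn)) hy

theorem form_mul {q : Q} (hq : Form J c q) {β : PT (Fin n)} (hβ : β ∈ PTzeta n) :
    Form J c (q * J β) := by
  have hβs := PTzeta_le_PsEnd hβ
  obtain ⟨α, hα, rfl⟩ | ⟨k, hk, α, hα, rfl⟩ | ⟨α, hα, y, hy, rfl⟩ := hq
  · exact Or.inl ⟨_, mul_mem hα hβs, (h.rep.mul _ hα _ hβs).symm⟩
  · rw [mul_assoc, ← h.rep.mul _ (sigma_mem_PsEnd hn hk) _ hβs]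
    exact h.form_c_mul hn hα.1 (mul_mem (sigma_mem hn hk) hβ)
  · have hb := pow_mem (gB_mem hn) (y.val - 1)
    rw [mul_assoc, ← h.rep.mul _ (PTzeta_le_PsEnd hb) _ hβs]
    exact h.form_c_z_mul hn (setD_subset_PsEnd hn hα) (mul_mem hb hβ)

theorem form_mul_d {q : Q} (hq : Form J c q) : Form J c (q * J (gD n)) := by
  have hne := one_ne_zero_of_le hn
  have hd := gD_mem (n := n)
  have hz := gZ_mem hn
  have hf := PTzeta_le_PsEnd (gF_mem hn)
  obtain ⟨α, hα, rfl⟩ | ⟨k, hk, α, hα, rfl⟩ | ⟨α, hα, y, hy, rfl⟩ := hq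
  · exact Or.inl ⟨_, mul_mem hα hd, (h.rep.mul _ hα _ hd).symm⟩
  · have hσ := sigma_mem_PsEnd hn hk
    refine Or.inl ⟨α * (gF n * gD n * sigma k), mul_mem hα.1 (mul_mem (mul_mem hf hd) hσ), ?_⟩
    rw [mul_assoc, ← h.rep.mul _ hσ _ hd, ← gD_mul_comm (sigma_mem hn hk), h.rep.mul _ hd _ hσ,
      mul_assoc, ← mul_assoc c, h.c_mul_d, h.rep.mul _ hα.1 _ (mul_mem (mul_mem hf hd) hσ),
      h.rep.mul _ (mul_mem hf hd) _ hσ, h.rep.mul _ hf _ hd]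
  · have hb := pow_mem (gB_mem hn) (y.val - 1)
    have hbs := PTzeta_le_PsEnd hb
    have h0s := PTzeta_le_PsEnd (zeroId_mem (n := n))
    have hαs := setD_subset_PsEnd hn hα
    -- `z b₀^l d = ε₀ z b₀^l` for the identity `ε₀` of `{0}`, and `c₀ ε₀ = ε c₀`
    let ε : PT (Fin n) := ⟨fun x => if x = 0 then some 0 else if x = 1 then some 1 else none⟩
    have hε : ε ∈ PTzeta n := by
      refine mem_PTzeta_iff.2 ⟨by simp [ε], fun x hx => ?_⟩
      simp only [ε, hx, if_false]; split_ifs <;> simp [hne]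
    have hε1 : ∀ x, x ≠ 1 → ε x ≠ some 1 := by
      intro x hx; simp only [ε, hx, if_false]; split_ifs <;> simp [hne.symm]
    have e1 : J (gZ n) * J (gB n ^ (y.val - 1)) * J (gD n) =
        J (zeroId n) * (J (gZ n) * J (gB n ^ (y.val - 1))) := by
      rw [mul_assoc, ← h.rep.mul _ hbs _ hd, ← gD_mul_comm hb, h.rep.mul _ hd _ hbs,
        ← mul_assoc, ← h.rep.mul _ hz _ hd, gZ_mul_gD hn, h.rep.mul _ h0s _ hz, mul_assoc]
    have e2 : c * J (zeroId n) = J ε * c := by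
      rw [← h.comm_c hn hε (by simp [ε, hne]) hε1]
      refine h.c_mul_eq hn zeroId_mem hε fun x hx => ?_
      simp [zeroId, ε, hx]
    have key : J α * c * J (gZ n) * J (gB n ^ (y.val - 1)) * J (gD n) =
        J (α * ε) * c * J (gZ n) * J (gB n ^ (y.val - 1)) := by
      rw [mul_assoc (J α * c), mul_assoc (J α * c), e1, mul_assoc (J α), ← mul_assoc c, e2,
        h.rep.mul _ hαs _ (PTzeta_le_PsEnd hε)]
      simp only [mul_assoc]
    rw [key]
    exact h.form_c_z_mul hn (mul_mem hαs (PTzeta_le_PsEnd hε)) hb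

theorem form_mul_z {q : Q} (hq : Form J c q) : Form J c (q * J (gZ n)) := by
  have hz := gZ_mem hn
  obtain ⟨α, hα, rfl⟩ | ⟨k, hk, α, hα, rfl⟩ | ⟨α, hα, y, hy, rfl⟩ := hq
  · exact Or.inl ⟨_, mul_mem hα hz, (h.rep.mul _ hα _ hz).symm⟩
  · have hσt : ∀ x, sigma k x ≠ none := by
      intro x; simp only [sigma]; split_ifs <;> simp
    rw [mul_assoc, ← h.rep.mul _ (sigma_mem_PsEnd hn hk) _ hz,
      mul_gZ_of_total (sigma_mem hn hk) hσt]
    have := h.form_c_z_mul hn hα.1 (one_mem _)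
    rwa [h.rep.one, mul_one] at this
  · have hb := pow_mem (gB_mem hn) (y.val - 1)
    have hbt : ∀ x, (gB n ^ (y.val - 1)) x ≠ none := by
      intro x
      by_cases hx : x = 0
      · rw [hx, gB_pow_zero_apply hn]; simp
      · rw [gB_pow_apply hn _ hx]; simp
    rw [mul_assoc, ← h.rep.mul _ (PTzeta_le_PsEnd hb) _ hz, mul_gZ_of_total hb hbt, mul_assoc,
      ← h.rep.mul _ hz _ hz, gZ_mul_gZ hn]
    exact h.form_c_mul hn (setD_subset_PsEnd hn hα) (kappa_mem hn)

theorem form_mul_c {q : Q} (hq : Form J c q) : Form J c (q * c) := by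
  have hne := one_ne_zero_of_le hn
  have hz := gZ_mem hn
  have form_c : ∀ α ∈ PsEnd (starS n), Form J c (J α * c) := by
    intro α hα
    have := h.form_c_mul hn hα (one_mem _)
    rwa [h.rep.one, mul_one] at this
  obtain ⟨α, hα, rfl⟩ | ⟨k, hk, α, hα, rfl⟩ | ⟨α, hα, y, hy, rfl⟩ := id hq
  · exact form_c α hα
  · by_cases hk1 : k = 1
    · have : sigma k = 1 := by
        refine PT.ext (funext fun x => ?_)
        rw [PT.one_apply]
        by_cases hx0 : x = 0
        · simp [sigma, hx0]
        by_cases hx1 : x = 1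
        · simp [sigma, hx1, hk1, hne]
        have := val_ne_zero hx0
        have hlt : ¬ x ≤ k := by
          rw [Fin.ext_iff, val_one hn] at hx1
          rw [Fin.le_def, hk1, val_one hn]; omega
        rw [sigma_apply_of_ne hx0 hx1, if_neg hlt]
      rw [this, h.rep.one, mul_one, mul_assoc, h.c_mul_c]
      exact form_c α hα.1
    · -- `σ_k = a₀ τ`, where `τ` commutes with `c₀`, so that `c₀ a₀ c₀ = e₀ c₀` applies
      have ha := gA_mem hn
      have hτ := mul_mem ha (sigma_mem hn hk)
      have has := PTzeta_le_PsEnd ha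
      have hτs := PTzeta_le_PsEnd hτ
      have h21 := two_ne_one_of_le hn
      have h2 := two_ne_zero_of_le hn
      have v1 := val_one hn
      have v2 := val_two hn
      have hk2 : (2 : Fin n) ≤ k := by
        have := val_ne_zero hk
        rw [Fin.ext_iff, v1] at hk1
        rw [Fin.le_def, v2]; omega
      have hτ1 : (gA n * sigma k) 1 = some 1 := by
        rw [PT.mul_apply_of_some (show gA n 1 = some 2 by simp [gA]), sigma_apply_of_ne h2 h21,
          if_pos hk2, Option.some.injEq, Fin.ext_iff, Fin.val_sub_one_of_ne_zero h2, v1, v2]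
      have hτ1' : ∀ x, x ≠ 1 → (gA n * sigma k) x ≠ some 1 := by
        intro x hx
        by_cases hx2 : x = 2
        · rw [PT.mul_apply_of_some (show gA n x = some 1 by simp [gA, hx2, h21])]
          simp [sigma, hne, hk1]
        · rw [PT.mul_apply_of_some (show gA n x = some x by simp [gA, hx, hx2])]
          by_cases hx0 : x = 0
          · simp [sigma, hx0, hne.symm]
          · rw [sigma_apply_of_ne hx0 hx, Ne, Option.some.injEq, Fin.ext_iff, v1]
            have := val_ne_zero hx0
            rw [Ne, Fin.ext_iff, v1] at hx
            rw [Fin.ext_iff, v2] at hx2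
            split_ifs
            · rw [Fin.val_sub_one_of_ne_zero hx0]; omega
            · exact hx
      have hσ : sigma k = gA n * (gA n * sigma k) := by rw [← mul_assoc, gA_mul_gA, one_mul]
      have hes := PTzeta_le_PsEnd (gE_mem hn)
      have key : J α * c * J (sigma k) * c = J (α * gE n) * c * J (gA n * sigma k) := by
        conv_lhs => rw [hσ, h.rep.mul _ has _ hτs]
        rw [mul_assoc, mul_assoc (J (gA n)), ← h.comm_c hn hτ hτ1 hτ1', h.rep.mul _ hα.1 _ hes,
          mul_assoc (J α) (J (gE n)), h.e_mul_c]
        simp only [mul_assoc]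
      rw [key]
      exact h.form_c_mul hn (mul_mem hα.1 hes) hτ
  · have hαs := setD_subset_PsEnd hn hα
    by_cases hy1 : y = 1
    · have : y.val - 1 = 0 := by rw [hy1, val_one hn]
      rw [this, pow_zero, h.rep.one, mul_one, mul_assoc (J α), mul_assoc (J α), h.c_mul_z_mul_c,
        ← mul_assoc, ← h.rep.mul _ hαs _ hz]
      exact form_c _ (mul_mem hαs hz)
    · have hb := PTzeta_le_PsEnd (pow_mem (gB_mem hn) (y.val - 1))
      rw [mul_assoc, mul_assoc, ← mul_assoc (J (gZ n)), ← h.rep.mul _ hz _ hb,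
        h.mul_c_of_notMem hn (mul_mem hz hb), h.rep.mul _ hz _ hb, ← mul_assoc]
      · exact hq
      · intro x
        rw [PT.mul_apply]
        by_cases hx : x = 0
        · simp [gZ, hx, gB_pow_one_apply hn hy, hy1]
        · simp [gZ, hx, gB_pow_zero_apply hn, hne.symm]

section Values

variable (E : Q →* PT (Fin n)) (hE : ∀ α ∈ PsEnd (starS n), E (J α) = α) (hc : E c = gC n)

include hE hc

omit h in
theorem map_form_c {k : Fin n} (hk : k ≠ 0) {α : PT (Fin n)} (hα : α ∈ setDk k) :
    E (J α * c * J (sigma k)) = α * gC n * sigma k := by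
  rw [map_mul, map_mul, hE α hα.1, hc, hE _ (sigma_mem_PsEnd hn hk)]

omit h in
theorem map_form_c_z {α : PT (Fin n)} (hα : α ∈ setD n) (l : ℕ) :
    E (J α * c * J (gZ n) * J (gB n ^ l)) = α * gC n * gZ n * gB n ^ l := by
  rw [map_mul, map_mul, map_mul, hE α (setD_subset_PsEnd hn hα), hc, hE _ (gZ_mem hn),
    hE _ (PTzeta_le_PsEnd (pow_mem (gB_mem hn) _))]

omit h in
/-- Normal forms with the same value are equal. -/
theorem form_unique {p q : Q} (hp : Form J c p) (hq : Form J c q) (hpq : E p = E q) :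
    p = q := by
  have hv : ∀ {k : Fin n}, k ≠ 0 → ∀ {α}, α ∈ setDk k →
      E (J α * c * J (sigma k)) = α * gC n * sigma k := fun hk _ hα => map_form_c hn E hE hc hk hα
  have hw : ∀ {α}, α ∈ setD n → ∀ {l : ℕ},
      E (J α * c * J (gZ n) * J (gB n ^ l)) = α * gC n * gZ n * gB n ^ l :=
    fun hα _ => map_form_c_z hn E hE hc hα _
  have hk : ∀ k : Fin n, k ≠ 0 → ∀ α ∈ setDk k, α * gC n * sigma k ∈ setGammak k :=
    fun k hk α hα => (bijOn_setGammak hn hk).mapsTo hα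
  have h0 : ∀ α ∈ setD n, ∀ y : Fin n, y ≠ 0 →
      α * gC n * gZ n * gB n ^ (y.val - 1) ∈ setGamma0 n :=
    fun α hα y hy => (bijOn_setGamma0 hn).mapsTo
      (show (α, y) ∈ setD n ×ˢ {y : Fin n | y ≠ 0} from ⟨hα, hy⟩)
  obtain ⟨α, hα, rfl⟩ | ⟨k, hk0, α, hα, rfl⟩ | ⟨α, hα, y, hy, rfl⟩ := hp <;>
  obtain ⟨β, hβ, rfl⟩ | ⟨l, hl0, β, hβ, rfl⟩ | ⟨β, hβ, w, hy', rfl⟩ := hq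
  · rw [hE α hα, hE β hβ] at hpq
    rw [hpq]
  · rw [hE α hα, hv hl0 hβ] at hpq
    exact absurd (hpq ▸ hα) (hk l hl0 β hβ).2.1
  · rw [hE α hα, hw hβ] at hpq
    exact absurd (hpq ▸ hα) (h0 β hβ w hy').2.1
  · rw [hE β hβ, hv hk0 hα] at hpq
    exact absurd (hpq ▸ hβ) (hk k hk0 α hα).2.1
  · rw [hv hk0 hα, hv hl0 hβ] at hpq
    have hkl : k = l := by
      have h1 := (hk k hk0 α hα).2.2.1
      rw [hpq] at h1
      exact h1.unique (hk l hl0 β hβ).2.2.1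
    subst hkl
    rw [(bijOn_setGammak hn hk0).injOn hα hβ hpq]
  · rw [hv hk0 hα, hw hβ] at hpq
    exact absurd (h0 β hβ w hy') (hpq ▸ notMem_setGamma0 (hk k hk0 α hα))
  · rw [hE β hβ, hw hα] at hpq
    exact absurd (hpq ▸ hβ) (h0 α hα y hy).2.1
  · rw [hw hα, hv hl0 hβ] at hpq
    exact absurd (h0 α hα y hy) (hpq ▸ notMem_setGamma0 (hk l hl0 β hβ))
  · rw [hw hα, hw hβ] at hpq
    have := (bijOn_setGamma0 hn).injOn
      (show (α, y) ∈ setD n ×ˢ {y : Fin n | y ≠ 0} from ⟨hα, hy⟩)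
      (show (β, w) ∈ setD n ×ˢ {y : Fin n | y ≠ 0} from ⟨hβ, hy'⟩) hpq
    rw [Prod.mk.injEq] at this
    rw [this.1, this.2]

omit h in
/-- Every weak endomorphism is the value of a normal form. -/
theorem exists_form {α : PT (Fin n)} (hα : α ∈ PwEnd (starS n)) : ∃ q, Form J c q ∧ E q = α := by
  by_cases hs : α ∈ PsEnd (starS n)
  · exact ⟨J α, Or.inl ⟨α, hs, rfl⟩, hE α hs⟩
  by_cases h0 : ∃ y, y ≠ 0 ∧ α 0 = some y
  · obtain ⟨⟨β, y⟩, hβ, rfl⟩ := (bijOn_setGamma0 hn).surjOn (show α ∈ setGamma0 n from ⟨hα, hs, h0⟩)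
    exact ⟨_, Or.inr (Or.inr ⟨β, hβ.1, y, hβ.2, rfl⟩), map_form_c_z hn E hE hc hβ.1 _⟩
  have h0' : α 0 = none ∨ α 0 = some 0 := by
    rcases hx : α 0 with _ | y
    · exact Or.inl rfl
    · right
      by_contra hy
      exact h0 ⟨y, fun hy0 => hy (by rw [hy0]), hx⟩
  have hu : ∃ u, u ≠ 0 ∧ α u = some 0 := by
    by_contra! hcon
    refine hs (mem_PsEnd_iff.2 ?_)
    rcases h0' with h0 | h0
    · refine Or.inr (Or.inl ⟨h0, fun x => ?_⟩)
      by_cases hx : x = 0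
      · simp [hx, h0]
      · exact hcon x hx
    · exact Or.inl ⟨h0, hcon⟩
  obtain ⟨u, hu0, hu⟩ := hu
  obtain ⟨j, hj, hj'⟩ := exists_missing hu0 (Or.inr hu)
  obtain ⟨k, hk, hmin⟩ := WellFounded.has_min
    (wellFounded_lt : WellFounded ((· < ·) : Fin n → Fin n → Prop))
    ({j | j ≠ 0} \ α.imageOf {x | x ≠ 0}) ⟨j, hj, fun ⟨x, hx, hxj⟩ => hj' x hx hxj⟩
  have hdom : 0 ∉ α.dom ↔ α 0 = none := by simp [PT.dom, Option.eq_none_iff_forall_ne_some]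
  obtain ⟨β, hβ, rfl⟩ := (bijOn_setGammak hn hk.1).surjOn
    (show α ∈ setGammak k from ⟨hα, hs, ⟨hk, fun j hj => not_lt.1 (hmin j hj)⟩, by rwa [hdom]⟩)
  exact ⟨_, Or.inr (Or.inl ⟨k, hk.1, β, hβ, rfl⟩), map_form_c hn E hE hc hk.1 hβ⟩

end Values

end WeakRel

end Weak

/-! ### The presentation of `PwEnd(S_n)` and its canonical forms -/

section WeakPresentation

variable {Q : Type*} [Monoid Q]

/-- What it means for the letters `f x` to satisfy the relations `R_w`, spelled out. -/
theorem relW_iff (n : ℕ) (R₀ : Set (FreeMonoid LetterT × FreeMonoid LetterT)) (f : LetterW → Q) :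
    (∀ u v, (u, v) ∈ relW n R₀ → FreeMonoid.lift f u = FreeMonoid.lift f v) ↔
    (∀ u v, (u, v) ∈ relS n R₀ → FreeMonoid.lift (fun x => f (LetterS.toW x)) u =
      FreeMonoid.lift (fun x => f (LetterS.toW x)) v) ∧
    f .c ^ 2 = f .c ∧ f .e * f .c = f .c * f .a * f .c ∧ f .c * f .f = f .c ∧
    f .f * f .c = f .f ∧ f .c * f .d = f .f * f .d ∧
    f .c * f .b ^ (n - 2) * f .a * f .b = f .b ^ (n - 2) * f .a * f .b * f .c ∧
    f .c * f .b * f .a = f .b * f .a * f .c ∧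
    f .c * f .a * f .f * f .a = f .a * f .f * f .a * f .c ∧
    f .c * f .a * f .b ^ (n - 2) * f .a * f .b * f .e * f .b ^ (n - 2) * f .a * f .b * f .a =
      f .a * f .b ^ (n - 2) * f .a * f .b * f .e * f .b ^ (n - 2) * f .a * f .b * f .a * f .c ∧
    f .c * f .z * f .c = f .z * f .c ∧ f .z ^ 2 * f .c = f .z * f .c ∧
    f .d * f .c * f .z * f .b ^ (n - 2) = f .a * (f .b * f .e) ^ (n - 3) * f .d * f .c := by
  have key : ∀ u v, (u, v) ∈ relW n R₀ ↔ _ := fun u v => by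
    simp only [relW, mapRel, Set.mem_union, Set.mem_image, Set.mem_insert_iff,
      Set.mem_singleton_iff, Prod.exists, Prod.mk.injEq]
    exact Iff.rfl
  simp only [key, or_imp, forall_and, forall_exists_index, and_imp]
  simp only [← lift_map_eq]
  constructor
  · rintro ⟨h0, h1, h2, h3, h4, h5, h6, h7, h8, h9, h10, h11, h12⟩
    refine ⟨fun u v h => h0 _ _ u v h rfl rfl, ?_, ?_, ?_, ?_, ?_, ?_, ?_, ?_, ?_, ?_, ?_, ?_⟩
    · simpa using h1 _ _ rfl rfl
    · simpa using h2 _ _ rfl rfl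
    · simpa using h3 _ _ rfl rfl
    · simpa using h4 _ _ rfl rfl
    · simpa using h5 _ _ rfl rfl
    · simpa using h6 _ _ rfl rfl
    · simpa using h7 _ _ rfl rfl
    · simpa using h8 _ _ rfl rfl
    · simpa using h9 _ _ rfl rfl
    · simpa using h10 _ _ rfl rfl
    · simpa using h11 _ _ rfl rfl
    · simpa using h12 _ _ rfl rfl
  · rintro ⟨h0, h1, h2, h3, h4, h5, h6, h7, h8, h9, h10, h11, h12⟩
    refine ⟨?_, ?_, ?_, ?_, ?_, ?_, ?_, ?_, ?_, ?_, ?_, ?_, ?_⟩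
    · rintro _ _ u v h rfl rfl; exact h0 u v h
    all_goals
      rintro _ _ rfl rfl
      simpa

variable {n : ℕ} [NeZero n]

theorem genW_mem (hn : 4 ≤ n) (x : LetterW) : genW n x ∈ PwEnd (starS n) := by
  cases x
  · exact PsEnd_le_PwEnd (genS_mem hn .a)
  · exact PsEnd_le_PwEnd (genS_mem hn .b)
  · exact PsEnd_le_PwEnd (genS_mem hn .e)
  · exact PsEnd_le_PwEnd (genS_mem hn .f)
  · exact gC_mem hn
  · exact PsEnd_le_PwEnd (genS_mem hn .d)
  · exact PsEnd_le_PwEnd (genS_mem hn .z)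

/-- `c₀` commutes with the four transformations that generate the partial transformations of
`{2, …, n - 1}`. -/
theorem gC_mul_comm_gens (hn : 4 ≤ n) :
    gC n * permPT (swap 2 3) = permPT (swap 2 3) * gC n ∧
    gC n * (gB n * gA n) = gB n * gA n * gC n ∧
    gC n * delPT 2 = delPT 2 * gC n ∧ gC n * colPT 3 2 = colPT 3 2 * gC n := by
  have h1 := one_ne_zero_of_le hn
  have h2 := two_ne_zero_of_le hn
  have h21 := two_ne_one_of_le hn
  obtain ⟨h30, h31, h32⟩ := three_ne hn
  have hperm : ∀ σ : Perm (Fin n), σ 0 = 0 → σ 1 = 1 → gC n * permPT σ = permPT σ * gC n :=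
    fun σ h0 h1 => gC_mul_comm (by simp [permPT, h0]) (by simp [permPT, h1]) fun x hx hx1 =>
      hx (σ.injective ((Option.some.inj hx1).trans h1.symm))
  refine ⟨hperm _ ?_ ?_, ?_, gC_mul_comm ?_ ?_ ?_, gC_mul_comm ?_ ?_ ?_⟩
  · exact Equiv.swap_apply_of_ne_of_ne h2.symm h30.symm
  · exact Equiv.swap_apply_of_ne_of_ne h21.symm h31.symm
  · rw [gB_mul_gA hn]
    refine hperm _ (Fin.ext ?_) (Fin.ext ?_)
    · rw [cyc_val, val_zero]; simp
    · rw [cyc_val, val_one hn]; simp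
  · simp [delPT, h2.symm]
  · simp [delPT, h21.symm]
  · intro x hx
    simp only [delPT]; split_ifs <;> simp [hx]
  · simp [colPT, h30.symm]
  · simp [colPT, h31.symm]
  · intro x hx
    simp only [colPT]; split_ifs <;> simp [hx, h21]

variable {R₀ : Set (FreeMonoid LetterT × FreeMonoid LetterT)}

/-- The relations `R_w` hold for the transformations denoted by the letters. -/
theorem relW_sound (hn : 4 ≤ n) (hR₀ : Defines R₀ (PTzeta n) (genT n)) :
    ∀ u v, (u, v) ∈ relW n R₀ →
      FreeMonoid.lift (genW n) u = FreeMonoid.lift (genW n) v := by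
  obtain ⟨hs, hc, hd, he⟩ := gC_mul_comm_gens hn
  refine (relW_iff n R₀ (genW n)).2 ⟨fun u v h => relS_sound hn hR₀ u v h, ?_, ?_, ?_, ?_, ?_, ?_,
    ?_, ?_, ?_, ?_, ?_, ?_⟩ <;> simp only [genW]
  · rw [pow_two, gC_mul_gC hn]
  · exact gE_mul_gC hn
  · exact gC_mul_gF hn
  · exact gF_mul_gC
  · exact gC_mul_gD
  · rw [gB_pow_conj hn, ← hs, ← gB_pow_conj hn]
    simp only [mul_assoc]
  · rw [mul_assoc, hc]
  · rw [gA_conj_gF, ← hd, ← gA_conj_gF]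
    simp only [mul_assoc]
  · rw [gE_conj hn, ← he, ← gE_conj hn]
    simp only [mul_assoc]
  · exact gC_mul_gZ_mul_gC hn
  · rw [pow_two]; exact gZ_sq_mul_gC hn
  · exact gD_mul_gC_mul_gZ hn

/-- A monoid with elements satisfying `R_w` receives a homomorphism from `PsEnd(S_n)`, and the
relations that involve `c₀` take the form used in `WeakRel`. -/
theorem exists_weakRel (hn : 4 ≤ n) (hR₀ : Defines R₀ (PTzeta n) (genT n)) (f : LetterW → Q)
    (hf : ∀ u v, (u, v) ∈ relW n R₀ → FreeMonoid.lift f u = FreeMonoid.lift f v) :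
    ∃ J : PT (Fin n) → Q, WeakRel J (f .c) ∧ ∀ x, J (genS n x) = f (LetterS.toW x) := by
  obtain ⟨h0, h1, h2, h3, h4, h5, h6, h7, h8, h9, h10, h11, h12⟩ := (relW_iff n R₀ f).1 hf
  obtain ⟨J, hJ, hJg⟩ := (defines_PsEnd hn hR₀).exists_isRep _ h0
  have ma := genS_mem hn .a
  have mb := genS_mem hn .b
  have me := genS_mem hn .e
  have mf := genS_mem hn .f
  have md := genS_mem hn .d
  have mz := genS_mem hn .z
  change gA n ∈ PsEnd (starS n) at ma
  change gB n ∈ PsEnd (starS n) at mb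
  change gE n ∈ PsEnd (starS n) at me
  change gF n ∈ PsEnd (starS n) at mf
  change gD n ∈ PsEnd (starS n) at md
  change gZ n ∈ PsEnd (starS n) at mz
  have ha : J (gA n) = f .a := hJg .a
  have hb : J (gB n) = f .b := hJg .b
  have he : J (gE n) = f .e := hJg .e
  have hf' : J (gF n) = f .f := hJg .f
  have hd : J (gD n) = f .d := hJg .d
  have hz : J (gZ n) = f .z := hJg .z
  have mbn := pow_mem mb (n - 2)
  have hbn : J (gB n ^ (n - 2)) = f .b ^ (n - 2) := by rw [hJ.pow mb, hb]
  have hba : J (gB n * gA n) = f .b * f .a := by rw [hJ.mul _ mb _ ma, ha, hb]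
  have hswap : J (permPT (swap 2 3)) = f .b ^ (n - 2) * f .a * f .b := by
    rw [← gB_pow_conj hn, hJ.mul _ (mul_mem mbn ma) _ mb, hJ.mul _ mbn _ ma, hbn, ha, hb]
  have hdel : J (delPT 2) = f .a * f .f * f .a := by
    rw [← gA_conj_gF, hJ.mul _ (mul_mem ma mf) _ ma, hJ.mul _ ma _ mf, ha, hf']
  have hcol : J (colPT 3 2) = f .a * f .b ^ (n - 2) * f .a * f .b * f .e * f .b ^ (n - 2) * f .a *
      f .b * f .a := by
    have m1 := mul_mem ma mbn
    have m2 := mul_mem m1 ma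
    have m3 := mul_mem m2 mb
    have m4 := mul_mem m3 me
    have m5 := mul_mem m4 mbn
    have m6 := mul_mem m5 ma
    have m7 := mul_mem m6 mb
    rw [← gE_conj hn, hJ.mul _ m7 _ ma, hJ.mul _ m6 _ mb, hJ.mul _ m5 _ ma, hJ.mul _ m4 _ mbn,
      hJ.mul _ m3 _ me, hJ.mul _ m2 _ mb, hJ.mul _ m1 _ ma, hJ.mul _ ma _ mbn, hbn, ha, hb, he]
  have hξ : J (gA n * (gB n * gE n) ^ (n - 3) * gD n) =
      f .a * (f .b * f .e) ^ (n - 3) * f .d := by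
    have m1 := mul_mem mb me
    rw [hJ.mul _ (mul_mem ma (pow_mem m1 _)) _ md, hJ.mul _ ma _ (pow_mem m1 _), hJ.pow m1,
      hJ.mul _ mb _ me, ha, hb, he, hd]
  refine ⟨J, ⟨hJ, ?_, ?_, ?_, ?_, ?_, ?_, ?_, ?_, ?_, ?_, ?_, ?_⟩, hJg⟩
  · rw [← pow_two, h1]
  · rw [ha, he, h2]
  · rw [hf', h3]
  · rw [hf', h4]
  · rw [hf', hd, h5]
  · rw [hswap, ← h6]; simp only [mul_assoc]
  · rw [hba, ← h7, mul_assoc]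
  · rw [hdel, ← h8]; simp only [mul_assoc]
  · rw [hcol, ← h9]; simp only [mul_assoc]
  · rw [hz, h10]
  · rw [← gZ_mul_gZ hn, hJ.mul _ mz _ mz, hz, ← pow_two, h11]
  · rw [hd, hz, hbn, hξ, h12]

/-- The monoid presented by `⟨a₀, b₀, e₀, f₀, c₀, d, z | R_w⟩`, with its normal forms: the values
of the words on the smaller alphabet are given by a map `J`, every element is a normal form, and
`E` evaluates elements as transformations. -/
theorem exists_weakRel_presented (hn : 4 ≤ n) (hR₀ : Defines R₀ (PTzeta n) (genT n)) :
    ∃ (J : PT (Fin n) → PresentedMonoid (fun u v => (u, v) ∈ relW n R₀))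
      (E : PresentedMonoid (fun u v => (u, v) ∈ relW n R₀) →* PT (Fin n)),
      (∀ w, E (PresentedMonoid.mk _ w) = FreeMonoid.lift (genW n) w) ∧
      (∀ α ∈ PsEnd (starS n), E (J α) = α) ∧
      (∀ u : FreeMonoid LetterS,
        J (evalS n u) = PresentedMonoid.mk _ (FreeMonoid.map LetterS.toW u)) ∧
      ∀ q, WeakRel.Form J (PresentedMonoid.of _ .c) q := by
  let r : FreeMonoid LetterW → FreeMonoid LetterW → Prop := fun u v => (u, v) ∈ relW n R₀
  obtain ⟨J, hJ, hJg⟩ := exists_weakRel hn hR₀ (PresentedMonoid.of r) fun u v h => by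
    rw [← mk_eq_lift, ← mk_eq_lift]; exact PresentedMonoid.mk_eq_mk_of_rel h
  have hJw : ∀ u : FreeMonoid LetterS,
      J (evalS n u) = PresentedMonoid.mk r (FreeMonoid.map LetterS.toW u) := by
    intro u
    rw [evalS, hJ.rep.apply_lift (genS_mem hn), mk_eq_lift, lift_map_eq]
    simp only [hJg]
  let E : PresentedMonoid r →* PT (Fin n) := PresentedMonoid.lift (genW n) (relW_sound hn hR₀)
  have hEmk : ∀ w, E (PresentedMonoid.mk r w) = FreeMonoid.lift (genW n) w := fun w => rfl
  refine ⟨J, E, hEmk, ?_, hJw, ?_⟩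
  · intro α hα
    obtain ⟨w, rfl⟩ := (defines_PsEnd hn hR₀).exists_word hα
    rw [show FreeMonoid.lift (genS n) w = evalS n w from rfl, hJw, hEmk, lift_map_eq]
    rfl
  · intro q
    obtain ⟨w, rfl⟩ := PresentedMonoid.surjective_mk q
    rw [mk_eq_lift]
    refine lift_induction _ (WeakRel.Form J (PresentedMonoid.of r .c))
      (Or.inl ⟨1, one_mem _, hJ.rep.one.symm⟩) (fun q x hq => ?_) w
    cases x
    · exact hJg .a ▸ hJ.form_mul hn hq (gA_mem hn)
    · exact hJg .b ▸ hJ.form_mul hn hq (gB_mem hn)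
    · exact hJg .e ▸ hJ.form_mul hn hq (gE_mem hn)
    · exact hJg .f ▸ hJ.form_mul hn hq (gF_mem hn)
    · exact hJ.form_mul_c hn hq
    · exact hJg .d ▸ hJ.form_mul_d hn hq
    · exact hJg .z ▸ hJ.form_mul_z hn hq

/-- The presentation `⟨a₀, b₀, e₀, f₀, c₀, d, z | R_w⟩` defines `PwEnd(S_n)`. -/
theorem defines_PwEnd (hn : 4 ≤ n) (hR₀ : Defines R₀ (PTzeta n) (genT n)) :
    Defines (relW n R₀) (PwEnd (starS n)) (genW n) := by
  obtain ⟨J, E, hE, hEJ, -, hform⟩ := exists_weakRel_presented hn hR₀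
  have hc : E (PresentedMonoid.of _ .c) = gC n := by
    rw [← show FreeMonoid.lift (genW n) (FreeMonoid.of .c) = gC n from rfl, ← hE]; rfl
  refine Defines.of_words (genW_mem hn) (relW_sound hn hR₀) (fun α hα => ?_) fun u v huv => ?_
  · obtain ⟨q, -, rfl⟩ := WeakRel.exists_form hn E hEJ hc hα
    obtain ⟨w, rfl⟩ := PresentedMonoid.surjective_mk q
    exact ⟨w, (hE w).symm⟩
  · refine PresentedMonoid.mk_eq_mk_iff.1
      (WeakRel.form_unique hn E hEJ hc (hform _) (hform _) ?_)
    rw [hE, hE, huv]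

instance PT.finite {V : Type*} [Finite V] : Finite (PT V) :=
  Finite.of_injective (fun α : PT V => α.toFun) fun _ _ h => PT.ext h

/-- Words in a set of canonical forms are determined by their values. -/
theorem IsCanonicalForms.surjOn_injOn {X T : Type*} [Monoid T] [Finite T]
    {R : Set (FreeMonoid X × FreeMonoid X)} {M : Submonoid T} {g : X → T} (h : Defines R M g)
    {W : Set (FreeMonoid X)} (hW : IsCanonicalForms R M W) :
    Set.SurjOn (FreeMonoid.lift g) W M ∧ Set.InjOn (FreeMonoid.lift g) W := by
  have hs : Set.SurjOn (FreeMonoid.lift g) W M := by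
    intro α hα
    obtain ⟨w, rfl⟩ := h.exists_word hα
    obtain ⟨w', hw', hc⟩ := hW.1 w
    exact ⟨w', hw', (h.lift_eq hc).symm⟩
  refine ⟨hs, ?_⟩
  have hcard : ENat.card M = (M : Set T).encard := rfl
  have hfin : W.Finite := by
    rw [← Set.encard_lt_top_iff]
    refine hW.2.trans_lt ?_
    rw [hcard, Set.encard_lt_top_iff]
    exact Set.toFinite _
  refine hfin.injOn_of_encard_image_eq (le_antisymm (Set.encard_image_le _ _) ?_)
  exact hW.2.trans (hcard.le.trans (Set.encard_le_encard hs))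

/-- The words in `W_w` represent the normal forms modulo `R_w`. -/
theorem exists_mem_setWw (hn : 4 ≤ n) (hR₀ : Defines R₀ (PTzeta n) (genT n))
    {Ws : Set (FreeMonoid LetterS)} (hWs : IsCanonicalForms (relS n R₀) (PsEnd (starS n)) Ws)
    (w : FreeMonoid LetterW) :
    ∃ w' ∈ setWw n Ws, conGen (fun u v => (u, v) ∈ relW n R₀) w w' := by
  obtain ⟨J, E, hE, hEJ, hJw, hform⟩ := exists_weakRel_presented hn hR₀
  have hsurj := (hWs.surjOn_injOn (defines_PsEnd hn hR₀)).1
  have hword : ∀ α ∈ PsEnd (starS n), ∃ u ∈ Ws, evalS n u = α := fun α hα => hsurj hα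
  rcases hform (PresentedMonoid.mk _ w) with ⟨α, hα, hq⟩ | ⟨k, hk, α, hα, hq⟩ |
    ⟨α, hα, y, hy, hq⟩
  · obtain ⟨u, hu, rfl⟩ := hword α hα
    rw [hJw] at hq
    exact ⟨_, Or.inl (Or.inl ⟨u, hu, rfl⟩), PresentedMonoid.mk_eq_mk_iff.1 hq⟩
  · obtain ⟨u, hu, rfl⟩ := hword α hα.1
    obtain ⟨v, hv, hvk⟩ := hword _ (sigma_mem_PsEnd hn hk)
    rw [← hvk, hJw, hJw] at hq
    exact ⟨_, Or.inl (Or.inr ⟨k, hk, u, hu, v, hv, hα, hvk, rfl⟩),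
      PresentedMonoid.mk_eq_mk_iff.1 hq⟩
  · obtain ⟨u, hu, rfl⟩ := hword α (setD_subset_PsEnd hn hα)
    have hz : J (gZ n) = PresentedMonoid.mk _ (FreeMonoid.of .z) := hJw (FreeMonoid.of .z)
    have hb : J (gB n ^ (y.val - 1)) =
        PresentedMonoid.mk _ (FreeMonoid.of LetterW.b ^ (y.val - 1)) := by
      have := hJw (FreeMonoid.of .b ^ (y.val - 1))
      rw [map_pow, map_pow] at this
      exact this
    rw [hz, hb, hJw] at hq
    exact ⟨_, Or.inr ⟨u, hu, y.val - 1, by omega, hα, rfl⟩, PresentedMonoid.mk_eq_mk_iff.1 hq⟩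

/-- Words in `W_w` are determined by their values. -/
theorem injOn_setWw (hn : 4 ≤ n) (hR₀ : Defines R₀ (PTzeta n) (genT n))
    {Ws : Set (FreeMonoid LetterS)} (hWs : IsCanonicalForms (relS n R₀) (PsEnd (starS n)) Ws) :
    Set.InjOn (FreeMonoid.lift (genW n)) (setWw n Ws) := by
  have hinj : ∀ u ∈ Ws, ∀ v ∈ Ws, evalS n u = evalS n v → u = v :=
    fun u hu v hv huv => (hWs.surjOn_injOn (defines_PsEnd hn hR₀)).2 hu hv huv
  have hval : ∀ u, FreeMonoid.lift (genW n) (FreeMonoid.map LetterS.toW u) = evalS n u :=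
    fun u => lift_map_eq _ _ _
  have hs : ∀ u, evalS n u ∈ PsEnd (starS n) := fun u => lift_mem (genS_mem hn) u
  have hk : ∀ k : Fin n, k ≠ 0 → ∀ α ∈ setDk k, α * gC n * sigma k ∈ setGammak k :=
    fun k hk α hα => (bijOn_setGammak hn hk).mapsTo hα
  have h0 : ∀ α ∈ setD n, ∀ l, l ≤ n - 2 → ∃ y : Fin n, y ≠ 0 ∧ y.val - 1 = l ∧
      α * gC n * gZ n * gB n ^ l ∈ setGamma0 n := by
    intro α hα l hl
    have hy : (⟨l + 1, by omega⟩ : Fin n) ≠ 0 := by rw [Ne, Fin.ext_iff, val_zero]; simp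
    exact ⟨_, hy, Nat.add_sub_cancel l 1, (bijOn_setGamma0 hn).mapsTo
      (show (α, (⟨l + 1, by omega⟩ : Fin n)) ∈ setD n ×ˢ {y : Fin n | y ≠ 0} from ⟨hα, hy⟩)⟩
  have v8 : ∀ u v, FreeMonoid.lift (genW n) (FreeMonoid.map LetterS.toW u *
      FreeMonoid.of LetterW.c * FreeMonoid.map LetterS.toW v) = evalS n u * gC n * evalS n v := by
    intro u v
    rw [map_mul, map_mul, hval, hval, FreeMonoid.lift_eval_of]; rfl
  have v9 : ∀ u l, FreeMonoid.lift (genW n) (FreeMonoid.map LetterS.toW u *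
      FreeMonoid.of LetterW.c * FreeMonoid.of LetterW.z * FreeMonoid.of LetterW.b ^ l) =
      evalS n u * gC n * gZ n * gB n ^ l := by
    intro u l
    rw [map_mul, map_mul, map_mul, map_pow, hval, FreeMonoid.lift_eval_of,
      FreeMonoid.lift_eval_of, FreeMonoid.lift_eval_of]; rfl
  rintro _ ((⟨u, hu, rfl⟩ | ⟨k, hk0, u, hu, v, hv, hα, hvk, rfl⟩) | ⟨u, hu, l, hl, hα, rfl⟩) _
    ((⟨u', hu', rfl⟩ | ⟨k', hk0', u', hu', v', hv', hα', hvk', rfl⟩) |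
      ⟨u', hu', l', hl', hα', rfl⟩) heq <;>
    simp only [hval, v8, v9] at heq
  · rw [hinj u hu u' hu' heq]
  · rw [hvk'] at heq
    exact absurd (heq ▸ hs u) (hk k' hk0' _ hα').2.1
  · obtain ⟨y, hy, hyl, hm⟩ := h0 _ hα' l' hl'
    exact absurd (heq ▸ hs u) hm.2.1
  · rw [hvk] at heq
    exact absurd (heq ▸ hs u') (hk k hk0 _ hα).2.1
  · rw [hvk, hvk'] at heq
    have hkk : k = k' := by
      have h1 := (hk k hk0 _ hα).2.2.1
      rw [heq] at h1
      exact h1.unique (hk k' hk0' _ hα').2.2.1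
    subst hkk
    rw [hinj u hu u' hu' ((bijOn_setGammak hn hk0).injOn hα hα' heq),
      hinj v hv v' hv' (hvk.trans hvk'.symm)]
  · obtain ⟨y, hy, hyl, hm⟩ := h0 _ hα' l' hl'
    rw [hvk] at heq
    exact absurd (heq ▸ hm) (notMem_setGamma0 (hk k hk0 _ hα))
  · obtain ⟨y, hy, hyl, hm⟩ := h0 _ hα l hl
    exact absurd (heq ▸ hs u') hm.2.1
  · obtain ⟨y, hy, hyl, hm⟩ := h0 _ hα l hl
    rw [hvk'] at heq
    exact absurd (heq ▸ hm) (notMem_setGamma0 (hk k' hk0' _ hα'))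
  · obtain ⟨y, hy, rfl, -⟩ := h0 _ hα l hl
    obtain ⟨y', hy', rfl, -⟩ := h0 _ hα' l' hl'
    have := (bijOn_setGamma0 hn).injOn
      (show (evalS n u, y) ∈ setD n ×ˢ {y : Fin n | y ≠ 0} from ⟨hα, hy⟩)
      (show (evalS n u', y') ∈ setD n ×ˢ {y : Fin n | y ≠ 0} from ⟨hα', hy'⟩) heq
    rw [Prod.mk.injEq] at this
    rw [hinj u hu u' hu' this.1, this.2]

theorem encard_setWw (hn : 4 ≤ n) (hR₀ : Defines R₀ (PTzeta n) (genT n))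
    {Ws : Set (FreeMonoid LetterS)} (hWs : IsCanonicalForms (relS n R₀) (PsEnd (starS n)) Ws) :
    (setWw n Ws).encard = ENat.card (PwEnd (starS n)) := by
  have hcard : ENat.card (PwEnd (starS n)) = (PwEnd (starS n) : Set (PT (Fin n))).encard := rfl
  have himage : FreeMonoid.lift (genW n) '' setWw n Ws = PwEnd (starS n) := by
    refine Set.Subset.antisymm ?_ fun α hα => ?_
    · rintro _ ⟨w, -, rfl⟩
      exact lift_mem (genW_mem hn) w
    · have hdef := defines_PwEnd hn hR₀
      obtain ⟨w, rfl⟩ := hdef.exists_word hα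
      obtain ⟨w', hw', hc⟩ := exists_mem_setWw hn hR₀ hWs w
      exact ⟨w', hw', (hdef.lift_eq hc).symm⟩
  rw [hcard, ← himage, (injOn_setWw hn hR₀ hWs).encard_image]

end WeakPresentation

end StarEnd


theorem theorem6p5 (n : ℕ) [NeZero n] (hn : 4 ≤ n)
    (R₀ : Set (FreeMonoid LetterT × FreeMonoid LetterT))
    (hR₀ : Defines R₀ (PTzeta n) (genT n)) :
    Defines (relW n R₀) (PwEnd (starS n)) (genW n) ∧
    (∀ Ws : Set (FreeMonoid LetterS), 1 ∈ Ws →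
      IsCanonicalForms (relS n R₀) (PsEnd (starS n)) Ws →
      IsCanonicalForms (relW n R₀) (PwEnd (starS n)) (setWw n Ws) ∧
      (setWw n Ws).encard = ENat.card (PwEnd (starS n))) ∧
    (∀ k : Fin n, k ≠ 0 →
      Set.BijOn (fun α => α * gC n * sigma k) (setDk k) (setGammak k)) ∧
    (setGamma0 n).ncard = (n - 1) * (setD n).ncard := by
  refine ⟨defines_PwEnd hn hR₀, fun Ws _ hWs => ?_, fun k hk => bijOn_setGammak hn hk,
    ncard_setGamma0 hn⟩
  have hcard := encard_setWw hn hR₀ hWs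
  exact ⟨⟨exists_mem_setWw hn hR₀ hWs, hcard.le⟩, hcard⟩
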